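/- **Setting.** Let $r\ge 0$, $T\ge 1$, and let $\mu_i,s_i,d_i\ge 1$ ($i=1,\dots,r$) be integers. Put $$\chi_\mu(B)=\prod_{i=1}^r(1-B^{\mu_is_i})^{d_i}=\sum_{k=0}^{n}e(k)B^k,\qquad n=\sum_i\mu_is_id_i,\qquad \sum_{k\ge0}d_\mu(k)x^k=\prod_{i=1}^r\Big(\sum_{j\ge0}x^{\mu_is_ij}\Big)^{d_i},$$ where $B$ is the backward shift, and $$\chi_\mu(e^{-i\lambda})=\prod_{j=1}^r(1-e^{-i\lambda\mu_js_j})^{d_j},\qquad \beta(i\lambda)=\prod_{j=1}^r\ \prod_{|k|\le[s_j/2]}(i\lambda-2\pi i k/s_j)^{d_j}.$$ Let $\vec\xi(m)=(\xi_1(m),\dots,\xi_T(m))^\top$, $m\in\mathbb Z$, be a sequence of complex random vectors whose increments $\chi_\mu\xi_p(m)=\sum_k e(k)\xi_p(m-k)$ are in $L_2(P)$, have mean zero, and are wide sense stationary with spectral density matrix $f$ (with respect to $d\lambda/2\pi$): $f(\lambda)$ is positive semidefinite for almost every $\lambda$, $\frac{|\chi_\mu|^2}{|\beta|^2}f$ is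 integrable on $[-\pi,\pi)$ and $$\mathsf E\,\chi_\mu\xi_p(m)\overline{\chi_\mu\xi_q(l)}=\frac1{2\pi}\int_{-\pi}^{\pi}e^{i\lambda(m-l)}\frac{|\chi_\mu(e^{-i\lambda})|^2}{|\beta(i\lambda)|^2}f_{pq}(\lambda)\,d\lambda .$$ Assume the minimality condition: $f$ is invertible a.e., and for $G=\frac{|\beta(i\lambda)|^2}{|\chi_\mu(e^{-i\lambda})|^2}f^{-1}(\lambda)$ the function $\operatorname{Tr}G$ is integrable on $[-\pi,\pi)$. Let $\vec Z$ be a vector stochastic measure on $[-\pi,\pi)$ with $\mathsf E Z_p(A)\overline{Z_q(A')}=\frac1{2\pi}\int_{A\cap A'}f_{pq}\,d\lambda$ for Borel sets $A,A'$ on which $f_{pp}$, respectively $f_{qq}$, is integrable, and such that $\chi_\mu\xi_p(m)=\int e^{im\lambda}\frac{\chi_\mu(e^{-i\lambda})}{\beta(i\lambda)}dZ_p(\lambda)$ for all $m,p$. Let $H^{0-}$ be the closed span in $L_2(P)$ of $\chi_\mu\xi_q(k)$, $k\le-1$, $1\le q\le T$. A linear estimate of $\xi_p(N)$ ($N\ge0$)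 from the observations $\vec\xi(m)$, $m\le-1$, is an element of $H^{0-}$ plus a finite linear combination of observed values which is exact (reproduces $x_p(N)$) on every deterministic sequence $\vec x$ with $\chi_\mu\vec x=0$. It is optimal if its mean square error is least among all linear estimates. Let $F_\mu$ be the operator in $\ell_2$ (square summable sequences $c=(\vec c(0),\vec c(1),\dots)$ in $\mathbb C^T$) with the $T\times T$ matrix blocks $(F_\mu)_{jk}=\frac1{2\pi}\int_{-\pi}^{\pi}e^{i\lambda(k-j)}G(\lambda)^\top d\lambda$, $j,k\ge0$. Since $G$ is integrable but possibly unbounded, this means: with $\vec C(e^{i\lambda})=\sum_{k\ge0}\vec c(k)e^{i\lambda k}$, the domain of $F_\mu$ consists of all $c\in\ell_2$ with $\int\vec C^{\,\top}G\,\overline{\vec C}\,d\lambda<\infty$, and $(F_\mu c)(j)=\frac1{2\pi}\int e^{-ij\lambda}G^\top\vec C\,d\lambda$. Let $\boldsymbol\delta_p$ be the $p$-th unit vector and $d_{\mu,N,p}=(d_\mu(N)\boldsymbol\delta_p,d_\mu(N-1)\boldsymbol\delta_p,\dots,d_\mu(0)\boldsymbol\delta_p,0,0,\dots)$. **Statement.**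 A stochastic measure $\vec Z$ as above exists. For $1\le p\le T$ and $N\ge0$ the optimal linear estimate $\widehat\xi_p(N)$ exists and is almost surely unique, and for every such $\vec Z$ $$\widehat\xi_p(N)=\int_{-\pi}^{\pi}(\vec h(\lambda))^\top d\vec Z(\lambda)-\sum_{k=-n}^{-1}v_N(k)\,\xi_p(k),\qquad v_N(k)=\sum_{l=0}^{N\wedge(k+n)}e(l-k)\,d_\mu(N-l).$$ The equation $F_\mu c=d_{\mu,N,p}$ has exactly one solution $c=F_\mu^{-1}d_{\mu,N,p}$, and the spectral characteristic is $$(\vec h(\lambda))^\top=\frac{\chi_\mu(e^{-i\lambda})}{\beta(i\lambda)}\Big(\boldsymbol\delta_p\sum_{k=0}^Nd_\mu(N-k)e^{i\lambda k}\Big)^{\!\top}-\frac{\overline{\beta(i\lambda)}}{\chi_\mu(e^{i\lambda})}\Big(\sum_{k=0}^\infty(F_\mu^{-1}d_{\mu,N,p})_k\,e^{i\lambda k}\Big)^{\!\top}f^{-1}(\lambda).$$ The mean square error is $$\mathsf E|\xi_p(N)-\widehat\xi_p(N)|^2=\mathsf E\Big|\sum_{k=0}^Nd_\mu(N-k)\chi_\mu\xi_p(k)-\int\vec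 h^\top d\vec Z\Big|^2=\frac1{2\pi}\int_{-\pi}^{\pi}\frac{|\beta(i\lambda)|^2}{|\chi_\mu(e^{-i\lambda})|^2}\vec C^{\,\top}f^{-1}\,\overline{\vec C}\,d\lambda=\langle d_{\mu,N,p},F_\mu^{-1}d_{\mu,N,p}\rangle,$$ where $\vec C(e^{i\lambda})=\sum_k(F_\mu^{-1}d_{\mu,N,p})_ke^{i\lambda k}$ and $\langle x,y\rangle=\sum_k x(k)^\top\overline{y(k)}$. Suppose in addition that $\mu_is_i>N$ for all $i$ and that there is a canonical factorization: there are an orthonormal system $\varepsilon_j(u)$ ($1\le j\le q$, $u\in\mathbb Z$) in $L_2(P)$ such that for every $m$ the closed spans of $\{\varepsilon_j(u):u\le m\}$ and of $\{\chi_\mu\xi_p(u):u\le m\}$ coincide, and $T\times q$ matrices $\varphi_\mu(k)$ with $\sum_k\|\varphi_\mu(k)\|^2<\infty$, $\chi_\mu\vec\xi(m)=\sum_{k\ge0}\varphi_\mu(k)\vec\varepsilon(m-k)$, and $\frac{|\chi_\mu|^2}{|\beta|^2}f=\Phi_\mu(e^{-i\lambda})\Phi_\mu^*(e^{-i\lambda})$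 a.e., where $\Phi_\mu(e^{-i\lambda})=\sum_k\varphi_\mu(k)e^{-i\lambda k}$. Then there is $\Psi_\mu$ with $\Psi_\mu(e^{-i\lambda})\Phi_\mu(e^{-i\lambda})=E_q$ a.e. ($E_q$ the identity matrix), and for every such $\Psi_\mu$ the spectral characteristic and the error can be calculated by $$\vec h(\lambda)=\frac{\chi_\mu(e^{-i\lambda})}{\beta(i\lambda)}e^{iN\lambda}\Big[\boldsymbol\delta_p-(\Psi_\mu(e^{-i\lambda}))^\top\Big(\sum_{k=0}^N\varphi_\mu(k)e^{-i\lambda k}\Big)^{\!\top}\boldsymbol\delta_p\Big],$$ $$\mathsf E|\xi_p(N)-\widehat\xi_p(N)|^2=\frac1{2\pi}\int_{-\pi}^{\pi}\Big[\boldsymbol\delta_p^\top\sum_{k=0}^N\varphi_\mu(k)e^{-i\lambda k}\Big]\Big[\boldsymbol\delta_p^\top\sum_{k=0}^N\varphi_\mu(k)e^{-i\lambda k}\Big]^*d\lambda=\sum_{k=0}^N\sum_{j=1}^q|\varphi_{\mu,p,j}(k)|^2.$$ -/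

import Mathlib

open MeasureTheory Complex Matrix
open scoped Real ENNReal ComplexOrder

noncomputable section

namespace GMForecast

instance factTwoPiPos : Fact (0 < 2 * π) := ⟨Real.two_pi_pos⟩

/-! ### Generalized multiple increments -/

/-- The parameters of a generalized multiple (GM) increment: steps `mu i`, seasons `s i` and
orders `d i`, all of them positive integers. -/
structure GMParams where
  r : ℕ
  mu : Fin r → ℕ
  s : Fin r → ℕ
  d : Fin r → ℕ
  mu_pos : ∀ i, 0 < mu i
  s_pos : ∀ i, 0 < s i
  d_pos : ∀ i, 0 < d i

namespace GMParams

variable (γ : GMParams)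

/-- The GM increment of a scalar sequence `x` at time `m`,
`∑_{l₁ ≤ d₁} ⋯ ∑_{l_r ≤ d_r} ∏ᵢ (-1)^{lᵢ} (dᵢ choose lᵢ) x(m - ∑ᵢ μᵢ sᵢ lᵢ)`. -/
def inc (x : ℤ → ℂ) (m : ℤ) : ℂ :=
  ∑ l ∈ Fintype.piFinset (fun i => Finset.range (γ.d i + 1)),
    (∏ i, (-1 : ℂ) ^ l i * ((γ.d i).choose (l i) : ℂ)) *
      x (m - ∑ i, ((γ.mu i * γ.s i * l i : ℕ) : ℤ))

/-- `n(γ) = ∑ᵢ μᵢ sᵢ dᵢ`, the degree of the increment operator in the backward shift. -/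
def deg : ℕ := ∑ i, γ.mu i * γ.s i * γ.d i

/-- `e_γ(k)`: the coefficient of `B^k` in `∏ᵢ (1 - B^{μᵢ sᵢ})^{dᵢ}`. -/
def e (k : ℕ) : ℂ :=
  (∏ i, (1 - (Polynomial.X : Polynomial ℂ) ^ (γ.mu i * γ.s i)) ^ γ.d i).coeff k

/-- `d_μ(k)`: the coefficient of `x^k` in `∏ᵢ (∑_j x^{μᵢ sᵢ j})^{dᵢ}`. -/
def dcoef (k : ℕ) : ℂ :=
  PowerSeries.coeff k
    (∏ i, (PowerSeries.mk (fun n => if γ.mu i * γ.s i ∣ n then (1 : ℂ) else 0)) ^ γ.d i)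

/-- `χ_μ(e^{-it}) = ∏_j (1 - e^{-i t μ_j s_j})^{d_j}`. -/
def chi (t : ℝ) : ℂ :=
  ∏ j, (1 - exp (-(I * t * (γ.mu j * γ.s j : ℕ)))) ^ γ.d j

/-- `β(it) = ∏_j ∏_{|k| ≤ [s_j/2]} (it - 2πik/s_j)^{d_j}`. -/
def beta (t : ℝ) : ℂ :=
  ∏ j, ∏ k ∈ Finset.Icc (-((γ.s j / 2 : ℕ) : ℤ)) ((γ.s j / 2 : ℕ) : ℤ),
    (I * t - 2 * π * I * (k : ℂ) / (γ.s j : ℂ)) ^ γ.d j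

/-- `|χ_μ(e^{-it})|² / |β(it)|²`. -/
def weight (t : ℝ) : ℝ := ‖γ.chi t‖ ^ 2 / ‖γ.beta t‖ ^ 2

/-- The coefficient `v_{N,p}(-j) = ∑_{l=0}^{N ∧ (n(γ)-j)} e_γ(l + j) d_μ(N - l)`, `1 ≤ j ≤ n(γ)`,
of the observed initial value `ξ_p(-j)`. -/
def v (N j : ℕ) : ℂ :=
  ∑ l ∈ Finset.range (min N (γ.deg - j) + 1), γ.e (l + j) * γ.dcoef (N - l)

end GMParams

/-! ### Stationary GM increment sequences with a spectral density -/

/-- The interval `[-π, π)`. -/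
def freq : Set ℝ := Set.Ico (-π) π

variable {Ω : Type*} [MeasurableSpace Ω] {P : Measure Ω} {T : ℕ}

/-- The GM increments of the vector sequence `ξ` (with classes `X m p` in `L²(P)`) have mean zero,
are wide sense stationary, and have the spectral density `f` (with respect to `dt / 2π`):
`E χξ_p(m) conj(χξ_q(n)) = (1/2π) ∫ e^{it(m-n)} |χ_μ(e^{-it})|² / |β(it)|² f_pq(t) dt`. -/
structure HasSpectralDensity (γ : GMParams) (P : Measure Ω) (ξ : ℤ → Fin T → Ω → ℂ)
    (X : ℤ → Fin T → Lp ℂ 2 P) (f : ℝ → Matrix (Fin T) (Fin T) ℂ) : Prop where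
  aestronglyMeasurable : ∀ m p, AEStronglyMeasurable (ξ m p) P
  increment : ∀ m p, X m p =ᵐ[P] fun ω => γ.inc (fun k => ξ k p ω) m
  mean_zero : ∀ m p, ∫ ω, X m p ω ∂P = 0
  posSemidef : ∀ᵐ t ∂volume.restrict freq, (f t).PosSemidef
  integrable : ∀ p q, IntegrableOn (fun t => (γ.weight t : ℂ) * f t p q) freq
  covariance : ∀ m n p q, inner ℂ (X n q) (X m p) =
    (1 / (2 * π) : ℂ) * ∫ t in freq,
      exp (I * t * ((m - n : ℤ) : ℂ)) * ((γ.weight t : ℂ) * f t p q)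

/-- The matrix function `|β(it)|² / |χ_μ(e^{-it})|² f(t)⁻¹`. -/
def symbol (γ : GMParams) (f : ℝ → Matrix (Fin T) (Fin T) ℂ) (t : ℝ) : Matrix (Fin T) (Fin T) ℂ :=
  (((γ.weight t)⁻¹ : ℝ) : ℂ) • (f t)⁻¹

/-- The minimality condition: `f` is invertible almost everywhere and
`∫ Tr [|β|² / |χ_μ|² f⁻¹] dt < ∞`. -/
def MinimalityCondition (γ : GMParams) (f : ℝ → Matrix (Fin T) (Fin T) ℂ) : Prop :=
  (∀ᵐ t ∂volume.restrict freq, IsUnit (f t).det) ∧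
    IntegrableOn (fun t => (symbol γ f t).trace) freq

/-! ### The orthogonal stochastic measure of the increments and the stochastic integral -/

/-- The squared seminorm `∫ u(t)ᵀ f(t) conj(u(t)) dt` of `L²(f)`. -/
def sqNorm (f : ℝ → Matrix (Fin T) (Fin T) ℂ) (u : ℝ → Fin T → ℂ) : ℝ≥0∞ :=
  ∫⁻ t in freq, ENNReal.ofReal (u t ⬝ᵥ (f t *ᵥ star (u t))).re

/-- Borel subsets of `[-π, π)` on which the `p`-th spectral measure is finite (all Borel subsets
when `f` is integrable). -/
def Admissible (f : ℝ → Matrix (Fin T) (Fin T) ℂ) (p : Fin T) (A : Set ℝ) : Prop :=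
  MeasurableSet A ∧ A ⊆ freq ∧ IntegrableOn (fun t => f t p p) A

/-- `Y = ∫ h(t)ᵀ dZ(t)`: the variable `Y` is the limit in `L²(P)` of the integrals of step functions
that converge to `h` in `L²(f)`. -/
def IsStochInt (f : ℝ → Matrix (Fin T) (Fin T) ℂ) (Z : Fin T → Set ℝ → Lp ℂ 2 P)
    (h : ℝ → Fin T → ℂ) (Y : Lp ℂ 2 P) : Prop :=
  ∀ ε : ℝ, 0 < ε → ∃ (n : ℕ) (a : Fin n → ℂ) (q : Fin n → Fin T) (A : Fin n → Set ℝ),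
    (∀ i, Admissible f (q i) (A i)) ∧
    sqNorm f (fun t => h t - ∑ i, (A i).indicator (fun _ => Pi.single (q i) (a i)) t)
      < ENNReal.ofReal ε ∧
    ‖Y - ∑ i, a i • Z (q i) (A i)‖ < ε

/-- `Z` is the vector stochastic measure of the spectral representation of the increments: it has
uncorrelated values on disjoint sets, with `E Z_p(A) conj(Z_q(B)) = (1/2π) ∫_{A ∩ B} f_pq(t) dt`,
and `χξ_p(m) = ∫ e^{imt} χ_μ(e^{-it}) / β(it) dZ_p(t)`. -/
structure IsSpectralProcess (γ : GMParams) (X : ℤ → Fin T → Lp ℂ 2 P)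
    (f : ℝ → Matrix (Fin T) (Fin T) ℂ) (Z : Fin T → Set ℝ → Lp ℂ 2 P) : Prop where
  covariance : ∀ p q A B, Admissible f p A → Admissible f q B →
    inner ℂ (Z q B) (Z p A) = (1 / (2 * π) : ℂ) * ∫ t in A ∩ B, f t p q
  representation : ∀ (m : ℤ) (p : Fin T), IsStochInt f Z
    (fun t => Pi.single p (exp (I * t * (m : ℂ)) * (γ.chi t / γ.beta t))) (X m p)

/-! ### Linear estimates -/

/-- The closed linear subspace of `L²(P)` generated by `X k p`, `k ≤ n`. -/
def past {ι : Type*} (X : ℤ → ι → Lp ℂ 2 P) (n : ℤ) : Submodule ℂ (Lp ℂ 2 P) :=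
  (Submodule.span ℂ {x | ∃ k ≤ n, ∃ p, x = X k p}).topologicalClosure

/-- `η` is a linear estimate of `ξ_p(N)` from the observations `ξ(m)`, `m ≤ -1`: the sum of an element
of the closed span `H^{0-}` of the observed increments and of a finite linear combination of
observed values. The values of `ξ` themselves need not have second moments, only the increments do;
so the finite combination has to be exact on the deterministic sequences whose GM increments vanish
(equivalently, the error of the estimate is a function of the increments alone). -/
def IsLinearEstimate (γ : GMParams) (ξ : ℤ → Fin T → Ω → ℂ) (X : ℤ → Fin T → Lp ℂ 2 P)
    (p : Fin T) (N : ℕ) (η : Ω → ℂ) : Prop :=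
  ∃ (c : ℤ × Fin T →₀ ℂ) (Y : Lp ℂ 2 P),
    (∀ a ∈ c.support, a.1 ≤ -1) ∧
    (∀ x : ℤ → Fin T → ℂ, (∀ m q, γ.inc (fun k => x k q) m = 0) →
      c.sum (fun a z => z * x a.1 a.2) = x N p) ∧
    Y ∈ past X (-1) ∧
    η =ᵐ[P] fun ω => c.sum (fun a z => z * ξ a.1 a.2 ω) + Y ω

/-- `η` is a linear estimate of `ξ_p(N)` with the least mean square error. -/
def IsOptimal (γ : GMParams) (ξ : ℤ → Fin T → Ω → ℂ) (X : ℤ → Fin T → Lp ℂ 2 P)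
    (p : Fin T) (N : ℕ) (η : Ω → ℂ) : Prop :=
  IsLinearEstimate γ ξ X p N η ∧ ∀ η', IsLinearEstimate γ ξ X p N η' →
    ∫⁻ ω, ‖ξ N p ω - η ω‖ₑ ^ 2 ∂P ≤ ∫⁻ ω, ‖ξ N p ω - η' ω‖ₑ ^ 2 ∂P

/-- The random variable `∫ hᵀ dZ - ∑_{k=-n(γ)}^{-1} v_{N,p}(k)ᵀ ξ(k)`, where `Y = ∫ hᵀ dZ`. -/
def estimate (γ : GMParams) (ξ : ℤ → Fin T → Ω → ℂ) (p : Fin T) (N : ℕ) (Y : Lp ℂ 2 P) (ω : Ω) : ℂ :=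
  Y ω - ∑ j ∈ Finset.Icc 1 γ.deg, γ.v N j * ξ (-(j : ℤ)) p ω

/-- `h` is the spectral characteristic of the optimal linear estimate of `ξ_p(N)`, and that estimate
is `∫ hᵀ dZ - ∑_{k=-n(γ)}^{-1} v_{N,p}(k)ᵀ ξ(k)`. The mean square error of the latter is the one of
the estimate `∫ hᵀ dZ` of `∑_{k=0}^N d_μ(N-k) χξ_p(k)`, and it is equal to `Δ`. -/
def IsOptimalCharacteristic (γ : GMParams) (ξ : ℤ → Fin T → Ω → ℂ) (X : ℤ → Fin T → Lp ℂ 2 P)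
    (f : ℝ → Matrix (Fin T) (Fin T) ℂ) (p : Fin T) (N : ℕ) (h : ℝ → Fin T → ℂ) (Δ : ℝ) : Prop :=
  ∀ Z, IsSpectralProcess γ X f Z → ∃ Y : Lp ℂ 2 P,
    IsStochInt f Z h Y ∧
    IsOptimal γ ξ X p N (estimate γ ξ p N Y) ∧
    MemLp (fun ω => ξ N p ω - estimate γ ξ p N Y ω) 2 P ∧
    ∫ ω, ‖ξ N p ω - estimate γ ξ p N Y ω‖ ^ 2 ∂P = Δ ∧
    ‖∑ k ∈ Finset.range (N + 1), γ.dcoef (N - k) • X k p - Y‖ ^ 2 = Δ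

/-! ### Fourier series and the operator `F_μ` in `ℓ²` -/

/-- The sum `∑_{k ≥ 0} a(k) e^{iσkt}` in the sense of `L²[-π, π)`, for square summable `a`. -/
def fourierSum (σ : ℤ) (a : ℕ → ℂ) (t : ℝ) : ℂ :=
  ((∑' k : ℕ, a k • fourierLp (T := 2 * π) 2 (σ * k) :
    Lp ℂ 2 (AddCircle.haarAddCircle (T := 2 * π))) : AddCircle (2 * π) → ℂ) (t : AddCircle (2 * π))

/-- The space `ℓ²` of square summable sequences of vectors of dimension `T`. -/
abbrev SeqSpace (T : ℕ) : Type := lp (fun _ : ℕ => EuclideanSpace ℂ (Fin T)) 2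

/-- `C(e^{it}) = ∑_{k ≥ 0} c(k) e^{ikt}`. -/
def series (c : SeqSpace T) (t : ℝ) : Fin T → ℂ := fun q => fourierSum 1 (fun k => c k q) t

/-- `F_μ c = b`, where `F_μ` is the operator in `ℓ²` with the matrix blocks
`(1/2π) ∫ e^{it(k-j)} G(t)ᵀ dt`, `j, k ≥ 0`, and `G = |β|² / |χ_μ|² f⁻¹`. Under the minimality condition
`G` is integrable but possibly unbounded, so `F_μ` is the Toeplitz operator
`(F_μ c)(j) = (1/2π) ∫ e^{-ijt} G(t)ᵀ C(e^{it}) dt` on its natural (quadratic form) domain, all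
`c ∈ ℓ²` with `∫ C(e^{it})ᵀ G(t) conj(C(e^{it})) dt < ∞`. -/
def OpF (γ : GMParams) (f : ℝ → Matrix (Fin T) (Fin T) ℂ) (c b : SeqSpace T) : Prop :=
  IntegrableOn (fun t => series c t ⬝ᵥ (symbol γ f t *ᵥ star (series c t))) freq ∧
  ∀ (j : ℕ) (q : Fin T),
    (1 / (2 * π) : ℂ) * ∫ t in freq,
      exp (-(I * t * (j : ℂ))) * ((symbol γ f t)ᵀ *ᵥ series c t) q = b j q

/-- The vector `d_{μ,N,p} = (d_μ(N) δ_p, d_μ(N-1) δ_p, …, d_μ(0) δ_p, 0, …)` of `ℓ²`. -/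
def dvec (γ : GMParams) (N : ℕ) (p : Fin T) : SeqSpace T :=
  ∑ k ∈ Finset.range (N + 1), lp.single 2 k (EuclideanSpace.single p (γ.dcoef (N - k)))

/-- The spectral characteristic
`h(t)ᵀ = χ_μ(e^{-it}) / β(it) (δ_p ∑_{k=0}^N d_μ(N-k) e^{ikt})ᵀ`
`- conj(β(it)) / χ_μ(e^{it}) C(e^{it})ᵀ f(t)⁻¹`; note that `χ_μ(e^{it}) = conj(χ_μ(e^{-it}))`. -/
def characteristic (γ : GMParams) (f : ℝ → Matrix (Fin T) (Fin T) ℂ) (N : ℕ) (p : Fin T)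
    (c : SeqSpace T) (t : ℝ) : Fin T → ℂ :=
  (γ.chi t / γ.beta t) • (Pi.single p
      (∑ k ∈ Finset.range (N + 1), γ.dcoef (N - k) * exp (I * t * (k : ℂ))) : Fin T → ℂ) -
    (star (γ.beta t) / star (γ.chi t)) • (series c t ᵥ* (f t)⁻¹)

/-- `(1/2π) ∫ |β(it)|² / |χ_μ(e^{-it})|² C(e^{it})ᵀ f(t)⁻¹ conj(C(e^{it})) dt`. -/
def errorIntegral (γ : GMParams) (f : ℝ → Matrix (Fin T) (Fin T) ℂ) (c : SeqSpace T) : ℂ :=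
  (1 / (2 * π) : ℂ) * ∫ t in freq,
    (star (γ.beta t) / star (γ.chi t)) *
      (series c t ⬝ᵥ ((f t)⁻¹ *ᵥ star (series c t))) * (γ.beta t / γ.chi t)

/-! ### Canonical factorization -/

/-- `Φ_μ(e^{-it}) = ∑_{k ≥ 0} φ_μ(k) e^{-ikt}`. -/
def boundary {q : ℕ} (φ : ℕ → Matrix (Fin T) (Fin q) ℂ) (t : ℝ) : Matrix (Fin T) (Fin q) ℂ :=
  Matrix.of fun i j => fourierSum (-1) (fun k => φ k i j) t

/-- Canonical factorization: the increments have the canonical moving average representation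
`χξ(m) = ∑_{k ≥ 0} φ_μ(k) ε(m-k)` with an innovation sequence `ε` (orthonormal, and with the same
past as the increments at every time), and correspondingly
`|χ_μ(e^{-it})|² / |β(it)|² f(t) = Φ_μ(e^{-it}) Φ_μ(e^{-it})^*`. -/
structure IsCanonical (γ : GMParams) (X : ℤ → Fin T → Lp ℂ 2 P)
    (f : ℝ → Matrix (Fin T) (Fin T) ℂ) {q : ℕ} (ε : ℤ → Fin q → Lp ℂ 2 P)
    (φ : ℕ → Matrix (Fin T) (Fin q) ℂ) : Prop where
  orthonormal : Orthonormal ℂ (fun a : ℤ × Fin q => ε a.1 a.2)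
  same_past : ∀ n, past X n = past ε n
  summable : Summable fun k => ∑ i, ∑ j, ‖φ k i j‖ ^ 2
  movingAverage : ∀ (m : ℤ) (p : Fin T), HasSum (fun k : ℕ => ∑ j, φ k p j • ε (m - (k : ℤ)) j) (X m p)
  factorization : ∀ᵐ t ∂volume.restrict freq,
    (γ.weight t : ℂ) • f t = boundary φ t * (boundary φ t)ᴴ

/-- The row `δ_pᵀ ∑_{k=0}^N φ_μ(k) e^{-ikt}`. -/
def truncRow {q : ℕ} (φ : ℕ → Matrix (Fin T) (Fin q) ℂ) (N : ℕ) (p : Fin T) (t : ℝ) : Fin q → ℂ :=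
  (∑ k ∈ Finset.range (N + 1), exp (-(I * t * (k : ℂ))) • φ k) p

/-- `h(t) = χ_μ(e^{-it}) / β(it) e^{iNt} [δ_p - Ψ(e^{-it})ᵀ (∑_{k=0}^N φ_μ(k) e^{-ikt})ᵀ δ_p]`. -/
def canonicalCharacteristic (γ : GMParams) {q : ℕ} (φ : ℕ → Matrix (Fin T) (Fin q) ℂ)
    (Ψ : ℝ → Matrix (Fin q) (Fin T) ℂ) (N : ℕ) (p : Fin T) (t : ℝ) : Fin T → ℂ :=
  (γ.chi t / γ.beta t * exp (I * t * (N : ℂ))) •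
    ((Pi.single p 1 : Fin T → ℂ) - (Ψ t)ᵀ *ᵥ truncRow φ N p t)

end GMForecast

end

open GMForecast

/-!
Everything takes place in the frequency domain. Write `ρ = χ_μ / β`. The space `L²(f)` is identified
with `L²([-π, π), ℂ^T)` by `u ↦ f^{1/2} u` (with the square root of `fᵀ`, see `root`). Since `|ρ|² f` is
the spectral density of the increments, the map `e^{imt} ρ δ_p ↦ χξ_p(m)` preserves Gram matrices and
extends to an isometry `V` into `L²(P)` (`HasSpectralDensity.exists_isometry`). The step functions are
total in `L²(f)` as well, so that `V` provides a stochastic measure `Z`, and the integral with respect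
to any admissible `Z` is `V` (`exists_isSpectralProcess`, `IsSpectralProcess.isStochInt`).

The power series of `d_μ` inverts the increment operator: `∑_{k ≤ N} d_μ(N - k) χξ_p(k)` is `ξ_p(N)` plus
a combination of the values `ξ_p(-1), …, ξ_p(-n)`. A finite combination of observed values which
vanishes on the sequences without increments is a combination of observed increments, because the
corresponding polynomial in the backward shift is divisible by `∏ᵢ (1 - B^{μᵢ sᵢ})^{dᵢ}`. Hence the linear
estimates of `ξ_p(N)` correspond to the elements of the closed span of the observed increments, and the
optimal one to the orthogonal projection of `∑_{k ≤ N} d_μ(N - k) χξ_p(k)` (`isOptimal_iff`).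

Let `e` be the error of that projection, computed in `L²(f)`. Its inner products with the images of
the increments are the Fourier coefficients of `C = conj(ρ) f^{1/2} e`; those of negative index vanish.
The remaining ones form a sequence `c` in `ℓ²`: as `e` belongs to the past up to time `N`, it is a finite
sum of components in the innovation spaces of the times `0, …, N`, and Bessel's inequality applies to the
shifts of each of them (`summable_norm_inner_sq`). The minimality condition supplies a system dual to
the increments (`IsMinimal.dual`), and pairing it with `e` gives `F_μ c = d_{μ,N,p}` together with the
formulas for the spectral characteristic and for the error (`IsMinimal.exists_prediction`, `opF_iff`).

If `F_μ c = 0`, the Fourier coefficients of index `≥ 0` of the integrable function `u = G^⊤ C` vanish, and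
`∫ conj(u) · C` is the quadratic form of `c`. Although `u` is merely integrable and `C` merely square
integrable, the integral is `0`: `C` is a limit of bounded analytic functions which are dominated by it
(`integral_star_mul_fourierSum_eq_zero`). So `C = 0`, and `F_μ` is injective.

For a canonical factorization `φ(0)` is injective and `Φ Φ^*` is invertible, so that `q = T` and `Φ` is
invertible almost everywhere. The function `e^{iut} ρ Ψ^⊤ δ_j` represents the innovation `ε_j(u)`. If all
the steps exceed `N`, then `∑_{k ≤ N} d_μ(N - k) χξ_p(k) = χξ_p(N)`, and the error is the part
`∑_{k ≤ N} φ(k) ε(N - k)` of the moving average.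
-/

open GMForecast

noncomputable section

namespace GMForecast

/-! ### Fourier analysis on the circle -/

/-- The normalized Lebesgue measure `dt / 2π` on `[-π, π)`, as a measure on the line. -/
def circ : Measure ℝ := ENNReal.ofReal (1 / (2 * π)) • volume.restrict freq

/-- The character `t ↦ e^{ikt}`. -/
def ex (k : ℤ) (t : ℝ) : ℂ := exp (I * t * (k : ℂ))

theorem ex_add (j k : ℤ) (t : ℝ) : ex (j + k) t = ex j t * ex k t := by
  simp only [ex, ← Complex.exp_add]; push_cast; ring_nf

theorem ex_zero (t : ℝ) : ex 0 t = 1 := by simp [ex]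

theorem star_ex (k : ℤ) (t : ℝ) : star (ex k t) = ex (-k) t := by
  simp only [ex, Complex.star_def, ← Complex.exp_conj]; simp

theorem norm_ex (k : ℤ) (t : ℝ) : ‖ex k t‖ = 1 := by
  rw [ex, show I * (t : ℂ) * (k : ℂ) = ((t * k : ℝ) : ℂ) * I by push_cast; ring]
  exact Complex.norm_exp_ofReal_mul_I _

@[fun_prop] theorem continuous_ex (k : ℤ) : Continuous (ex k) := by
  unfold ex; fun_prop

theorem fourier_coe (k : ℤ) (t : ℝ) : fourier k (t : AddCircle (2 * π)) = ex k t := by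
  rw [fourier_coe_apply, ex]
  congr 1
  have : (π : ℂ) ≠ 0 := by exact_mod_cast Real.pi_ne_zero
  push_cast; field_simp

theorem measurePreserving_coe : MeasurePreserving (fun t : ℝ => (t : AddCircle (2 * π))) circ
    AddCircle.haarAddCircle := by
  have h := AddCircle.measurePreserving_mk (2 * π) (-π)
  rw [show (-π + 2 * π) = π by ring, AddCircle.volume_eq_smul_haarAddCircle] at h
  have h2 := h.smul_measure (ENNReal.ofReal (1 / (2 * π)))
  rw [smul_smul, ← ENNReal.ofReal_mul (by positivity), one_div_mul_cancel Real.two_pi_pos.ne',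
    ENNReal.ofReal_one, one_smul] at h2
  rw [circ, freq, restrict_Ico_eq_restrict_Ioc]
  exact h2

instance : IsProbabilityMeasure circ where
  measure_univ := by
    have := measurePreserving_coe.measure_preimage (s := Set.univ) MeasurableSet.univ.nullMeasurableSet
    rw [Set.preimage_univ] at this
    rw [this]; simp

theorem integral_comp_coe {g : AddCircle (2 * π) → ℂ}
    (hg : AEStronglyMeasurable g AddCircle.haarAddCircle) :
    ∫ x, g x ∂AddCircle.haarAddCircle = ∫ t : ℝ, g t ∂circ := by
  rw [← measurePreserving_coe.map_eq] at hg ⊢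
  exact integral_map measurePreserving_coe.measurable.aemeasurable hg

theorem integral_circ (g : ℝ → ℂ) : ∫ t, g t ∂circ = (1 / (2 * π) : ℂ) * ∫ t in freq, g t := by
  rw [circ, integral_smul_measure, ENNReal.toReal_ofReal (by positivity)]
  simp

theorem ae_circ {q : ℝ → Prop} : (∀ᵐ t ∂circ, q t) ↔ ∀ᵐ t ∂volume.restrict freq, q t := by
  rw [circ, Measure.ae_ennreal_smul_measure_iff]
  have := Real.pi_pos
  simp [this]

theorem integrable_circ {E : Type*} [NormedAddCommGroup E] {g : ℝ → E} :
    Integrable g circ ↔ IntegrableOn g freq := by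
  have := Real.pi_pos
  rw [circ, integrable_smul_measure (by simp [this]) ENNReal.ofReal_ne_top, IntegrableOn]

theorem integral_ex (k : ℤ) : ∫ t, ex k t ∂circ = if k = 0 then 1 else 0 := by
  have h := orthonormal_iff_ite.mp (orthonormal_fourier (T := 2 * π)) 0 k
  rw [L2.inner_def] at h
  have h2 : ∫ x : AddCircle (2 * π), fourier k x ∂AddCircle.haarAddCircle = if 0 = k then 1 else 0 := by
    rw [← h]
    apply integral_congr_ae
    filter_upwards [coeFn_fourierLp (T := 2 * π) 2 0, coeFn_fourierLp (T := 2 * π) 2 k] with x h1 h2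
    rw [h1, h2]; simp
  rw [integral_comp_coe (map_continuous (fourier k)).aestronglyMeasurable] at h2
  simp only [fourier_coe] at h2
  rw [h2]; simp [eq_comm]

theorem integrable_continuous_mul {g : ℝ → ℂ} (hg : Integrable g circ)
    (φ : C(AddCircle (2 * π), ℂ)) : Integrable (fun t : ℝ => φ t * g t) circ := by
  refine hg.bdd_mul (c := ‖φ‖) ?_ (Filter.Eventually.of_forall fun t => φ.norm_coe_le_norm _)
  exact ((map_continuous φ).comp (AddCircle.continuous_mk' _)).aestronglyMeasurable

theorem integrable_ex_mul {g : ℝ → ℂ} (hg : Integrable g circ) (k : ℤ) :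
    Integrable (fun t : ℝ => ex k t * g t) circ := by
  simpa only [fourier_coe] using integrable_continuous_mul hg (fourier k)

/-- An integrable function which is orthogonal to some characters is orthogonal to the uniform
limits of their linear combinations. -/
theorem integral_mul_eq_zero_of_mem_closure {g : ℝ → ℂ} (hg : Integrable g circ) (S : Set ℤ)
    (h : ∀ k ∈ S, ∫ t, ex k t * g t ∂circ = 0) (φ : C(AddCircle (2 * π), ℂ))
    (hφ : φ ∈ (Submodule.span ℂ (fourier '' S)).topologicalClosure) :
    ∫ t : ℝ, φ t * g t ∂circ = 0 := by
  let L : C(AddCircle (2 * π), ℂ) →L[ℂ] ℂ := LinearMap.mkContinuous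
    { toFun := fun φ => ∫ t : ℝ, φ t * g t ∂circ
      map_add' := fun φ ψ => by
        simp only [ContinuousMap.add_apply, add_mul]
        exact integral_add (integrable_continuous_mul hg φ) (integrable_continuous_mul hg ψ)
      map_smul' := fun a φ => by
        simp only [ContinuousMap.smul_apply, smul_eq_mul, mul_assoc, RingHom.id_apply]
        exact integral_const_mul _ _ } (∫ t, ‖g t‖ ∂circ) (fun φ => by
        simp only [LinearMap.coe_mk, AddHom.coe_mk]
        refine (norm_integral_le_integral_norm _).trans ?_
        rw [← integral_mul_const]
        refine integral_mono (integrable_continuous_mul hg φ).norm (hg.norm.mul_const _) fun t => ?_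
        simp only [norm_mul]
        rw [mul_comm]
        exact mul_le_mul_of_nonneg_left (φ.norm_coe_le_norm _) (norm_nonneg _))
  have hle : (Submodule.span ℂ (fourier '' S)).topologicalClosure ≤ LinearMap.ker L.toLinearMap := by
    refine Submodule.topologicalClosure_minimal _ (Submodule.span_le.mpr ?_) L.isClosed_ker
    rintro _ ⟨k, hk, rfl⟩
    have := h k hk
    simp only [← fourier_coe] at this
    exact this
  exact hle hφ

/-- Uniqueness of the Fourier coefficients of an integrable function. -/
theorem ae_eq_zero_of_integral_ex_mul {g : ℝ → ℂ} (hg : Integrable g circ)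
    (h : ∀ k, ∫ t, ex k t * g t ∂circ = 0) : g =ᵐ[circ] 0 := by
  have hπ := Real.pi_pos
  have hg' := integrable_circ.mp hg
  have key := IsOpen.ae_eq_zero_of_integral_contDiff_smul_eq_zero (μ := volume)
    (isOpen_Ioo (a := -π) (b := π)) (f := g)
    ((hg'.mono_set Set.Ioo_subset_Ico_self).locallyIntegrableOn) (by
      intro φ hφ _ hsupp
      have hz : ∀ t, t ∉ Set.Ioo (-π) π → φ t = 0 := fun t ht => by
        by_contra hne
        exact ht (hsupp (subset_closure hne))
      have hcont : Continuous (AddCircle.liftIco (2 * π) (-π) (fun t => (φ t : ℂ))) := by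
        apply AddCircle.liftIco_continuous
        · rw [hz _ (by simp), hz _ (by simp; intro; linarith)]
        · exact (Complex.continuous_ofReal.comp hφ.continuous).continuousOn
      have h1 := integral_mul_eq_zero_of_mem_closure hg Set.univ (fun k _ => h k) ⟨_, hcont⟩ (by
        rw [Set.image_univ, span_fourier_closure_eq_top]; trivial)
      rw [integral_circ, mul_eq_zero, or_iff_right (by
        have : (π : ℂ) ≠ 0 := by exact_mod_cast hπ.ne'
        simp [this])] at h1
      rw [← setIntegral_eq_integral_of_forall_compl_eq_zero (s := freq), ← h1]
      · refine setIntegral_congr_fun measurableSet_Ico fun t ht => ?_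
        simp only [ContinuousMap.coe_mk]
        rw [AddCircle.liftIco_coe_apply (by
          rwa [show (-π + 2 * π) = π by ring])]
        simp
      · intro t ht
        rw [hz t fun h => ht (Set.Ioo_subset_Ico_self h), zero_smul])
  rw [Filter.EventuallyEq, ae_circ, freq, restrict_Ico_eq_restrict_Ioc,
    ← restrict_Ioo_eq_restrict_Ioc, ae_restrict_iff' measurableSet_Ioo]
  exact key

/-! ### Square summable Fourier series -/

theorem memLp_fourierSum (σ : ℤ) (a : ℕ → ℂ) : MemLp (fourierSum σ a) 2 circ :=
  (Lp.memLp _).comp_measurePreserving measurePreserving_coe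

theorem hasSum_fourierLp {σ : ℤ} (hσ : σ ≠ 0) {a : ℕ → ℂ} (ha : Summable fun k => ‖a k‖ ^ 2) :
    HasSum (fun k : ℕ => a k • fourierLp (T := 2 * π) 2 (σ * k))
      (∑' k : ℕ, a k • fourierLp (T := 2 * π) 2 (σ * k)) := by
  have ho : Orthonormal ℂ fun k : ℕ => fourierLp (T := 2 * π) 2 (σ * k) :=
    orthonormal_fourier.comp (fun k : ℕ => σ * k) fun j k h => by simpa [hσ] using h
  exact ((ho.orthogonalFamily.summable_iff_norm_sq_summable a).mpr ha).hasSum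

theorem integral_ex_mul_fourierSum {σ : ℤ} (hσ : σ ≠ 0) {a : ℕ → ℂ}
    (ha : Summable fun k => ‖a k‖ ^ 2) (j : ℤ) :
    HasSum (fun k : ℕ => if j = σ * k then a k else 0) (∫ t, ex (-j) t * fourierSum σ a t ∂circ) := by
  have h := (innerSL ℂ (fourierLp (T := 2 * π) 2 j)).hasSum (hasSum_fourierLp hσ ha)
  simp only [innerSL_apply_apply, inner_smul_right,
    orthonormal_iff_ite.mp (orthonormal_fourier (T := 2 * π))] at h
  have h' : ∫ t, ex (-j) t * fourierSum σ a t ∂circ = inner ℂ (fourierLp (T := 2 * π) 2 j)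
      (∑' k : ℕ, a k • fourierLp (T := 2 * π) 2 (σ * k)) := by
    rw [L2.inner_def, integral_comp_coe
      ((Lp.aestronglyMeasurable _).inner (Lp.aestronglyMeasurable _))]
    apply integral_congr_ae
    filter_upwards [measurePreserving_coe.quasiMeasurePreserving.ae_eq
      (coeFn_fourierLp (T := 2 * π) 2 j)] with t ht
    simp only [Function.comp_apply] at ht
    rw [ht, fourier_coe, fourierSum, ← star_ex]
    simp [mul_comm]
  rw [h']
  simpa using h

theorem integral_ex_mul_fourierSum_coe {σ : ℤ} (hσ : σ ≠ 0) {a : ℕ → ℂ}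
    (ha : Summable fun k => ‖a k‖ ^ 2) (k : ℕ) :
    ∫ t, ex (-(σ * k)) t * fourierSum σ a t ∂circ = a k := by
  refine (integral_ex_mul_fourierSum hσ ha _).unique ?_
  convert hasSum_ite_eq k (a k) using 3 with j
  · simp [hσ, eq_comm]
  · rename_i h; rw [h]

theorem integral_ex_mul_fourierSum_eq_zero {σ : ℤ} (hσ : σ ≠ 0) {a : ℕ → ℂ}
    (ha : Summable fun k => ‖a k‖ ^ 2) {j : ℤ} (hj : ∀ k : ℕ, j ≠ σ * k) :
    ∫ t, ex (-j) t * fourierSum σ a t ∂circ = 0 := by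
  refine (integral_ex_mul_fourierSum hσ ha _).unique ?_
  simp only [hj, if_false]
  exact hasSum_zero

theorem tendsto_eLpNorm_fourierSum {σ : ℤ} (hσ : σ ≠ 0) {a : ℕ → ℂ}
    (ha : Summable fun k => ‖a k‖ ^ 2) :
    Filter.Tendsto (fun n : ℕ => eLpNorm (fun t : ℝ =>
      (∑ k ∈ Finset.range n, a k • fourier (σ * k) : C(AddCircle (2 * π), ℂ)) t - fourierSum σ a t)
        2 circ) Filter.atTop (nhds 0) := by
  have h := (hasSum_fourierLp hσ ha).tendsto_sum_nat
  rw [Lp.tendsto_Lp_iff_tendsto_eLpNorm'] at h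
  convert h using 2 with n
  rw [← eLpNorm_comp_measurePreserving (((Lp.aestronglyMeasurable _)).sub
    (Lp.aestronglyMeasurable _)) measurePreserving_coe]
  apply eLpNorm_congr_ae
  have : (((∑ k ∈ Finset.range n, a k • fourierLp (T := 2 * π) 2 (σ * k) : Lp ℂ 2 _)) :
      AddCircle (2 * π) → ℂ) =ᵐ[AddCircle.haarAddCircle]
      (∑ k ∈ Finset.range n, a k • fourier (σ * k) : C(AddCircle (2 * π), ℂ)) := by
    have := ContinuousMap.coeFn_toLp (p := 2) (𝕜 := ℂ) (AddCircle.haarAddCircle (T := 2 * π))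
      (∑ k ∈ Finset.range n, a k • fourier (σ * k) : C(AddCircle (2 * π), ℂ))
    rw [map_sum] at this
    simpa only [map_smul] using this
  filter_upwards [measurePreserving_coe.quasiMeasurePreserving.ae_eq this] with t ht
  simp only [Function.comp_apply] at ht
  simp only [Function.comp_apply, Pi.sub_apply, ht, fourierSum]

/-! ### The disc algebra -/

/-- The disc algebra: the uniform closure of the polynomials in `e^{it}`. -/
def discAlgebra : Subalgebra ℂ C(AddCircle (2 * π), ℂ) :=
  (Algebra.adjoin ℂ {fourier 1}).topologicalClosure

theorem fourier_one_pow (n : ℕ) : (fourier 1 : C(AddCircle (2 * π), ℂ)) ^ n = fourier (n : ℤ) := by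
  induction n with
  | zero => ext x; simp
  | succ n ih =>
    rw [pow_succ, ih]; ext x
    rw [ContinuousMap.mul_apply, ← fourier_add]; simp

theorem fourier_mem_adjoin {k : ℤ} (hk : 0 ≤ k) :
    (fourier k : C(AddCircle (2 * π), ℂ)) ∈ Algebra.adjoin ℂ {fourier 1} := by
  lift k to ℕ using hk
  rw [← fourier_one_pow]
  exact Subalgebra.pow_mem _ (Algebra.self_mem_adjoin_singleton _ _) _

theorem span_fourier_le_discAlgebra {φ : C(AddCircle (2 * π), ℂ)}
    (hφ : φ ∈ Submodule.span ℂ (fourier '' {k : ℤ | 0 ≤ k})) : φ ∈ discAlgebra := by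
  apply Subalgebra.le_topologicalClosure
  have : Submodule.span ℂ (fourier '' {k : ℤ | 0 ≤ k}) ≤
      Subalgebra.toSubmodule (Algebra.adjoin ℂ {(fourier 1 : C(AddCircle (2 * π), ℂ))}) := by
    rw [Submodule.span_le]
    rintro _ ⟨k, hk, rfl⟩
    exact fourier_mem_adjoin hk
  exact this hφ

theorem discAlgebra_le_closure {φ : C(AddCircle (2 * π), ℂ)} (hφ : φ ∈ discAlgebra) :
    φ ∈ (Submodule.span ℂ (fourier '' {k : ℤ | 0 ≤ k})).topologicalClosure := by
  have hle : ∀ x ∈ Algebra.adjoin ℂ {(fourier 1 : C(AddCircle (2 * π), ℂ))},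
      x ∈ Submodule.span ℂ (fourier '' {k : ℤ | 0 ≤ k}) := by
    intro x hx
    have hx' : x ∈ Subalgebra.toSubmodule (Algebra.adjoin ℂ {(fourier 1 : C(AddCircle (2 * π), ℂ))}) := hx
    rw [Algebra.adjoin_eq_span] at hx'
    refine Submodule.span_mono ?_ hx'
    intro y hy
    obtain ⟨n, rfl⟩ := Submonoid.mem_closure_singleton.mp hy
    exact ⟨n, by simp, (fourier_one_pow n).symm⟩
  exact closure_mono hle hφ

/-- An element of the disc algebra whose real part is at least `1` is invertible there: for small
`s > 0` the Neumann series of `1 - (1 - s g)` converges. -/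
theorem exists_inv_mem_discAlgebra {g : C(AddCircle (2 * π), ℂ)} (hg : g ∈ discAlgebra)
    (h1 : ∀ x, 1 ≤ (g x).re) : ∃ h ∈ discAlgebra, ∀ x, h x = (g x)⁻¹ := by
  have hcl : IsClosed (discAlgebra : Set C(AddCircle (2 * π), ℂ)) :=
    Subalgebra.isClosed_topologicalClosure _
  have : CompleteSpace discAlgebra := hcl.completeSpace_coe
  have hM : 1 ≤ ‖g‖ := ((h1 0).trans (Complex.re_le_norm _)).trans (g.norm_coe_le_norm 0)
  set s : ℝ := 1 / ‖g‖ ^ 2 with hs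
  have hspos : 0 < s := by positivity
  let x : discAlgebra := ⟨1 - (s : ℂ) • g, Subalgebra.sub_mem _ (Subalgebra.one_mem _)
    (Subalgebra.smul_mem _ hg _)⟩
  have hx : ‖x‖ < 1 := by
    change ‖1 - (s : ℂ) • g‖ < 1
    have : ‖1 - (s : ℂ) • g‖ ≤ √(1 - s) := by
      refine (ContinuousMap.norm_le _ (Real.sqrt_nonneg _)).mpr fun y => ?_
      apply Real.le_sqrt_of_sq_le
      have e1 : ‖(1 - (s : ℂ) • g : C(AddCircle (2 * π), ℂ)) y‖ ^ 2
          = 1 - 2 * s * (g y).re + s ^ 2 * ‖g y‖ ^ 2 := by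
        rw [Complex.sq_norm, Complex.sq_norm, Complex.normSq_apply, Complex.normSq_apply]
        simp only [ContinuousMap.sub_apply, ContinuousMap.one_apply, ContinuousMap.smul_apply,
          smul_eq_mul, Complex.sub_re, Complex.one_re, Complex.sub_im, Complex.one_im,
          Complex.re_ofReal_mul, Complex.im_ofReal_mul]
        ring
      have e2 : s ^ 2 * ‖g y‖ ^ 2 ≤ s := by
        have : ‖g y‖ ^ 2 ≤ ‖g‖ ^ 2 := by gcongr; exact g.norm_coe_le_norm y
        calc s ^ 2 * ‖g y‖ ^ 2 ≤ s ^ 2 * ‖g‖ ^ 2 := by gcongr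
          _ = s := by rw [hs]; field_simp
      rw [e1]
      nlinarith [h1 y]
    refine this.trans_lt ?_
    rw [Real.sqrt_lt' one_pos]; linarith
  obtain ⟨y, hy⟩ : ∃ y : discAlgebra, (1 - x) * y = 1 :=
    ⟨_, (Units.oneSub x hx).mul_inv⟩
  refine ⟨(s : ℂ) • y.1, Subalgebra.smul_mem _ y.2 _, fun z => ?_⟩
  have hy' := congrArg (fun w : discAlgebra => (w : C(AddCircle (2 * π), ℂ)) z) hy
  simp [x] at hy'
  refine eq_inv_of_mul_eq_one_left ?_
  rw [ContinuousMap.smul_apply, smul_eq_mul, ← hy']; ring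

theorem integrable_continuous (φ : C(AddCircle (2 * π), ℂ)) : Integrable (fun t : ℝ => φ t) circ := by
  simpa using integrable_continuous_mul (integrable_const (1 : ℂ)) φ

/-- The mean value is multiplicative on polynomials in `e^{it}`. -/
theorem integral_mul_of_mem_span {φ ψ : C(AddCircle (2 * π), ℂ)}
    (hφ : φ ∈ Submodule.span ℂ (fourier '' {k : ℤ | 0 ≤ k}))
    (hψ : ψ ∈ Submodule.span ℂ (fourier '' {k : ℤ | 0 ≤ k})) :
    ∫ t : ℝ, φ t * ψ t ∂circ = (∫ t : ℝ, φ t ∂circ) * ∫ t : ℝ, ψ t ∂circ := by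
  induction hφ, hψ using Submodule.span_induction₂ with
  | mem_mem x y hx hy =>
    obtain ⟨j, hj, rfl⟩ := hx
    obtain ⟨k, hk, rfl⟩ := hy
    change 0 ≤ j at hj
    change 0 ≤ k at hk
    simp only [fourier_coe, ← ex_add, integral_ex]
    split_ifs <;> first | omega | simp
  | zero_left => simp
  | zero_right => simp
  | add_left x y z _ _ _ hx hy =>
    simp only [ContinuousMap.add_apply, add_mul]
    rw [integral_add (integrable_continuous_mul (integrable_continuous _) _)
      (integrable_continuous_mul (integrable_continuous _) _), hx, hy,
      integral_add (integrable_continuous _) (integrable_continuous _), add_mul]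
  | add_right x y z _ _ _ hx hy =>
    simp only [ContinuousMap.add_apply, mul_add]
    rw [integral_add (integrable_continuous_mul (integrable_continuous _) _)
      (integrable_continuous_mul (integrable_continuous _) _), hx, hy,
      integral_add (integrable_continuous _) (integrable_continuous _), mul_add]
  | smul_left a x y _ _ h =>
    simp only [ContinuousMap.smul_apply, smul_eq_mul, mul_assoc, integral_const_mul]
    rw [h]
  | smul_right a x y _ _ h =>
    simp only [ContinuousMap.smul_apply, smul_eq_mul, mul_left_comm _ a, integral_const_mul]
    rw [h]

/-- For a polynomial in `e^{it}` with real mean value, the `L²` norm is controlled by the real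
part. -/
theorem integral_norm_sq_le_of_mem_span {φ : C(AddCircle (2 * π), ℂ)}
    (hφ : φ ∈ Submodule.span ℂ (fourier '' {k : ℤ | 0 ≤ k}))
    (him : (∫ t : ℝ, φ t ∂circ).im = 0) :
    ∫ t : ℝ, ‖φ t‖ ^ 2 ∂circ ≤ 2 * ∫ t : ℝ, (φ t).re ^ 2 ∂circ := by
  have h := congrArg Complex.re (integral_mul_of_mem_span hφ hφ)
  have hi := integrable_continuous_mul (integrable_continuous φ) φ
  have hi2 : Integrable (fun t : ℝ => (φ t).re ^ 2) circ := by
    have := (integrable_continuous (⟨fun x => (((φ x).re ^ 2 : ℝ) : ℂ), by fun_prop⟩)).re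
    simpa only [ContinuousMap.coe_mk, RCLike.re_eq_complex_re, Complex.ofReal_re] using this
  have hi3 : Integrable (fun t : ℝ => ‖φ t‖ ^ 2) circ := by
    have := (integrable_continuous (⟨fun x => ((‖φ x‖ ^ 2 : ℝ) : ℂ), by fun_prop⟩)).re
    simpa only [ContinuousMap.coe_mk, RCLike.re_eq_complex_re, Complex.ofReal_re] using this
  have e : ∫ t : ℝ, (φ t * φ t).re ∂circ = (∫ t : ℝ, φ t * φ t ∂circ).re := integral_re hi
  rw [← e, Complex.mul_re, him] at h
  have e2 : ∫ t : ℝ, (φ t * φ t).re ∂circ =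
      2 * ∫ t : ℝ, (φ t).re ^ 2 ∂circ - ∫ t : ℝ, ‖φ t‖ ^ 2 ∂circ := by
    rw [← integral_const_mul, ← integral_sub (hi2.const_mul 2) hi3]
    congr 1; ext t
    rw [Complex.sq_norm, Complex.normSq_apply, Complex.mul_re]; ring
  nlinarith [mul_self_nonneg (∫ t : ℝ, φ t ∂circ).re]

/-- Every trigonometric polynomial has the real part of a polynomial in `e^{it}`. -/
theorem exists_analytic_re_eq {p : C(AddCircle (2 * π), ℂ)}
    (hp : p ∈ Submodule.span ℂ (Set.range (fourier (T := 2 * π)))) (a : ℂ) :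
    ∃ φ ∈ Submodule.span ℂ (fourier '' {k : ℤ | 0 ≤ k}),
      ∀ x : AddCircle (2 * π), (φ x).re = (a * p x).re := by
  induction hp using Submodule.span_induction generalizing a with
  | mem x hx =>
    obtain ⟨k, rfl⟩ := hx
    rcases le_total 0 k with hk | hk
    · exact ⟨a • fourier k, Submodule.smul_mem _ _ (Submodule.subset_span ⟨k, hk, rfl⟩),
        fun x => by simp⟩
    · refine ⟨star a • fourier (-k), Submodule.smul_mem _ _
        (Submodule.subset_span ⟨-k, by simpa using hk, rfl⟩), fun x => ?_⟩
      rw [ContinuousMap.smul_apply, fourier_neg, smul_eq_mul, Complex.star_def, ← map_mul,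
        Complex.conj_re]
  | zero => exact ⟨0, Submodule.zero_mem _, fun x => by simp⟩
  | add x y _ _ hx hy =>
    obtain ⟨φ, hφ, h1⟩ := hx a
    obtain ⟨ψ, hψ, h2⟩ := hy a
    exact ⟨φ + ψ, Submodule.add_mem _ hφ hψ, fun z => by
      simp only [ContinuousMap.add_apply, Complex.add_re, h1, h2, mul_add]⟩
  | smul b x _ hx =>
    obtain ⟨φ, hφ, h1⟩ := hx (a * b)
    exact ⟨φ, hφ, fun z => by rw [h1, ContinuousMap.smul_apply, smul_eq_mul, mul_assoc]⟩

/-- Every real continuous function on the circle is approximated uniformly from above by the real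
part of a polynomial in `e^{it}` with real mean value. -/
theorem exists_analytic_re_near (g : C(AddCircle (2 * π), ℝ)) {ε : ℝ} (hε : 0 < ε) :
    ∃ φ ∈ Submodule.span ℂ (fourier '' {k : ℤ | 0 ≤ k}),
      (∀ x : AddCircle (2 * π), g x ≤ (φ x).re ∧ (φ x).re ≤ g x + ε) ∧
        (∫ t : ℝ, φ t ∂circ).im = 0 := by
  let G : C(AddCircle (2 * π), ℂ) := ⟨fun x => ((g x + ε / 2 : ℝ) : ℂ), by fun_prop⟩
  have hG : G ∈ (Submodule.span ℂ (Set.range (fourier (T := 2 * π)))).topologicalClosure := by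
    rw [span_fourier_closure_eq_top]; trivial
  obtain ⟨p, hp, hd⟩ := Metric.mem_closure_iff.mp hG (ε / 2) (by positivity)
  obtain ⟨φ, hφ, hre⟩ := exists_analytic_re_eq hp 1
  set m := (∫ t : ℝ, φ t ∂circ).im
  refine ⟨φ - (I * m) • fourier 0, Submodule.sub_mem _ hφ (Submodule.smul_mem _ _
    (Submodule.subset_span ⟨0, by simp, rfl⟩)), fun x => ?_, ?_⟩
  · have h1 : |(g x + ε / 2) - (p x).re| ≤ ε / 2 := by
      have := (ContinuousMap.dist_apply_le_dist (f := G) (g := p) x).trans hd.le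
      rw [dist_eq_norm] at this
      refine le_trans ?_ this
      have := Complex.abs_re_le_norm (G x - p x)
      simpa [G] using this
    have h2 : ((φ - (I * m) • fourier 0 : C(AddCircle (2 * π), ℂ)) x).re = (p x).re := by
      simp [hre]
    rw [h2]
    rw [abs_le] at h1
    constructor <;> linarith [h1.1, h1.2]
  · have h1 : ∫ t : ℝ, (φ - (I * m) • fourier 0 : C(AddCircle (2 * π), ℂ)) t ∂circ
        = (∫ t : ℝ, φ t ∂circ) - I * m := by
      simp only [ContinuousMap.sub_apply, ContinuousMap.smul_apply, fourier_coe, ex_zero]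
      rw [integral_sub (integrable_continuous φ) (integrable_const _)]
      simp
    rw [h1]
    simp [m]

theorem memLp_continuous (φ : C(AddCircle (2 * π), ℂ)) : MemLp (fun t : ℝ => φ t) 2 circ :=
  MemLp.of_bound ((map_continuous φ).comp (AddCircle.continuous_mk' _)).aestronglyMeasurable ‖φ‖
    (Filter.Eventually.of_forall fun _ => φ.norm_coe_le_norm _)

theorem integrable_star {g : ℝ → ℂ} (hg : Integrable g circ) :
    Integrable (fun t => star (g t)) circ :=
  Complex.conjCLE.toContinuousLinearMap.integrable_comp hg

theorem eLpNorm_le_of_mem_span {φ : C(AddCircle (2 * π), ℂ)}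
    (hφ : φ ∈ Submodule.span ℂ (fourier '' {k : ℤ | 0 ≤ k}))
    (him : (∫ t : ℝ, φ t ∂circ).im = 0) :
    eLpNorm (fun t : ℝ => φ t) 2 circ ≤ 2 * eLpNorm (fun t : ℝ => (φ t).re) 2 circ := by
  have h := integral_norm_sq_le_of_mem_span hφ him
  rw [(memLp_continuous φ).eLpNorm_eq_integral_rpow_norm (by simp) (by simp),
    (show MemLp (fun t : ℝ => (φ t).re) 2 circ from (memLp_continuous φ).re).eLpNorm_eq_integral_rpow_norm (by simp) (by simp)]
  simp only [ENNReal.toReal_ofNat, Real.rpow_two, Real.norm_eq_abs, sq_abs]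
  rw [← ENNReal.ofReal_ofNat, ← ENNReal.ofReal_mul (by norm_num)]
  apply ENNReal.ofReal_le_ofReal
  rw [← one_div, ← Real.sqrt_eq_rpow, ← Real.sqrt_eq_rpow]
  have h0 : 0 ≤ ∫ t : ℝ, (φ t).re ^ 2 ∂circ := integral_nonneg fun t => sq_nonneg _
  rw [show (2 : ℝ) * √(∫ t : ℝ, (φ t).re ^ 2 ∂circ) = √(4 * ∫ t : ℝ, (φ t).re ^ 2 ∂circ) by
    rw [Real.sqrt_mul (by norm_num), show (4 : ℝ) = 2 ^ 2 by norm_num,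
      Real.sqrt_sq (by norm_num)]]
  exact Real.sqrt_le_sqrt (by linarith)

/-- A sequence of polynomials in `e^{it}` with real mean values converges in `L²` as soon as the real
parts do. -/
theorem exists_tendsto_eLpNorm_of_re {Q : ℕ → C(AddCircle (2 * π), ℂ)}
    (hQ : ∀ k, Q k ∈ Submodule.span ℂ (fourier '' {k : ℤ | 0 ≤ k}))
    (him : ∀ k, (∫ t : ℝ, Q k t ∂circ).im = 0) {g : ℝ → ℝ} (hg : MemLp g 2 circ)
    (hlim : Filter.Tendsto (fun k => eLpNorm (fun t : ℝ => (Q k t).re - g t) 2 circ)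
      Filter.atTop (nhds 0)) :
    ∃ L : ℝ → ℂ, MemLp L 2 circ ∧ Filter.Tendsto
      (fun k => eLpNorm (fun t : ℝ => Q k t - L t) 2 circ) Filter.atTop (nhds 0) := by
  have hc : CauchySeq fun k => (memLp_continuous (Q k)).toLp := by
    rw [EMetric.cauchySeq_iff]
    intro ε hε
    have hε4 : 0 < ε / 4 := ENNReal.div_pos hε.ne' (by simp)
    obtain ⟨K, hK⟩ := Filter.eventually_atTop.mp (hlim.eventually_lt_const hε4)
    refine ⟨K, fun m hm n hn => ?_⟩
    rw [Lp.edist_toLp_toLp]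
    have h1 : eLpNorm ((fun t : ℝ => Q m t) - fun t : ℝ => Q n t) 2 circ ≤
        2 * eLpNorm (fun t : ℝ => ((Q m - Q n) t).re) 2 circ := by
      refine le_trans (le_of_eq ?_) (eLpNorm_le_of_mem_span (Submodule.sub_mem _ (hQ m) (hQ n)) ?_)
      · rfl
      · simp only [ContinuousMap.sub_apply]
        rw [integral_sub (integrable_continuous _) (integrable_continuous _), Complex.sub_im, him,
          him, sub_zero]
    have h2 : eLpNorm (fun t : ℝ => ((Q m - Q n) t).re) 2 circ < ε / 4 + ε / 4 := by
      have e : (fun t : ℝ => ((Q m - Q n) t).re) =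
          (fun t : ℝ => (Q m t).re - g t) - fun t : ℝ => (Q n t).re - g t := by
        ext t; simp
      rw [e]
      refine (eLpNorm_sub_le ?_ ?_ (by norm_num)).trans_lt (ENNReal.add_lt_add (hK m hm) (hK n hn))
      · exact ((memLp_continuous (Q m)).re.sub hg).1
      · exact ((memLp_continuous (Q n)).re.sub hg).1
    calc _ ≤ _ := h1
      _ < 2 * (ε / 4 + ε / 4) := by gcongr; simp
      _ = ε := by
        rw [← two_mul, ← mul_assoc, show (2 : ℝ≥0∞) * 2 = 4 by norm_num]
        exact ENNReal.mul_div_cancel (by simp) (by simp)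
  obtain ⟨L, hL⟩ := cauchySeq_tendsto_of_complete hc
  refine ⟨L, Lp.memLp L, ?_⟩
  rw [Lp.tendsto_Lp_iff_tendsto_eLpNorm'] at hL
  refine hL.congr fun k => eLpNorm_congr_ae ?_
  filter_upwards [(memLp_continuous (Q k)).coeFn_toLp] with t ht
  rw [Pi.sub_apply, ht]

/-- A form of Smirnov's theorem. If `u` is integrable, its Fourier coefficients of index `≥ 0` vanish
and `C` has square summable Fourier coefficients, of index `≥ 0` only, then `∫ conj(u) C = 0` whenever
the integrand is integrable. With an analytic `Q` such that `Re Q = ∑_q |C_q|`, the function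
`r C / (r + Q)` is analytic and bounded by `r`, so that it is orthogonal to `u`. It is also bounded by
`|C|`, so that dominated convergence applies to its product with `u` as `r → ∞`. -/
theorem integral_star_mul_fourierSum_eq_zero {ι : Type*} [Fintype ι] {u : ℝ → ι → ℂ}
    {c : ι → ℕ → ℂ} (hc : ∀ q, Summable fun k => ‖c q k‖ ^ 2)
    (hu : ∀ q, Integrable (fun t => u t q) circ)
    (h0 : ∀ (j : ℕ) q, ∫ t, ex (-j) t * u t q ∂circ = 0)
    (hint : Integrable (fun t => ∑ q, star (u t q) * fourierSum 1 (c q) t) circ) :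
    ∫ t, ∑ q, star (u t q) * fourierSum 1 (c q) t ∂circ = 0 := by
  set C : ι → ℝ → ℂ := fun q => fourierSum 1 (c q) with hC
  have hCm : ∀ q, MemLp (C q) 2 circ := fun q => memLp_fourierSum _ _
  let P : ℕ → ι → C(AddCircle (2 * π), ℂ) := fun k q =>
    ∑ j ∈ Finset.range k, c q j • fourier (1 * j)
  have hPs : ∀ k q, P k q ∈ Submodule.span ℂ (fourier '' {k : ℤ | 0 ≤ k}) := fun k q =>
    Submodule.sum_mem _ fun j _ => Submodule.smul_mem _ _ (Submodule.subset_span ⟨1 * j, by simp, rfl⟩)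
  have hP : ∀ q, Filter.Tendsto (fun k => eLpNorm (fun t : ℝ => P k q t - C q t) 2 circ)
      Filter.atTop (nhds 0) := fun q => tendsto_eLpNorm_fourierSum one_ne_zero (hc q)
  let N : ℕ → C(AddCircle (2 * π), ℝ) := fun k => ⟨fun x => ∑ q, ‖P k q x‖, by fun_prop⟩
  choose Q hQs hQre hQim using fun k : ℕ =>
    exists_analytic_re_near (N k) (ε := 1 / ((k : ℝ) + 1)) (by positivity)
  have hPm : ∀ k q, MemLp (fun t : ℝ => P k q t - C q t) 2 circ := fun k q =>
    (memLp_continuous _).sub (hCm q)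
  have hsum : ∀ k, eLpNorm (fun t : ℝ => ∑ q, ‖P k q t - C q t‖) 2 circ ≤
      ∑ q, eLpNorm (fun t : ℝ => P k q t - C q t) 2 circ := fun k => by
    have := eLpNorm_sum_le (p := 2) (μ := circ) (s := Finset.univ)
      (f := fun q (t : ℝ) => ‖P k q t - C q t‖) (fun q _ => (hPm k q).1.norm) (by norm_num)
    simp only [eLpNorm_norm] at this
    convert this using 2
    ext t; simp
  have hsum0 : Filter.Tendsto (fun k => ∑ q, eLpNorm (fun t : ℝ => P k q t - C q t) 2 circ)
      Filter.atTop (nhds 0) := by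
    simpa using tendsto_finsetSum Finset.univ fun q _ => hP q
  obtain ⟨L, hLm, hL⟩ := exists_tendsto_eLpNorm_of_re hQs hQim (g := fun t => ∑ q, ‖C q t‖)
    (memLp_finsetSum _ fun q _ => (hCm q).norm) (by
      have hz : Filter.Tendsto (fun k : ℕ => ENNReal.ofReal (1 / ((k : ℝ) + 1))) Filter.atTop
          (nhds 0) := by
        simpa using ENNReal.tendsto_ofReal tendsto_one_div_add_atTop_nhds_zero_nat
      refine tendsto_of_tendsto_of_tendsto_of_le_of_le tendsto_const_nhds
        (by simpa using hsum0.add hz) (fun _ => bot_le) fun k => ?_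
      have hb : eLpNorm (fun t : ℝ => (Q k t).re - ∑ q, ‖C q t‖) 2 circ ≤
          eLpNorm ((fun t : ℝ => ∑ q, ‖P k q t - C q t‖) + fun _ => 1 / ((k : ℝ) + 1)) 2 circ := by
        refine eLpNorm_mono_real fun t => ?_
        obtain ⟨h1, h2⟩ := hQre k t
        have h3 : |∑ q, ‖P k q t‖ - ∑ q, ‖C q t‖| ≤ ∑ q, ‖P k q t - C q t‖ := by
          rw [← Finset.sum_sub_distrib]
          exact (Finset.abs_sum_le_sum_abs _ _).trans
            (Finset.sum_le_sum fun q _ => abs_norm_sub_norm_le _ _)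
        simp only [N, ContinuousMap.coe_mk] at h1 h2
        rw [Real.norm_eq_abs, Pi.add_apply]
        rw [abs_le] at h3 ⊢
        constructor <;> linarith [h3.1, h3.2, show 0 < 1 / ((k : ℝ) + 1) by positivity]
      refine hb.trans ((eLpNorm_add_le ?_ aestronglyMeasurable_const (by norm_num)).trans
        (add_le_add (hsum k) ?_))
      · exact (memLp_finsetSum (p := 2) _ fun q _ => (hPm k q).norm).1
      · rw [eLpNorm_const _ (by simp) (by simp [IsProbabilityMeasure.ne_zero])]
        simp [Real.enorm_eq_ofReal_abs, abs_of_pos (show 0 < (k : ℝ) + 1 by positivity)])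
  -- all the series converge almost everywhere along a common subsequence
  have hQm : ∀ k, MemLp (fun t : ℝ => Q k t - L t) 2 circ := fun k =>
    (memLp_continuous _).sub hLm
  have hgm : ∀ k, MemLp (fun t : ℝ => ∑ q, ‖P k q t - C q t‖) 2 circ := fun k =>
    memLp_finsetSum _ fun q _ => (hPm k q).norm
  obtain ⟨ns, hns, hae⟩ := TendstoInMeasure.exists_seq_tendsto_ae
    (tendstoInMeasure_of_tendsto_eLpNorm (p := 2) (μ := circ) (l := Filter.atTop)
      (f := fun k (t : ℝ) => (∑ q, ‖P k q t - C q t‖) + ‖Q k t - L t‖) (g := fun _ => 0)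
      (by simp) (fun k => (hgm k).1.add (hQm k).1.norm) aestronglyMeasurable_const (by
        refine tendsto_of_tendsto_of_tendsto_of_le_of_le tendsto_const_nhds
          (by simpa using hsum0.add hL) (fun _ => bot_le) fun k => ?_
        refine le_trans (le_of_eq ?_) ((eLpNorm_add_le (hgm k).1 (hQm k).1.norm (by norm_num)).trans
          (add_le_add (hsum k) (eLpNorm_norm _).le))
        congr 1; ext t; simp))
  have hPae : ∀ᵐ t ∂circ, ∀ q, Filter.Tendsto (fun i => P (ns i) q (t : ℝ)) Filter.atTop
      (nhds (C q t)) := by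
    filter_upwards [hae] with t ht q
    rw [tendsto_iff_norm_sub_tendsto_zero]
    refine squeeze_zero (fun _ => norm_nonneg _) (fun i => ?_) ht
    have := Finset.single_le_sum (f := fun q => ‖P (ns i) q t - C q t‖)
      (fun q _ => norm_nonneg _) (Finset.mem_univ q)
    linarith [norm_nonneg (Q (ns i) t - L t)]
  have hQae : ∀ᵐ t ∂circ, Filter.Tendsto (fun i => Q (ns i) (t : ℝ)) Filter.atTop (nhds (L t)) := by
    filter_upwards [hae] with t ht
    rw [tendsto_iff_norm_sub_tendsto_zero]
    refine squeeze_zero (fun _ => norm_nonneg _) (fun i => ?_) ht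
    linarith [Finset.sum_nonneg fun q (_ : q ∈ Finset.univ) => norm_nonneg (P (ns i) q t - C q t)]
  have hQ0 : ∀ k (x : AddCircle (2 * π)), 0 ≤ (Q k x).re := fun k x =>
    (Finset.sum_nonneg fun q _ => norm_nonneg _).trans (hQre k x).1
  have hPQ : ∀ k q (x : AddCircle (2 * π)), ‖P k q x‖ ≤ (Q k x).re := fun k q x =>
    (Finset.single_le_sum (f := fun q => ‖P k q x‖) (fun q _ => norm_nonneg _)
      (Finset.mem_univ q)).trans (hQre k x).1
  have hL0 : ∀ᵐ t ∂circ, 0 ≤ (L t).re := by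
    filter_upwards [hQae] with t ht
    exact ge_of_tendsto' ((Complex.continuous_re.tendsto _).comp ht) fun i => hQ0 _ _
  have hden : ∀ (r : ℕ) {z : ℂ}, 0 ≤ z.re → z.re ≤ ‖((r : ℂ) + 1) + z‖ ∧
      (r : ℝ) + 1 ≤ ‖((r : ℂ) + 1) + z‖ := fun r z hz => by
    have h := Complex.re_le_norm (((r : ℂ) + 1) + z)
    simp only [Complex.add_re, Complex.natCast_re, Complex.one_re] at h
    have hr : (0 : ℝ) ≤ r := Nat.cast_nonneg r
    constructor <;> linarith
  -- orthogonality of `u` to the bounded analytic functions `r C / (r + Q)`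
  have hr : ∀ r : ℕ, ∫ t, ∑ q, star (u t q) * (((r : ℂ) + 1) * C q t * (((r : ℂ) + 1) + L t)⁻¹) ∂circ
      = 0 := by
    intro r
    have hex : ∀ k, ∃ h ∈ discAlgebra, ∀ x, h x = (((r : ℂ) + 1) + Q k x)⁻¹ := fun k => by
      obtain ⟨h, hh, he⟩ := exists_inv_mem_discAlgebra
        (g := ((r : ℂ) + 1) • 1 + Q k)
        (Subalgebra.add_mem _ (Subalgebra.smul_mem _ (Subalgebra.one_mem _) _)
          (span_fourier_le_discAlgebra (hQs k)))
        (fun x => by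
          have := hQ0 k x
          have hr : (0 : ℝ) ≤ r := Nat.cast_nonneg r
          simp
          linarith)
      exact ⟨h, hh, fun x => by rw [he]; simp⟩
    choose h hh he using hex
    have hBn : ∀ k q (x : AddCircle (2 * π)), ‖P k q x * h k x‖ ≤ 1 := fun k q x => by
      rw [he, norm_mul, norm_inv]
      have h1 := hden r (hQ0 k x)
      exact mul_inv_le_one_of_le₀ ((hPQ k q x).trans h1.1) (norm_nonneg _)
    have hB : ∀ k q, ∫ t : ℝ, (P k q * h k) t * star (u t q) ∂circ = 0 := fun k q => by
      refine integral_mul_eq_zero_of_mem_closure (integrable_star (hu q)) {k : ℤ | 0 ≤ k} (fun j hj => ?_) _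
        (discAlgebra_le_closure (Subalgebra.mul_mem _ (span_fourier_le_discAlgebra (hPs k q)) (hh k)))
      lift j to ℕ using hj
      have := congrArg star (h0 j q)
      rw [star_zero, Complex.star_def, ← integral_conj] at this
      rw [← this]
      congr 1; ext t
      rw [← Complex.star_def, star_mul', star_ex, neg_neg]
    have hlim := tendsto_integral_of_dominated_convergence (μ := circ)
      (F := fun i (t : ℝ) => ∑ q, star (u t q) * (((r : ℂ) + 1) * P (ns i) q t * h (ns i) t))
      (f := fun t => ∑ q, star (u t q) * (((r : ℂ) + 1) * C q t * (((r : ℂ) + 1) + L t)⁻¹))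
      (fun t => ∑ q, ‖u t q‖ * ((r : ℝ) + 1)) ?_ ?_ ?_ ?_
    · refine tendsto_nhds_unique hlim (tendsto_const_nhds.congr fun i => ?_)
      rw [integral_finsetSum]
      · refine (Finset.sum_eq_zero fun q _ => ?_).symm
        rw [← mul_zero ((r : ℂ) + 1), ← hB (ns i) q, ← integral_const_mul]
        congr 1; ext t; rw [ContinuousMap.mul_apply]; ring
      · intro q _
        refine ((integrable_continuous_mul (integrable_star (hu q)) (P (ns i) q * h (ns i))).const_mul
          ((r : ℂ) + 1)).congr (Filter.Eventually.of_forall fun t => ?_)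
        simp only [ContinuousMap.mul_apply]; ring
    · intro i
      refine Finset.aestronglyMeasurable_fun_sum _ fun q _ => ?_
      exact (hu q).1.star.mul (((((map_continuous (P (ns i) q)).comp
        (AddCircle.continuous_mk' _)).const_mul _).mul ((map_continuous (h (ns i))).comp
        (AddCircle.continuous_mk' _))).aestronglyMeasurable)
    · exact integrable_finsetSum _ fun q _ => (hu q).norm.mul_const _
    · intro i
      refine Filter.Eventually.of_forall fun t => (norm_sum_le _ _).trans
        (Finset.sum_le_sum fun q _ => ?_)
      rw [norm_mul, norm_star, mul_assoc, norm_mul]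
      gcongr
      have e : ‖(r : ℂ) + 1‖ = (r : ℝ) + 1 := by exact_mod_cast Complex.norm_natCast (r + 1)
      rw [e]
      exact mul_le_of_le_one_right (by positivity) (hBn _ _ _)
    · filter_upwards [hPae, hQae, hL0] with t h1 h2 h3
      refine tendsto_finsetSum _ fun q _ => Filter.Tendsto.const_mul _ ?_
      simp only [he]
      refine ((h1 q).const_mul _).mul ((h2.const_add _).inv₀ ?_)
      intro h4
      have := (hden r h3).2
      rw [h4, norm_zero] at this
      linarith [show (0 : ℝ) ≤ r from Nat.cast_nonneg r]
  -- `r → ∞`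
  have hlim := tendsto_integral_of_dominated_convergence (μ := circ)
    (F := fun (r : ℕ) (t : ℝ) =>
      ∑ q, star (u t q) * (((r : ℂ) + 1) * C q t * (((r : ℂ) + 1) + L t)⁻¹))
    (f := fun t => ∑ q, star (u t q) * C q t)
    (fun t => ‖∑ q, star (u t q) * C q t‖) ?_ hint.norm ?_ ?_
  · simp only [hr] at hlim
    exact tendsto_nhds_unique hlim tendsto_const_nhds
  · intro r
    refine Finset.aestronglyMeasurable_fun_sum _ fun q _ => (hu q).1.star.mul ?_
    exact ((hCm q).1.const_mul _).mul
      ((hLm.1.const_add _).aemeasurable.inv.aestronglyMeasurable)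
  · intro r
    filter_upwards [hL0] with t ht
    have e : ∑ q, star (u t q) * (((r : ℂ) + 1) * C q t * (((r : ℂ) + 1) + L t)⁻¹) =
        (((r : ℂ) + 1) * (((r : ℂ) + 1) + L t)⁻¹) * ∑ q, star (u t q) * C q t := by
      rw [Finset.mul_sum]; congr 1; ext q; ring
    rw [e, norm_mul]
    refine mul_le_of_le_one_left (norm_nonneg _) ?_
    rw [norm_mul, norm_inv]
    refine mul_inv_le_one_of_le₀ ?_ (norm_nonneg _)
    have e : ‖(r : ℂ) + 1‖ = (r : ℝ) + 1 := by exact_mod_cast Complex.norm_natCast (r + 1)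
    rw [e]; exact (hden r ht).2
  · filter_upwards [hL0] with t ht
    refine tendsto_finsetSum _ fun q _ => Filter.Tendsto.const_mul _ ?_
    have h1 : Filter.Tendsto (fun r : ℕ => (1 : ℂ) + L t * ((r : ℂ) + 1)⁻¹) Filter.atTop (nhds 1) := by
      have := (tendsto_one_div_add_atTop_nhds_zero_nat (𝕜 := ℂ)).const_mul (L t)
      simpa using this.const_add 1
    have h2 := (h1.inv₀ one_ne_zero).const_mul (C q t)
    simp only [inv_one, mul_one] at h2
    refine h2.congr fun r => ?_
    have hr1 : (r : ℂ) + 1 ≠ 0 := by exact_mod_cast Nat.succ_ne_zero r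
    have hr2 : ((r : ℂ) + 1) + L t ≠ 0 := fun h4 => by
      have := (hden r ht).2
      rw [h4, norm_zero] at this
      linarith [show (0 : ℝ) ≤ r from Nat.cast_nonneg r]
    rw [show (1 : ℂ) + L t * ((r : ℂ) + 1)⁻¹ = (((r : ℂ) + 1) + L t) / ((r : ℂ) + 1) by
      field_simp, inv_div]
    field_simp

/-! ### Hilbert space preliminaries -/

section Hilbert

variable {H H' : Type*} [NormedAddCommGroup H] [InnerProductSpace ℂ H] [NormedAddCommGroup H']
  [InnerProductSpace ℂ H'] {ι : Type*}

theorem inner_linearCombination_eq {E : ι → H} {X : ι → H'}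
    (hG : ∀ i j, inner ℂ (X i) (X j) = inner ℂ (E i) (E j)) (a b : ι →₀ ℂ) :
    inner ℂ (Finsupp.linearCombination ℂ X a) (Finsupp.linearCombination ℂ X b) =
      inner ℂ (Finsupp.linearCombination ℂ E a) (Finsupp.linearCombination ℂ E b) := by
  simp only [Finsupp.linearCombination_apply, Finsupp.sum_inner, Finsupp.inner_sum, inner_smul_left,
    inner_smul_right, hG]

/-- Two families with the same Gram matrix, the first of them total, are related by a linear
isometry. -/
theorem exists_linearIsometry_of_gram [CompleteSpace H] [CompleteSpace H'] {E : ι → H} {X : ι → H'}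
    (hE : ∀ x : H, (∀ i, inner ℂ (E i) x = 0) → x = 0)
    (hG : ∀ i j, inner ℂ (X i) (X j) = inner ℂ (E i) (E j)) :
    ∃ V : H →ₗᵢ[ℂ] H', ∀ i, V (E i) = X i := by
  have hn : ∀ a : ι →₀ ℂ, ‖Finsupp.linearCombination ℂ X a‖ = ‖Finsupp.linearCombination ℂ E a‖ :=
    fun a => by
      rw [@norm_eq_sqrt_re_inner ℂ, @norm_eq_sqrt_re_inner ℂ, inner_linearCombination_eq hG]
  have hd : DenseRange (Finsupp.linearCombination ℂ E) := by
    have h : (LinearMap.range (Finsupp.linearCombination ℂ E)).topologicalClosure = ⊤ := by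
      rw [Submodule.topologicalClosure_eq_top_iff, Submodule.eq_bot_iff]
      intro x hx
      refine hE x fun i => hx _ ⟨Finsupp.single i 1, by simp⟩
    exact Submodule.dense_iff_topologicalClosure_eq_top.mpr h
  have hC : ∃ C, ∀ a : ι →₀ ℂ,
      ‖Finsupp.linearCombination ℂ X a‖ ≤ C * ‖Finsupp.linearCombination ℂ E a‖ :=
    ⟨1, fun a => by rw [hn, one_mul]⟩
  let V := (Finsupp.linearCombination ℂ X).extendOfNorm (Finsupp.linearCombination ℂ E)
  have hV : ∀ a, V (Finsupp.linearCombination ℂ E a) = Finsupp.linearCombination ℂ X a :=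
    LinearMap.extendOfNorm_eq hd hC
  refine ⟨⟨V.toLinearMap, fun x => ?_⟩, fun i => ?_⟩
  · induction x using hd.induction_on with
    | hp => exact isClosed_eq (V.continuous.norm) continuous_norm
    | ih a => simp only [ContinuousLinearMap.coe_coe, hV, hn]
  · simpa using hV (Finsupp.single i 1)

/-- The closed linear span of `E k p`, `k ≤ n`. -/
def closedPast (E : ℤ → ι → H) (n : ℤ) : Submodule ℂ H :=
  (Submodule.span ℂ {x | ∃ k ≤ n, ∃ p, x = E k p}).topologicalClosure

theorem mem_closedPast (E : ℤ → ι → H) {k n : ℤ} (h : k ≤ n) (p : ι) : E k p ∈ closedPast E n :=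
  Submodule.le_topologicalClosure _ (Submodule.subset_span ⟨k, h, p, rfl⟩)

theorem closedPast_mono (E : ℤ → ι → H) {m n : ℤ} (h : m ≤ n) : closedPast E m ≤ closedPast E n :=
  Submodule.topologicalClosure_mono (Submodule.span_mono fun _ ⟨k, hk, p, hx⟩ => ⟨k, hk.trans h, p, hx⟩)

instance [CompleteSpace H] (E : ℤ → ι → H) (n : ℤ) : CompleteSpace (closedPast E n) :=
  (Submodule.isClosed_topologicalClosure _).completeSpace_coe

/-- To be mapped into a closed subspace, or to be orthogonal to it, is decided on generators. -/
theorem map_mem_of_mem_closedPast {E : ℤ → ι → H} {n : ℤ} (L : H →L[ℂ] H') {W : Submodule ℂ H'}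
    (hW : IsClosed (W : Set H')) (h : ∀ k ≤ n, ∀ p, L (E k p) ∈ W) {x : H}
    (hx : x ∈ closedPast E n) : L x ∈ W := by
  have : closedPast E n ≤ W.comap L.toLinearMap := by
    refine Submodule.topologicalClosure_minimal _ (Submodule.span_le.mpr ?_)
      (hW.preimage L.continuous)
    rintro _ ⟨k, hk, p, rfl⟩
    exact h k hk p
  exact this hx

theorem inner_eq_zero_of_mem_closedPast {E : ℤ → ι → H} {n : ℤ} {e : H}
    (h : ∀ k ≤ n, ∀ p, inner ℂ e (E k p) = 0) {x : H} (hx : x ∈ closedPast E n) :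
    inner ℂ e x = 0 := by
  have := map_mem_of_mem_closedPast (innerSL ℂ e) (W := ⊥) (by simp)
    (fun k hk p => by simpa using h k hk p) hx
  simpa using this

/-- The coefficients of an element of the past up to time `n - 1` which is orthogonal to the past up
to time `-1` are square summable. Such an element is the sum of its components in the innovation
spaces of the times `0, …, n - 1`; the shifts of such a component are orthogonal to each other, so that
Bessel's inequality applies. -/
theorem summable_norm_inner_sq [CompleteSpace H] {E : ℤ → ι → H} {S : ℤ → H →ₗᵢ[ℂ] H}
    (hS0 : ∀ x, S 0 x = x) (hSadd : ∀ m n x, S (m + n) x = S m (S n x))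
    (hSE : ∀ m n p, S m (E n p) = E (m + n) p) (n : ℕ) {e : H} (he : e ∈ closedPast E (n - 1))
    (hort : ∀ k ≤ -1, ∀ p, inner ℂ e (E k p) = 0) (p : ι) :
    Summable fun k : ℤ => ‖inner ℂ (E k p) e‖ ^ 2 := by
  induction n generalizing e with
  | zero =>
    have : inner ℂ e e = 0 := inner_eq_zero_of_mem_closedPast hort (by simpa using he)
    rw [inner_self_eq_zero.mp this]
    simp
  | succ n ih =>
    have hSmem : ∀ (j m : ℤ) {x : H}, x ∈ closedPast E m → S j x ∈ closedPast E (j + m) :=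
      fun j m x hx => map_mem_of_mem_closedPast (S j).toContinuousLinearMap
        (Submodule.isClosed_topologicalClosure _) (fun k hk q => by
          change S j (E k q) ∈ _
          rw [hSE]; exact mem_closedPast E (by omega) q) hx
    set e' : H := (closedPast E (n - 1)).starProjection e with he'
    have hv : ∀ x ∈ closedPast E ((n : ℤ) - 1), inner ℂ (e - e') x = 0 := fun x hx =>
      Submodule.starProjection_inner_eq_zero e x hx
    have he'm : e' ∈ closedPast E ((n : ℤ) - 1) := Submodule.starProjection_apply_mem _ _
    have hsum' : Summable fun k : ℤ => ‖inner ℂ (E k p) e'‖ ^ 2 := ih he'm fun k hk q => by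
      have h1 := hv (E k q) (mem_closedPast E (by omega) q)
      rw [inner_sub_left, hort k hk q, zero_sub, neg_eq_zero] at h1
      exact h1
    have hvm : e - e' ∈ closedPast E (n : ℤ) := Submodule.sub_mem _ (by simpa using he)
      (closedPast_mono E (by omega) he'm)
    set v := e - e' with hvdef
    have horth : ∀ j k : ℤ, j ≠ k → inner ℂ (S j v) (S k v) = 0 := by
      have hlt : ∀ j k : ℤ, j < k → inner ℂ (S k v) (S j v) = 0 := fun j k hjk => by
        rw [show j = k + (j - k) by ring, hSadd, LinearIsometry.inner_map_map]
        exact hv _ (closedPast_mono E (by omega) (hSmem (j - k) n hvm))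
      intro j k hjk
      rcases lt_or_gt_of_ne hjk with h | h
      · rw [← inner_conj_symm, hlt j k h, map_zero]
      · exact hlt k j h
    have hsumv : Summable fun k : ℤ => ‖inner ℂ (E k p) v‖ ^ 2 := by
      by_cases hv0 : v = 0
      · rw [hv0]; simp
      have hn : ‖v‖ ≠ 0 := norm_ne_zero_iff.mpr hv0
      have hon : Orthonormal ℂ fun k : ℤ => ((‖v‖⁻¹ : ℝ) : ℂ) • S k v := by
        refine ⟨fun k => ?_, fun j k hjk => ?_⟩
        · rw [norm_smul, LinearIsometry.norm_map, Complex.norm_real, norm_inv, norm_norm,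
            inv_mul_cancel₀ hn]
        · simp only [inner_smul_left, inner_smul_right, horth j k hjk, mul_zero]
      have hb := (hon.inner_products_summable (E 0 p)).mul_left (‖v‖ ^ 2)
      rw [← (Equiv.neg ℤ).summable_iff] at hb
      refine hb.congr fun k => ?_
      have e1 : inner ℂ (E k p) v = inner ℂ (E 0 p) (S (-k) v) := by
        rw [← (S k).inner_map_map (E 0 p), hSE, ← hSadd, add_neg_cancel, hS0, add_zero]
      simp only [Function.comp_apply, Equiv.neg_apply, inner_smul_left, norm_mul, mul_pow]
      rw [e1, ← inner_conj_symm (E 0 p), RCLike.norm_conj]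
      simp only [RCLike.norm_conj, Complex.norm_real, norm_inv, norm_norm]
      field_simp
    refine Summable.of_nonneg_of_le (fun _ => sq_nonneg _) (fun k => ?_)
      ((hsum'.add hsumv).mul_left 2)
    have e1 : inner ℂ (E k p) e = inner ℂ (E k p) e' + inner ℂ (E k p) v := by
      rw [← inner_add_right]; simp [hvdef]
    rw [e1]
    have := norm_add_le (inner ℂ (E k p) e') (inner ℂ (E k p) v)
    nlinarith [norm_nonneg (inner ℂ (E k p) e' + inner ℂ (E k p) v),
      sq_nonneg (‖inner ℂ (E k p) e'‖ - ‖inner ℂ (E k p) v‖)]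

end Hilbert

section

/-! ### The space `L²(f)` -/

open scoped MatrixOrder Matrix.Norms.L2Operator in
theorem exists_measurable_sqrt (T : ℕ) : ∃ g : Matrix (Fin T) (Fin T) ℂ → Matrix (Fin T) (Fin T) ℂ,
    (∀ i j, Measurable fun A : Fin T → Fin T → ℂ => g (Matrix.of A) i j) ∧
      ∀ A, A.PosSemidef → (g A).IsHermitian ∧ g A * g A = A := by
  classical
  refine ⟨CFC.sqrt ∘ fun A => if 0 ≤ A then A else 0, fun i j => ?_, fun A hA => ?_⟩
  · have hc := CFC.continuousOn_sqrt (A := Matrix (Fin T) (Fin T) ℂ)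
    have hcl : IsClosed {A : Matrix (Fin T) (Fin T) ℂ | 0 ≤ A} := isClosed_Ici
    have hcl' : IsClosed {A : Fin T → Fin T → ℂ | 0 ≤ Matrix.of A} := hcl
    have h1 : ContinuousOn (fun A : Fin T → Fin T → ℂ => (CFC.sqrt (Matrix.of A)) i j)
        {A | 0 ≤ Matrix.of A} := by
      intro A hA
      have := hc (Matrix.of A) hA
      have h2 : ContinuousWithinAt (fun A : Fin T → Fin T → ℂ => (CFC.sqrt (Matrix.of A)))
        {A | 0 ≤ Matrix.of A} A := this
      have h3 : Continuous fun M : Matrix (Fin T) (Fin T) ℂ => M i j := continuous_id.matrix_elem i j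
      exact h3.continuousAt.comp_continuousWithinAt h2
    have := ContinuousOn.measurable_piecewise (s := {A : Fin T → Fin T → ℂ | 0 ≤ Matrix.of A}) h1
      (g := fun _ => (CFC.sqrt (0 : Matrix (Fin T) (Fin T) ℂ)) i j) continuousOn_const
      hcl'.measurableSet
    convert this using 1
    ext A
    by_cases h : 0 ≤ Matrix.of A <;> simp [Set.piecewise, h]
  · have h0 : 0 ≤ A := Matrix.nonneg_iff_posSemidef.mpr hA
    simp only [Function.comp_apply, h0, if_true]
    exact ⟨(CFC.sqrt_nonneg A).isSelfAdjoint, CFC.sqrt_mul_sqrt_self A h0⟩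

/-- A measurable function on matrices which gives a Hermitian square root of every positive
semidefinite matrix. -/
def psdSqrt {T : ℕ} : Matrix (Fin T) (Fin T) ℂ → Matrix (Fin T) (Fin T) ℂ :=
  (exists_measurable_sqrt T).choose

theorem measurable_psdSqrt {T : ℕ} (i j : Fin T) :
    Measurable fun A : Fin T → Fin T → ℂ => psdSqrt (Matrix.of A) i j :=
  (exists_measurable_sqrt T).choose_spec.1 i j

theorem psdSqrt_spec {T : ℕ} {A : Matrix (Fin T) (Fin T) ℂ} (hA : A.PosSemidef) :
    (psdSqrt A).IsHermitian ∧ psdSqrt A * psdSqrt A = A :=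
  (exists_measurable_sqrt T).choose_spec.2 A hA

variable {T : ℕ}

/-- The properties of the spectral density `f` and of the transfer function `ρ = χ_μ / β` which the
frequency domain arguments use: `|ρ|² f` and its inverse are integrable. -/
structure IsMinimal (ρ : ℝ → ℂ) (f : ℝ → Matrix (Fin T) (Fin T) ℂ) : Prop where
  measurable : Measurable ρ
  ne_zero : ∀ᵐ t ∂circ, ρ t ≠ 0
  aestronglyMeasurable : ∀ p q, AEStronglyMeasurable (fun t => f t p q) circ
  posSemidef : ∀ᵐ t ∂circ, (f t).PosSemidef
  isUnit : ∀ᵐ t ∂circ, IsUnit (f t).det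
  integrable : ∀ p, Integrable (fun t => ‖ρ t‖ ^ 2 * (f t p p).re) circ
  integrable_inv : ∀ p, Integrable (fun t => (‖ρ t‖ ^ 2)⁻¹ * ((f t)⁻¹ p p).re) circ

/-- The Hermitian square root of `fᵀ`, so that `uᵀ f conj(u) = |root f u|²`. -/
def root (f : ℝ → Matrix (Fin T) (Fin T) ℂ) (t : ℝ) : Matrix (Fin T) (Fin T) ℂ := psdSqrt (f t)ᵀ

/-- The space `L²([-π, π), ℂ^T)` with respect to `dt / 2π`. The space `L²(f)` is identified with it
by `u ↦ root f u`. -/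
abbrev VecL2 (T : ℕ) : Type := Lp (EuclideanSpace ℂ (Fin T)) 2 circ

/-- The function `root f u` with values in the Euclidean space. -/
def rootMul (f : ℝ → Matrix (Fin T) (Fin T) ℂ) (u : ℝ → Fin T → ℂ) (t : ℝ) :
    EuclideanSpace ℂ (Fin T) := WithLp.toLp 2 (root f t *ᵥ u t)

theorem aestronglyMeasurable_inv {f : ℝ → Matrix (Fin T) (Fin T) ℂ}
    (hf : ∀ p q, AEStronglyMeasurable (fun t => f t p q) circ) (p q : Fin T) :
    AEStronglyMeasurable (fun t => (f t)⁻¹ p q) circ := by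
  have h : AEMeasurable (fun t => fun i j => f t i j) circ :=
    aemeasurable_pi_lambda _ fun i => aemeasurable_pi_lambda _ fun j =>
      (hf i j).aemeasurable
  have h2 : Measurable fun A : Fin T → Fin T → ℂ => (Matrix.of A)⁻¹ p q := by
    simp only [Matrix.inv_def, Ring.inverse_eq_inv', Matrix.smul_apply, smul_eq_mul]
    have hof : Continuous fun A : Fin T → Fin T → ℂ => (Matrix.of A : Matrix (Fin T) (Fin T) ℂ) :=
      continuous_id
    exact (hof.matrix_det.measurable.inv).mul (hof.matrix_adjugate.matrix_elem p q).measurable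
  exact (h2.comp_aemeasurable h).aestronglyMeasurable

theorem aestronglyMeasurable_mulVec {A : ℝ → Matrix (Fin T) (Fin T) ℂ} {u : ℝ → Fin T → ℂ}
    (hA : ∀ p q, AEStronglyMeasurable (fun t => A t p q) circ)
    (hu : ∀ p, AEStronglyMeasurable (fun t => u t p) circ) (p : Fin T) :
    AEStronglyMeasurable (fun t => (A t *ᵥ u t) p) circ := by
  simp only [Matrix.mulVec, dotProduct]
  exact Finset.aestronglyMeasurable_fun_sum _ fun q _ => (hA p q).mul (hu q)

namespace IsMinimal

variable {ρ : ℝ → ℂ} {f : ℝ → Matrix (Fin T) (Fin T) ℂ} (hf : IsMinimal ρ f)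
include hf

theorem root_spec : ∀ᵐ t ∂circ, (root f t).IsHermitian ∧ root f t * root f t = (f t)ᵀ ∧
    IsUnit (root f t).det := by
  filter_upwards [hf.posSemidef, hf.isUnit] with t h1 h2
  obtain ⟨h3, h4⟩ := psdSqrt_spec h1.transpose
  refine ⟨h3, h4, ?_⟩
  have : (root f t).det * (root f t).det = (f t).det := by
    rw [← Matrix.det_mul, ← Matrix.det_transpose (f t)]; exact congrArg _ h4
  exact isUnit_of_mul_isUnit_left (this ▸ h2)

theorem aestronglyMeasurable_root (p q : Fin T) :
    AEStronglyMeasurable (fun t => root f t p q) circ := by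
  have h : AEMeasurable (fun t => fun i j => (f t)ᵀ i j) circ :=
    aemeasurable_pi_lambda _ fun i => aemeasurable_pi_lambda _ fun j =>
      (hf.aestronglyMeasurable j i).aemeasurable
  exact ((measurable_psdSqrt p q).comp_aemeasurable h).aestronglyMeasurable

theorem aestronglyMeasurable_rootMul {u : ℝ → Fin T → ℂ}
    (hu : ∀ p, AEStronglyMeasurable (fun t => u t p) circ) :
    AEStronglyMeasurable (rootMul f u) circ := by
  have : AEMeasurable (fun t => root f t *ᵥ u t) circ := aemeasurable_pi_lambda _ fun p =>
    (aestronglyMeasurable_mulVec hf.aestronglyMeasurable_root hu p).aemeasurable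
  exact ((WithLp.measurable_toLp 2 _).comp_aemeasurable this).aestronglyMeasurable

theorem inner_rootMul_left : ∀ᵐ t ∂circ, ∀ (u : ℝ → Fin T → ℂ) (x : EuclideanSpace ℂ (Fin T)),
    inner ℂ (rootMul f u t) x = (root f t *ᵥ x.ofLp) ⬝ᵥ star (u t) := by
  filter_upwards [hf.root_spec] with t ⟨h1, _, _⟩ u x
  rw [rootMul, EuclideanSpace.inner_eq_star_dotProduct, Matrix.star_mulVec, h1.eq,
    dotProduct_comm, ← Matrix.dotProduct_mulVec, dotProduct_comm]

theorem inner_rootMul : ∀ᵐ t ∂circ, ∀ u v : ℝ → Fin T → ℂ,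
    inner ℂ (rootMul f u t) (rootMul f v t) = v t ⬝ᵥ (f t *ᵥ star (u t)) := by
  filter_upwards [hf.root_spec, hf.inner_rootMul_left] with t ⟨_, h2, _⟩ h u v
  rw [h, rootMul, Matrix.mulVec_mulVec, h2, Matrix.mulVec_transpose, ← Matrix.dotProduct_mulVec]

theorem norm_sq_rootMul : ∀ᵐ t ∂circ, ∀ u : ℝ → Fin T → ℂ,
    ‖rootMul f u t‖ ^ 2 = (u t ⬝ᵥ (f t *ᵥ star (u t))).re := by
  filter_upwards [hf.inner_rootMul] with t h u
  rw [← h u u, ← RCLike.re_eq_complex_re, inner_self_eq_norm_sq]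

theorem memLp_rootMul {u : ℝ → Fin T → ℂ} (hu : ∀ p, AEStronglyMeasurable (fun t => u t p) circ)
    (hint : Integrable (fun t => (u t ⬝ᵥ (f t *ᵥ star (u t))).re) circ) :
    MemLp (rootMul f u) 2 circ := by
  rw [memLp_two_iff_integrable_sq_norm (hf.aestronglyMeasurable_rootMul hu)]
  refine hint.congr ?_
  filter_upwards [hf.norm_sq_rootMul] with t ht
  rw [ht]

/-- The inverse of the embedding `u ↦ root f u`. -/
theorem rootMul_inv_mulVec : ∀ᵐ t ∂circ, ∀ x : EuclideanSpace ℂ (Fin T),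
    (WithLp.toLp 2 (root f t *ᵥ ((f t)⁻¹ᵀ *ᵥ (root f t *ᵥ x.ofLp))) : EuclideanSpace ℂ (Fin T))
      = x := by
  filter_upwards [hf.root_spec] with t ⟨_, h2, h3⟩ x
  have e : root f t * ((f t)⁻¹ᵀ * root f t) = 1 := by
    rw [Matrix.transpose_nonsing_inv, ← h2, Matrix.mul_inv_rev, Matrix.mul_assoc,
      Matrix.nonsing_inv_mul _ h3, Matrix.mul_one, Matrix.mul_nonsing_inv _ h3]
  rw [Matrix.mulVec_mulVec, Matrix.mulVec_mulVec, Matrix.mul_assoc, e, Matrix.one_mulVec]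

end IsMinimal

/-- The function `e^{imt} ρ(t) δ_p` of `L²(f)`, which corresponds to the increment `χξ_p(m)`. -/
def expFun (ρ : ℝ → ℂ) (m : ℤ) (p : Fin T) (t : ℝ) : Fin T → ℂ := Pi.single p (ex m t * ρ t)

/-- The function of `L²(f)` whose inner product with `u` is the `j`-th Fourier coefficient of the
`q`-th component of `u / ρ`. -/
def dualFun (ρ : ℝ → ℂ) (f : ℝ → Matrix (Fin T) (Fin T) ℂ) (j : ℤ) (q : Fin T) (t : ℝ) : Fin T → ℂ :=
  (ex j t * (star (ρ t))⁻¹) • (f t)⁻¹ q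

namespace IsMinimal

variable {ρ : ℝ → ℂ} {f : ℝ → Matrix (Fin T) (Fin T) ℂ} (hf : IsMinimal ρ f)
include hf

theorem memLp_expFun (m : ℤ) (p : Fin T) : MemLp (rootMul f (expFun ρ m p)) 2 circ := by
  refine hf.memLp_rootMul (fun q => ?_) ((hf.integrable p).congr
    (Filter.Eventually.of_forall fun t => ?_))
  · by_cases h : q = p
    · subst h
      simp only [expFun, Pi.single_eq_same]
      exact ((continuous_ex m).measurable.mul hf.measurable).aestronglyMeasurable
    · simpa [expFun, h] using aestronglyMeasurable_const
  · have e : ex m t * ρ t * (f t p p * star (ex m t * ρ t)) = ((‖ρ t‖ ^ 2 : ℝ) : ℂ) * f t p p := by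
      rw [mul_comm (f t p p), ← mul_assoc, Complex.star_def, Complex.mul_conj, Complex.normSq_eq_norm_sq,
        norm_mul, norm_ex, one_mul]
    have e2 : star (expFun ρ m p t) = Pi.single p (star (ex m t * ρ t)) := by
      rw [expFun, Pi.single_star]
    simp only [e2]
    rw [expFun, single_dotProduct, Matrix.mulVec_single, Pi.smul_apply, op_smul_eq_mul,
      Matrix.col_apply, e, Complex.re_ofReal_mul]

theorem memLp_dualFun (j : ℤ) (q : Fin T) : MemLp (rootMul f (dualFun ρ f j q)) 2 circ := by
  refine hf.memLp_rootMul (fun r => ?_) ((hf.integrable_inv q).congr ?_)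
  · refine (((continuous_ex j).measurable.mul ?_).aestronglyMeasurable).mul
      (aestronglyMeasurable_inv hf.aestronglyMeasurable q r)
    exact (Complex.continuous_conj.measurable.comp hf.measurable).inv
  · filter_upwards [hf.isUnit] with t h
    have e : (f t)⁻¹ q ⬝ᵥ (f t *ᵥ star ((f t)⁻¹ q)) = star ((f t)⁻¹ q q) := by
      have h1 := congrFun (congrFun (Matrix.nonsing_inv_mul _ h) q)
      rw [Matrix.dotProduct_mulVec]
      have h2 : (f t)⁻¹ q ᵥ* f t = Pi.single q 1 := by
        ext r
        rw [Pi.single_apply, ← Matrix.mul_apply_eq_vecMul, h1 r, Matrix.one_apply]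
        simp [eq_comm]
      rw [h2]; simp
    have e2 : (ex j t * (star (ρ t))⁻¹) * star (ex j t * (star (ρ t))⁻¹) =
        (((‖ρ t‖ ^ 2)⁻¹ : ℝ) : ℂ) := by
      rw [Complex.star_def, Complex.mul_conj, Complex.normSq_eq_norm_sq, norm_mul, norm_ex]
      simp
    rw [dualFun, star_smul, Matrix.mulVec_smul, smul_dotProduct, dotProduct_smul, e, smul_smul, e2,
      smul_eq_mul, Complex.re_ofReal_mul]
    simp

end IsMinimal

end

section

variable {T : ℕ}

/-! ### The images of the increments and the dual system -/

/-- The function `conj(ρ) root f k`: if `k` is the image of `u ∈ L²(f)`, its Fourier coefficients are the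
inner products of `u` with the increments. -/
def specDens (ρ : ℝ → ℂ) (f : ℝ → Matrix (Fin T) (Fin T) ℂ) (k : VecL2 T) (t : ℝ) : Fin T → ℂ :=
  star (ρ t) • (root f t *ᵥ (k t).ofLp)

/-- The function `f⁻ᵀ root f k` of `L²(f)` whose image is `k`. -/
def preimage (f : ℝ → Matrix (Fin T) (Fin T) ℂ) (k : VecL2 T) (t : ℝ) : Fin T → ℂ :=
  (f t)⁻¹ᵀ *ᵥ (root f t *ᵥ (k t).ofLp)

namespace IsMinimal

variable {ρ : ℝ → ℂ} {f : ℝ → Matrix (Fin T) (Fin T) ℂ} (hf : IsMinimal ρ f)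
include hf

/-- The image of `e^{imt} ρ δ_p`. -/
def basis (m : ℤ) (p : Fin T) : VecL2 T := (hf.memLp_expFun m p).toLp

/-- The element whose inner product with the image of `u` is a Fourier coefficient of `u / ρ`. -/
def dual (j : ℤ) (q : Fin T) : VecL2 T := (hf.memLp_dualFun j q).toLp

theorem inner_expFun : ∀ᵐ t ∂circ, ∀ (m : ℤ) (p : Fin T) (x : EuclideanSpace ℂ (Fin T)),
    inner ℂ (rootMul f (expFun ρ m p) t) x = ex (-m) t * (star (ρ t) • (root f t *ᵥ x.ofLp)) p := by
  filter_upwards [hf.inner_rootMul_left] with t h m p x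
  rw [h, expFun, Pi.star_single, dotProduct_single, star_mul', star_ex, Pi.smul_apply, smul_eq_mul]
  ring

theorem inner_dualFun : ∀ᵐ t ∂circ, ∀ (j : ℤ) (q : Fin T) (x : EuclideanSpace ℂ (Fin T)),
    inner ℂ (rootMul f (dualFun ρ f j q) t) x =
      ex (-j) t * ((ρ t)⁻¹ * ((f t)⁻¹ᵀ *ᵥ (root f t *ᵥ x.ofLp)) q) := by
  filter_upwards [hf.inner_rootMul_left, hf.posSemidef] with t h hp j q x
  have e : star ((f t)⁻¹ q) = fun r => (f t)⁻¹ r q := by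
    ext r
    exact hp.isHermitian.inv.apply r q
  rw [h, dualFun, star_smul, star_mul', star_ex, star_inv₀, star_star, e, dotProduct_smul,
    smul_eq_mul, mul_assoc, dotProduct_comm]
  rfl

theorem integrable_specDens (k : VecL2 T) (p : Fin T) :
    Integrable (fun t => specDens ρ f k t p) circ := by
  refine (L2.integrable_inner (𝕜 := ℂ) (hf.basis 0 p) k).congr ?_
  filter_upwards [hf.inner_expFun, (hf.memLp_expFun 0 p).coeFn_toLp] with t h1 h2
  rw [basis, h2, h1, neg_zero, ex_zero, one_mul, specDens]

theorem inner_basis (m : ℤ) (p : Fin T) (k : VecL2 T) :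
    inner ℂ (hf.basis m p) k = ∫ t, ex (-m) t * specDens ρ f k t p ∂circ := by
  rw [L2.inner_def]
  refine integral_congr_ae ?_
  filter_upwards [hf.inner_expFun, (hf.memLp_expFun m p).coeFn_toLp] with t h1 h2
  rw [basis, h2, h1, specDens]

theorem integrable_preimage (k : VecL2 T) (q : Fin T) :
    Integrable (fun t => (ρ t)⁻¹ * preimage f k t q) circ := by
  refine (L2.integrable_inner (𝕜 := ℂ) (hf.dual 0 q) k).congr ?_
  filter_upwards [hf.inner_dualFun, (hf.memLp_dualFun 0 q).coeFn_toLp] with t h1 h2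
  rw [dual, h2, h1, neg_zero, ex_zero, one_mul, preimage]

theorem inner_dual (j : ℤ) (q : Fin T) (k : VecL2 T) :
    inner ℂ (hf.dual j q) k = ∫ t, ex (-j) t * ((ρ t)⁻¹ * preimage f k t q) ∂circ := by
  rw [L2.inner_def]
  refine integral_congr_ae ?_
  filter_upwards [hf.inner_dualFun, (hf.memLp_dualFun j q).coeFn_toLp] with t h1 h2
  rw [dual, h2, h1, preimage]

theorem rootMul_preimage (k : VecL2 T) : rootMul f (preimage f k) =ᵐ[circ] k := by
  filter_upwards [hf.rootMul_inv_mulVec] with t h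
  exact h (k t)

theorem preimage_eq : ∀ᵐ t ∂circ, ∀ (k : VecL2 T) (u : Fin T → ℂ),
    k t = WithLp.toLp 2 (root f t *ᵥ u) → preimage f k t = u := by
  filter_upwards [hf.root_spec, hf.isUnit] with t ⟨_, h2, _⟩ h3 k u hk
  rw [preimage, hk]
  simp only [Matrix.mulVec_mulVec, h2]
  rw [← Matrix.transpose_mul, Matrix.mul_nonsing_inv _ h3, Matrix.transpose_one, Matrix.one_mulVec]

theorem specDens_dotProduct (k : VecL2 T) : ∀ᵐ t ∂circ,
    (specDens ρ f k t) ⬝ᵥ ((f t)⁻¹ *ᵥ star (specDens ρ f k t)) =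
      ((‖ρ t‖ ^ 2 * ‖k t‖ ^ 2 : ℝ) : ℂ) := by
  filter_upwards [hf.inner_rootMul_left, hf.posSemidef, hf.rootMul_preimage k] with t h hp hk
  have h1 := h (preimage f k) (k t)
  have e : star (preimage f k t) = (f t)⁻¹ *ᵥ star (root f t *ᵥ (k t).ofLp) := by
    rw [preimage, Matrix.star_mulVec, ← Matrix.mulVec_transpose]
    congr 1
    ext i j
    exact hp.isHermitian.inv.apply i j
  rw [hk, inner_self_eq_norm_sq_to_K, e] at h1
  rw [specDens, star_smul, star_star, Matrix.mulVec_smul, smul_dotProduct, dotProduct_smul, ← h1,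
    smul_eq_mul, smul_eq_mul, ← mul_assoc, mul_comm (star (ρ t)), Complex.star_def,
    Complex.mul_conj, Complex.normSq_eq_norm_sq]
  simp

theorem inner_basis_basis (m n : ℤ) (p q : Fin T) : inner ℂ (hf.basis n q) (hf.basis m p) =
    ∫ t, ex (m - n) t * (((‖ρ t‖ ^ 2 : ℝ) : ℂ) * f t p q) ∂circ := by
  rw [L2.inner_def]
  refine integral_congr_ae ?_
  filter_upwards [hf.inner_rootMul, (hf.memLp_expFun m p).coeFn_toLp,
    (hf.memLp_expFun n q).coeFn_toLp] with t h1 h2 h3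
  have e : star (expFun ρ n q t) = Pi.single q (star (ex n t * ρ t)) := by
    rw [expFun, Pi.single_star]
  rw [basis, basis, h2, h3, h1, e, expFun, single_dotProduct, Matrix.mulVec_single, Pi.smul_apply,
    op_smul_eq_mul, Matrix.col_apply, star_mul', star_ex, sub_eq_add_neg, ex_add,
    ← Complex.normSq_eq_norm_sq, ← Complex.mul_conj, Complex.star_def]
  ring

theorem inner_dual_basis (j m : ℤ) (q p : Fin T) :
    inner ℂ (hf.dual j q) (hf.basis m p) = if m = j ∧ q = p then 1 else 0 := by
  rw [hf.inner_dual]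
  have : ∫ t, ex (-j) t * ((ρ t)⁻¹ * preimage f (hf.basis m p) t q) ∂circ =
      ∫ t, (if q = p then (1 : ℂ) else 0) * ex (m - j) t ∂circ := by
    refine integral_congr_ae ?_
    filter_upwards [hf.preimage_eq, (hf.memLp_expFun m p).coeFn_toLp, hf.ne_zero] with t h1 h2 h3
    rw [h1 (hf.basis m p) _ h2, expFun, Pi.single_apply, sub_eq_add_neg, ex_add]
    split_ifs
    · field_simp
    · simp
  rw [this, integral_const_mul, integral_ex]
  simp only [sub_eq_zero]
  split_ifs <;> simp_all

/-- The images of the increments are total. -/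
theorem eq_zero_of_inner_basis (k : VecL2 T) (h : ∀ m p, inner ℂ (hf.basis m p) k = 0) : k = 0 := by
  have h1 : ∀ᵐ t ∂circ, ∀ p, specDens ρ f k t p = 0 := by
    rw [ae_all_iff]
    intro p
    refine ae_eq_zero_of_integral_ex_mul (hf.integrable_specDens k p) fun m => ?_
    rw [← h (-m) p, hf.inner_basis, neg_neg]
  rw [Lp.eq_zero_iff_ae_eq_zero]
  filter_upwards [h1, hf.ne_zero, hf.rootMul_preimage k] with t h1 h2 h3
  rw [← h3, rootMul, preimage]
  have : root f t *ᵥ (k t).ofLp = 0 := by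
    ext p
    have := h1 p
    simp only [specDens, Pi.smul_apply, smul_eq_mul, mul_eq_zero, star_eq_zero, h2, false_or] at this
    exact this
  rw [this]
  simp

end IsMinimal

theorem memLp_ex_smul (n : ℤ) (k : VecL2 T) : MemLp (fun t => ex n t • k t) 2 circ := by
  refine (Lp.memLp k).of_le ((continuous_ex n).aestronglyMeasurable.smul (Lp.aestronglyMeasurable k))
    (Filter.Eventually.of_forall fun t => ?_)
  rw [norm_smul, norm_ex, one_mul]

/-- Multiplication by `e^{int}`, the shift of the stationary sequence. -/
def shift (n : ℤ) : VecL2 T →ₗᵢ[ℂ] VecL2 T where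
  toFun k := (memLp_ex_smul n k).toLp
  map_add' k l := by
    refine Lp.ext ?_
    filter_upwards [(memLp_ex_smul n (k + l)).coeFn_toLp, (memLp_ex_smul n k).coeFn_toLp,
      (memLp_ex_smul n l).coeFn_toLp, Lp.coeFn_add k l, Lp.coeFn_add (memLp_ex_smul n k).toLp
        (memLp_ex_smul n l).toLp] with t h1 h2 h3 h4 h5
    rw [h1, h5, Pi.add_apply, h2, h3, h4, Pi.add_apply, smul_add]
  map_smul' a k := by
    refine Lp.ext ?_
    filter_upwards [(memLp_ex_smul n (a • k)).coeFn_toLp, (memLp_ex_smul n k).coeFn_toLp,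
      Lp.coeFn_smul a k, Lp.coeFn_smul a (memLp_ex_smul n k).toLp] with t h1 h2 h3 h4
    rw [h1, RingHom.id_apply, h4, Pi.smul_apply, h2, h3, Pi.smul_apply, smul_comm]
  norm_map' k := by
    simp only [LinearMap.coe_mk, AddHom.coe_mk]
    rw [Lp.norm_toLp, Lp.norm_def]
    congr 1
    refine eLpNorm_congr_norm_ae (Filter.Eventually.of_forall fun t => ?_)
    rw [norm_smul, norm_ex, one_mul]

theorem coeFn_shift (n : ℤ) (k : VecL2 T) : shift n k =ᵐ[circ] fun t => ex n t • k t :=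
  (memLp_ex_smul n k).coeFn_toLp

theorem shift_zero (k : VecL2 T) : shift 0 k = k := by
  refine Lp.ext ?_
  filter_upwards [coeFn_shift 0 k] with t h
  rw [h, ex_zero, one_smul]

theorem shift_add (m n : ℤ) (k : VecL2 T) : shift (m + n) k = shift m (shift n k) := by
  refine Lp.ext ?_
  filter_upwards [coeFn_shift (m + n) k, coeFn_shift m (shift n k), coeFn_shift n k] with t h1 h2 h3
  rw [h1, h2, h3, ex_add, mul_smul]

theorem IsMinimal.shift_basis {ρ : ℝ → ℂ} {f : ℝ → Matrix (Fin T) (Fin T) ℂ} (hf : IsMinimal ρ f)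
    (m n : ℤ) (p : Fin T) : shift m (hf.basis n p) = hf.basis (m + n) p := by
  refine Lp.ext ?_
  filter_upwards [coeFn_shift m (hf.basis n p), (hf.memLp_expFun n p).coeFn_toLp,
    (hf.memLp_expFun (m + n) p).coeFn_toLp] with t h1 h2 h3
  rw [h1, basis, basis, h2, h3, rootMul, rootMul, ← WithLp.toLp_smul, ← Matrix.mulVec_smul, expFun,
    expFun, ← Pi.single_smul, smul_eq_mul, ex_add, mul_assoc]

end

section

variable {T : ℕ}

/-! ### The equation `F_μ c = b` in the frequency domain -/

theorem summable_coord (c : SeqSpace T) (q : Fin T) : Summable fun k => ‖c k q‖ ^ 2 := by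
  have h := (lp.memℓp c).summable (by simp)
  simp only [ENNReal.toReal_ofNat, Real.rpow_two] at h
  refine h.of_nonneg_of_le (fun _ => sq_nonneg _) fun k => ?_
  gcongr
  exact PiLp.norm_apply_le _ _

theorem memLp_series (c : SeqSpace T) (q : Fin T) : MemLp (fun t => series c t q) 2 circ :=
  memLp_fourierSum _ _

theorem integral_ex_mul_series (c : SeqSpace T) (j : ℕ) (q : Fin T) :
    ∫ t, ex (-j) t * series c t q ∂circ = c j q := by
  rw [← integral_ex_mul_fourierSum_coe one_ne_zero (summable_coord c q) j, one_mul]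
  rfl

theorem integral_ex_mul_series_of_neg (c : SeqSpace T) {j : ℤ} (hj : j < 0) (q : Fin T) :
    ∫ t, ex (-j) t * series c t q ∂circ = 0 :=
  integral_ex_mul_fourierSum_eq_zero one_ne_zero (summable_coord c q) fun k => by omega

namespace IsMinimal

variable {ρ : ℝ → ℂ} {f : ℝ → Matrix (Fin T) (Fin T) ℂ} (hf : IsMinimal ρ f)
include hf

/-- An element whose inner products with the increments before time `0` vanish is determined by the
sequence of the others, if that sequence is square summable. -/
theorem specDens_ae_eq_series {k : VecL2 T} {c : SeqSpace T}
    (h0 : ∀ (j : ℕ) q, c j q = inner ℂ (hf.basis j q) k)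
    (hneg : ∀ j < 0, ∀ q, inner ℂ (hf.basis j q) k = 0) : specDens ρ f k =ᵐ[circ] series c := by
  have h : ∀ᵐ t ∂circ, ∀ q, specDens ρ f k t q - series c t q = 0 := by
    rw [ae_all_iff]
    intro q
    have hi := (memLp_series c q).integrable one_le_two
    refine ae_eq_zero_of_integral_ex_mul ((hf.integrable_specDens k q).sub hi) fun m => ?_
    simp only [mul_sub]
    rw [integral_sub (integrable_ex_mul (hf.integrable_specDens k q) m) (integrable_ex_mul hi m)]
    obtain ⟨j, rfl⟩ : ∃ j, m = -j := ⟨-m, by ring⟩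
    rw [← hf.inner_basis]
    rcases lt_or_ge j 0 with hj | hj
    · rw [integral_ex_mul_series_of_neg c hj, hneg j hj, sub_zero]
    · lift j to ℕ using hj
      rw [integral_ex_mul_series, h0, sub_self]
  filter_upwards [h] with t ht
  ext q
  exact sub_eq_zero.mp (ht q)

theorem star_preimage_dotProduct (k : VecL2 T) : ∀ᵐ t ∂circ,
    ∑ q, star ((ρ t)⁻¹ * preimage f k t q) * specDens ρ f k t q = ((‖k t‖ ^ 2 : ℝ) : ℂ) := by
  filter_upwards [hf.inner_rootMul_left, hf.rootMul_preimage k, hf.ne_zero] with t h hk h0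
  have h1 := h (preimage f k) (k t)
  rw [hk, inner_self_eq_norm_sq_to_K] at h1
  have h0' : star (ρ t) ≠ 0 := star_ne_zero.mpr h0
  simp only [specDens, Pi.smul_apply, smul_eq_mul, star_mul', star_inv₀]
  rw [show ((‖k t‖ ^ 2 : ℝ) : ℂ) = (root f t *ᵥ (k t).ofLp) ⬝ᵥ star (preimage f k t) by
    rw [← h1]; simp, dotProduct]
  refine Finset.sum_congr rfl fun q _ => ?_
  rw [Pi.star_apply]
  field_simp

/-- The operator `F_μ` is injective: `u = f⁻ᵀ root f k / ρ` and `C = conj(ρ) root f k` satisfy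
`∑_q conj(u_q) C_q = |k|²`, and the integral of the left-hand side vanishes. -/
theorem eq_zero_of_inner_dual {k : VecL2 T} {c : SeqSpace T}
    (hk : specDens ρ f k =ᵐ[circ] series c) (h : ∀ (j : ℕ) q, inner ℂ (hf.dual j q) k = 0) :
    k = 0 := by
  have he : (fun t => ∑ q, star ((ρ t)⁻¹ * preimage f k t q) * fourierSum 1 (fun k => c k q) t)
      =ᵐ[circ] fun t => ((‖k t‖ ^ 2 : ℝ) : ℂ) := by
    filter_upwards [hf.star_preimage_dotProduct k, hk] with t h1 h2
    rw [← h1, h2]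
    rfl
  have hi : Integrable (fun t => ‖k t‖ ^ 2) circ :=
    (memLp_two_iff_integrable_sq_norm (Lp.aestronglyMeasurable k)).mp (Lp.memLp k)
  have h0 := integral_star_mul_fourierSum_eq_zero (fun q => summable_coord c q)
    (u := fun t q => (ρ t)⁻¹ * preimage f k t q) (fun q => hf.integrable_preimage k q)
    (fun j q => by rw [← hf.inner_dual]; exact h j q) (hi.ofReal.congr he.symm)
  rw [integral_congr_ae he, integral_complex_ofReal, Complex.ofReal_eq_zero,
    integral_eq_zero_iff_of_nonneg (fun t => sq_nonneg _) hi] at h0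
  rw [Lp.eq_zero_iff_ae_eq_zero]
  filter_upwards [h0] with t ht
  simpa using ht

theorem unique_of_inner_dual {k l : VecL2 T} {c d : SeqSpace T}
    (hk : specDens ρ f k =ᵐ[circ] series c) (hl : specDens ρ f l =ᵐ[circ] series d)
    (h : ∀ (j : ℕ) q, inner ℂ (hf.dual j q) k = inner ℂ (hf.dual j q) l) : k = l ∧ c = d := by
  have hcoef : ∀ {k : VecL2 T} {c : SeqSpace T}, specDens ρ f k =ᵐ[circ] series c →
      (∀ (j : ℕ) q, c j q = inner ℂ (hf.basis j q) k) ∧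
      (∀ j < 0, ∀ q, inner ℂ (hf.basis j q) k = 0) := by
    intro k c hk
    have : ∀ (j : ℤ) q, inner ℂ (hf.basis j q) k = ∫ t, ex (-j) t * series c t q ∂circ :=
      fun j q => by
        rw [hf.inner_basis]
        refine integral_congr_ae ?_
        filter_upwards [hk] with t ht
        rw [ht]
    exact ⟨fun j q => by rw [this, integral_ex_mul_series],
      fun j hj q => by rw [this, integral_ex_mul_series_of_neg c hj]⟩
  obtain ⟨h1, h2⟩ := hcoef hk
  obtain ⟨h3, h4⟩ := hcoef hl
  have hs : specDens ρ f (k - l) =ᵐ[circ] series (c - d) := by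
    refine hf.specDens_ae_eq_series (fun j q => ?_) fun j hj q => ?_
    · rw [inner_sub_right, ← h1, ← h3]; rfl
    · rw [inner_sub_right, h2 j hj, h4 j hj, sub_zero]
  have hkl : k = l := sub_eq_zero.mp (hf.eq_zero_of_inner_dual hs fun j q => by
    rw [inner_sub_right, h, sub_self])
  refine ⟨hkl, ?_⟩
  ext j q
  rw [h1, h3, hkl]

/-- The projection of a polynomial `∑_{k ≤ N} a(k) e^{ikt} ρ δ_p` on the past up to time `-1`, and the
sequence `c` of the inner products of the error with the increments. That `c` is square summable is the
content of `summable_norm_inner_sq`. -/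
theorem exists_prediction (a : ℕ → ℂ) (N : ℕ) (p : Fin T) : ∃ (e : VecL2 T) (c : SeqSpace T),
    (∑ k ∈ Finset.range (N + 1), a k • hf.basis k p) - e ∈ closedPast hf.basis (-1) ∧
    (∀ j ≤ -1, ∀ q, inner ℂ (hf.basis j q) e = 0) ∧
    (∀ (j : ℕ) q, c j q = inner ℂ (hf.basis j q) e) ∧
    specDens ρ f e =ᵐ[circ] series c ∧
    ∀ (j : ℕ) q, inner ℂ (hf.dual j q) e = if j ≤ N ∧ q = p then a j else 0 := by
  set τ := ∑ k ∈ Finset.range (N + 1), a k • hf.basis (k : ℤ) p with hτ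
  set w := (closedPast hf.basis (-1)).starProjection τ with hw
  have hwm : w ∈ closedPast hf.basis (-1) := Submodule.starProjection_apply_mem _ _
  have hort : ∀ j ≤ -1, ∀ q, inner ℂ (τ - w) (hf.basis j q) = 0 := fun j hj q =>
    Submodule.starProjection_inner_eq_zero τ _ (mem_closedPast _ hj q)
  have hort' : ∀ j ≤ -1, ∀ q, inner ℂ (hf.basis j q) (τ - w) = 0 := fun j hj q => by
    rw [← inner_conj_symm, hort j hj, map_zero]
  have hmem : τ - w ∈ closedPast hf.basis (((N + 1 : ℕ) : ℤ) - 1) := by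
    refine Submodule.sub_mem _ (Submodule.sum_mem _ fun k hk => Submodule.smul_mem _ _
      (mem_closedPast _ ?_ p)) (closedPast_mono _ (by omega) hwm)
    have := Finset.mem_range.mp hk
    omega
  have hs : ∀ q, Summable fun j : ℕ => ‖inner ℂ (hf.basis j q) (τ - w)‖ ^ 2 := fun q =>
    (summable_norm_inner_sq shift_zero shift_add hf.shift_basis (N + 1) hmem hort q).comp_injective
      Nat.cast_injective
  let c : SeqSpace T := ⟨fun j => WithLp.toLp 2 fun q => inner ℂ (hf.basis j q) (τ - w), by
    refine memℓp_gen ?_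
    simp only [ENNReal.toReal_ofNat, Real.rpow_two, EuclideanSpace.norm_sq_eq]
    exact summable_sum fun q _ => hs q⟩
  refine ⟨τ - w, c, by simpa using hwm, hort', fun j q => rfl,
    hf.specDens_ae_eq_series (fun j q => rfl) fun j hj q => hort' j (by omega) q, fun j q => ?_⟩
  have h1 : inner ℂ (hf.dual j q) w = 0 := inner_eq_zero_of_mem_closedPast (fun k hk r => by
    rw [hf.inner_dual_basis, if_neg (by omega)]) hwm
  rw [inner_sub_right, h1, sub_zero, hτ, inner_sum]
  simp only [inner_smul_right, hf.inner_dual_basis, Nat.cast_inj]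
  split_ifs with h
  · obtain ⟨h2, rfl⟩ := h
    simp [Nat.lt_succ_of_le h2]
  · refine Finset.sum_eq_zero fun k hk => ?_
    rw [if_neg, mul_zero]
    rintro ⟨rfl, rfl⟩
    exact h ⟨Nat.le_of_lt_succ (Finset.mem_range.mp hk), rfl⟩

end IsMinimal

end

/-! ### The algebra of generalized multiple increments -/

/-- The value `∑_k p_k x(m - k)` at time `m` of a polynomial in the backward shift, applied to `x`. -/
def shiftEval (x : ℤ → ℂ) (m : ℤ) : Polynomial ℂ →ₗ[ℂ] ℂ :=
  Polynomial.lsum fun k : ℕ => x (m - k) • LinearMap.id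

theorem shiftEval_C_mul_X_pow (x : ℤ → ℂ) (m : ℤ) (a : ℂ) (k : ℕ) :
    shiftEval x m (Polynomial.C a * Polynomial.X ^ k) = a * x (m - k) := by
  rw [shiftEval, Polynomial.lsum_apply, Polynomial.C_mul_X_pow_eq_monomial,
    Polynomial.sum_monomial_index]
  · simp [mul_comm]
  · simp

theorem shiftEval_eq_sum (x : ℤ → ℂ) (m : ℤ) (q : Polynomial ℂ) {n : ℕ} (hn : q.natDegree < n) :
    shiftEval x m q = ∑ k ∈ Finset.range n, q.coeff k * x (m - k) := by
  conv_lhs => rw [q.as_sum_range_C_mul_X_pow' hn]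
  simp only [map_sum, shiftEval_C_mul_X_pow]

theorem shiftEval_mul (x : ℤ → ℂ) (m : ℤ) (q r : Polynomial ℂ) :
    shiftEval x m (q * r) = ∑ k ∈ Finset.range (q.natDegree + 1),
      q.coeff k * shiftEval x (m - k) r := by
  conv_lhs => rw [q.as_sum_range_C_mul_X_pow, Finset.sum_mul]
  rw [map_sum]
  refine Finset.sum_congr rfl fun k _ => ?_
  rw [shiftEval_eq_sum x (m - k) r (Nat.lt_succ_self _), Finset.mul_sum]
  conv_lhs => rw [r.as_sum_range_C_mul_X_pow, Finset.mul_sum]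
  rw [map_sum]
  refine Finset.sum_congr rfl fun j _ => ?_
  rw [show Polynomial.C (q.coeff k) * Polynomial.X ^ k * (Polynomial.C (r.coeff j) * Polynomial.X ^ j)
      = Polynomial.C (q.coeff k * r.coeff j) * Polynomial.X ^ (k + j) by
    rw [Polynomial.C_mul, pow_add]; ring, shiftEval_C_mul_X_pow, mul_assoc]
  congr 3
  push_cast; ring

namespace GMParams

variable (γ : GMParams)

/-- The increment operator `∏ᵢ (1 - B^{μᵢ sᵢ})^{dᵢ}` as a polynomial in the backward shift. -/
def poly : Polynomial ℂ := ∏ i, (1 - (Polynomial.X : Polynomial ℂ) ^ (γ.mu i * γ.s i)) ^ γ.d i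

theorem natDegree_poly_le : γ.poly.natDegree ≤ γ.deg := by
  refine (Polynomial.natDegree_prod_le _ _).trans (Finset.sum_le_sum fun i _ => ?_)
  refine Polynomial.natDegree_pow_le.trans ?_
  rw [mul_comm (γ.mu i * γ.s i)]
  gcongr
  refine (Polynomial.natDegree_sub_le _ _).trans ?_
  simp

theorem e_eq_zero {k : ℕ} (h : γ.deg < k) : γ.e k = 0 :=
  Polynomial.coeff_eq_zero_of_natDegree_lt (γ.natDegree_poly_le.trans_lt h)

theorem e_zero : γ.e 0 = 1 := by
  rw [e, Polynomial.coeff_zero_eq_eval_zero, Polynomial.eval_prod]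
  refine Finset.prod_eq_one fun i _ => ?_
  have := Nat.mul_pos (γ.mu_pos i) (γ.s_pos i)
  simp [this.ne']

theorem inc_eq_shiftEval (x : ℤ → ℂ) (m : ℤ) : γ.inc x m = shiftEval x m γ.poly := by
  have h : γ.poly = ∑ l ∈ Fintype.piFinset (fun i => Finset.range (γ.d i + 1)),
      Polynomial.C (∏ i, (-1 : ℂ) ^ l i * ((γ.d i).choose (l i) : ℂ)) *
        Polynomial.X ^ (∑ i, γ.mu i * γ.s i * l i) := by
    have h1 : ∀ i, (1 - (Polynomial.X : Polynomial ℂ) ^ (γ.mu i * γ.s i)) ^ γ.d i =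
        ∑ l ∈ Finset.range (γ.d i + 1), Polynomial.C ((-1 : ℂ) ^ l * ((γ.d i).choose l : ℂ)) *
          Polynomial.X ^ (γ.mu i * γ.s i * l) := fun i => by
      rw [sub_eq_neg_add, add_pow]
      refine Finset.sum_congr rfl fun l _ => ?_
      rw [neg_pow, one_pow, pow_mul]
      simp
      ring
    rw [poly, Finset.prod_congr rfl fun i _ => h1 i, Finset.prod_univ_sum]
    refine Finset.sum_congr rfl fun l _ => ?_
    rw [Finset.prod_mul_distrib, map_prod, Finset.prod_pow_eq_pow_sum]
  rw [h, map_sum, inc]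
  refine Finset.sum_congr rfl fun l _ => ?_
  rw [shiftEval_C_mul_X_pow]
  push_cast
  rfl

theorem inc_eq_sum (x : ℤ → ℂ) (m : ℤ) {n : ℕ} (hn : γ.deg < n) :
    γ.inc x m = ∑ k ∈ Finset.range n, γ.e k * x (m - k) := by
  rw [inc_eq_shiftEval, shiftEval_eq_sum x m _ (γ.natDegree_poly_le.trans_lt hn)]
  rfl

/-- The generating function of `d_μ`. -/
def dseries : PowerSeries ℂ :=
  ∏ i, (PowerSeries.mk (fun n => if γ.mu i * γ.s i ∣ n then (1 : ℂ) else 0)) ^ γ.d i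

theorem one_sub_X_pow_mul_mk {a : ℕ} (ha : 0 < a) :
    (1 - (PowerSeries.X : PowerSeries ℂ) ^ a) *
      PowerSeries.mk (fun n => if a ∣ n then (1 : ℂ) else 0) = 1 := by
  ext n
  rw [sub_mul, one_mul, map_sub, PowerSeries.coeff_mk, PowerSeries.coeff_X_pow_mul',
    PowerSeries.coeff_one]
  by_cases h : a ≤ n
  · have h0 : n ≠ 0 := by omega
    rw [if_pos h, PowerSeries.coeff_mk, if_neg h0]
    have : a ∣ n - a ↔ a ∣ n := by
      conv_rhs => rw [← Nat.sub_add_cancel h]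
      simp
    simp [this]
  · rw [if_neg h, sub_zero]
    have : a ∣ n ↔ n = 0 := ⟨fun hd => by
      by_contra h0
      exact h (Nat.le_of_dvd (Nat.pos_of_ne_zero h0) hd), fun h0 => h0 ▸ dvd_zero a⟩
    simp [this]

theorem poly_mul_dseries : (γ.poly : PowerSeries ℂ) * γ.dseries = 1 := by
  have : (γ.poly : PowerSeries ℂ) =
      ∏ i, (1 - (PowerSeries.X : PowerSeries ℂ) ^ (γ.mu i * γ.s i)) ^ γ.d i := by
    rw [poly, ← Polynomial.coeToPowerSeries.ringHom_apply, map_prod]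
    simp
  rw [this, dseries, ← Finset.prod_mul_distrib]
  refine Finset.prod_eq_one fun i _ => ?_
  rw [← mul_pow, one_sub_X_pow_mul_mk (Nat.mul_pos (γ.mu_pos i) (γ.s_pos i)), one_pow]

/-- The inversion of the increments: `∑_{k ≤ N} d_μ(N - k) χx(k)` is `x(N)` plus a combination of the
initial values `x(-1), …, x(-n)`. -/
theorem sum_dcoef_mul_inc (x : ℤ → ℂ) (N : ℕ) :
    ∑ k ∈ Finset.range (N + 1), γ.dcoef (N - k) * γ.inc x k =
      x N + ∑ j ∈ Finset.Icc 1 γ.deg, γ.v N j * x (-(j : ℤ)) := by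
  have hinc : ∀ k : ℕ, γ.inc x k = (∑ i ∈ Finset.range (k + 1), γ.e i * x ((k - i : ℕ) : ℤ)) +
      ∑ j ∈ Finset.Icc 1 γ.deg, γ.e (k + j) * x (-(j : ℤ)) := fun k => by
    rw [γ.inc_eq_sum x k (n := k + 1 + γ.deg) (by omega), Finset.sum_range_add]
    congr 1
    · refine Finset.sum_congr rfl fun i hi => ?_
      rw [Nat.cast_sub (Nat.le_of_lt_succ (Finset.mem_range.mp hi))]
    · rw [← Finset.Ico_succ_right_eq_Icc, Finset.sum_Ico_eq_sum_range]
      refine Finset.sum_congr (by simp) fun i _ => ?_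
      rw [show k + 1 + i = k + (1 + i) by ring]
      congr 2
      push_cast; ring
  simp only [hinc, mul_add, Finset.sum_add_distrib]
  congr 1
  · let xs : PowerSeries ℂ := PowerSeries.mk fun m => x m
    have h1 : ∀ k : ℕ, ∑ i ∈ Finset.range (k + 1), γ.e i * x ((k - i : ℕ) : ℤ) =
        PowerSeries.coeff k ((γ.poly : PowerSeries ℂ) * xs) := fun k => by
      rw [PowerSeries.coeff_mul, Finset.Nat.sum_antidiagonal_eq_sum_range_succ_mk]
      refine Finset.sum_congr rfl fun i _ => ?_
      rw [Polynomial.coeff_coe, PowerSeries.coeff_mk]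
      rfl
    simp only [h1]
    have h2 : PowerSeries.coeff N ((γ.poly : PowerSeries ℂ) * xs * γ.dseries) = x N := by
      rw [mul_right_comm, poly_mul_dseries, one_mul, PowerSeries.coeff_mk]
    rw [← h2, PowerSeries.coeff_mul, Finset.Nat.sum_antidiagonal_eq_sum_range_succ_mk]
    exact Finset.sum_congr rfl fun k _ => mul_comm _ _
  · simp only [Finset.mul_sum]
    rw [Finset.sum_comm]
    refine Finset.sum_congr rfl fun j _ => ?_
    rw [v, Finset.sum_mul]
    symm
    refine (Finset.sum_subset (Finset.range_subset_range.mpr (by omega)) fun l hl hl' => ?_).trans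
      (Finset.sum_congr rfl fun l _ => by ring)
    rw [Finset.mem_range] at hl hl'
    rw [γ.e_eq_zero (by omega)]
    simp

/-- If all the steps exceed `N`, the inversion of the increments is trivial up to time `N`. -/
theorem dcoef_eq_ite {N : ℕ} (h : ∀ i, N < γ.mu i * γ.s i) {k : ℕ} (hk : k ≤ N) :
    γ.dcoef k = if k = 0 then 1 else 0 := by
  let J : Ideal (PowerSeries ℂ) := Ideal.span {PowerSeries.X ^ (N + 1)}
  have h1 : Ideal.Quotient.mk J γ.dseries = 1 := by
    rw [dseries, map_prod]
    refine Finset.prod_eq_one fun i _ => ?_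
    rw [map_pow]
    suffices Ideal.Quotient.mk J
        (PowerSeries.mk (fun n => if γ.mu i * γ.s i ∣ n then (1 : ℂ) else 0)) = 1 by
      rw [this, one_pow]
    rw [← map_one (Ideal.Quotient.mk J), Ideal.Quotient.eq, Ideal.mem_span_singleton,
      PowerSeries.X_pow_dvd_iff]
    intro m hm
    rw [map_sub, PowerSeries.coeff_mk, PowerSeries.coeff_one]
    have : γ.mu i * γ.s i ∣ m ↔ m = 0 := ⟨fun hd => by
      by_contra h0
      have := Nat.le_of_dvd (Nat.pos_of_ne_zero h0) hd
      have := h i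
      omega, fun h0 => h0 ▸ dvd_zero _⟩
    simp [this]
  rw [← map_one (Ideal.Quotient.mk J), Ideal.Quotient.eq, Ideal.mem_span_singleton,
    PowerSeries.X_pow_dvd_iff] at h1
  have h2 := h1 k (by omega)
  rw [map_sub, PowerSeries.coeff_one, sub_eq_zero] at h2
  exact h2

/-- A polynomial in the backward shift whose value at time `-1` vanishes on all the sequences without
increments is a multiple of the increment operator: otherwise a linear functional on
`ℂ[X] / (poly)`, where `X` is invertible, gives a counterexample. -/
theorem poly_dvd_of_shiftEval_eq_zero {A : Polynomial ℂ}
    (h : ∀ y : ℤ → ℂ, (∀ m, γ.inc y m = 0) → shiftEval y (-1) A = 0) : γ.poly ∣ A := by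
  let J : Ideal (Polynomial ℂ) := Ideal.span {γ.poly}
  have hu : Ideal.Quotient.mk J Polynomial.X * Ideal.Quotient.mk J (-γ.poly.divX) = 1 := by
    rw [← map_mul, ← map_one (Ideal.Quotient.mk J), Ideal.Quotient.eq, Ideal.mem_span_singleton]
    have h1 := Polynomial.X_mul_divX_add γ.poly
    have h2 : γ.poly.coeff 0 = 1 := γ.e_zero
    rw [h2, map_one] at h1
    exact ⟨-1, by linear_combination -h1⟩
  let u : (Polynomial ℂ ⧸ J)ˣ := ⟨_, _, hu, by rw [mul_comm]; exact hu⟩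
  rw [← Ideal.mem_span_singleton, ← Ideal.Quotient.eq_zero_iff_mem,
    ← Module.forall_dual_apply_eq_zero_iff ℂ]
  intro φ
  let y : ℤ → ℂ := fun m => φ ((u ^ (-1 - m) : (Polynomial ℂ ⧸ J)ˣ) : Polynomial ℂ ⧸ J)
  have key : ∀ (m : ℤ) (q : Polynomial ℂ), shiftEval y m q =
      φ (((u ^ (-1 - m) : (Polynomial ℂ ⧸ J)ˣ) : Polynomial ℂ ⧸ J) * Ideal.Quotient.mk J q) := by
    intro m q
    rw [shiftEval_eq_sum y m q (Nat.lt_succ_self _)]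
    conv_rhs => rw [q.as_sum_range_C_mul_X_pow, map_sum, Finset.mul_sum, map_sum]
    refine Finset.sum_congr rfl fun k _ => ?_
    have e1 : ((u ^ (-1 - (m - k)) : (Polynomial ℂ ⧸ J)ˣ) : Polynomial ℂ ⧸ J) =
        ((u ^ (-1 - m) : (Polynomial ℂ ⧸ J)ˣ) : Polynomial ℂ ⧸ J) *
          Ideal.Quotient.mk J Polynomial.X ^ k := by
      rw [show (-1 - (m - k) : ℤ) = (-1 - m) + k by ring, _root_.zpow_add, Units.val_mul, zpow_natCast,
        Units.val_pow_eq_pow_val]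
    rw [← Polynomial.smul_eq_C_mul]
    have e2 : Ideal.Quotient.mk J (q.coeff k • Polynomial.X ^ k) =
        q.coeff k • Ideal.Quotient.mk J Polynomial.X ^ k := by
      rw [← map_pow]; rfl
    rw [e2, mul_smul_comm, map_smul, ← e1, smul_eq_mul]
  have h0 := h y fun m => by
    rw [inc_eq_shiftEval, key, Ideal.Quotient.eq_zero_iff_mem.mpr (Ideal.mem_span_singleton_self _),
      mul_zero, map_zero]
  rw [key] at h0
  simpa using h0

end GMParams

section

/-! ### Linear estimates -/

namespace GMParams
variable (γ : GMParams) {T : ℕ}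

theorem inc_zero (m : ℤ) : γ.inc (fun _ => 0) m = 0 := by
  simp [inc]

/-- A finite combination of observed values which vanishes on all the sequences without increments is a
finite combination of observed increments. -/
theorem exists_sum_inc_of_annihilates {c : ℤ × Fin T →₀ ℂ} (hc : ∀ a ∈ c.support, a.1 ≤ -1)
    (h : ∀ x : ℤ → Fin T → ℂ, (∀ m q, γ.inc (fun k => x k q) m = 0) →
      c.sum (fun a z => z * x a.1 a.2) = 0) :
    ∃ B : Fin T → Polynomial ℂ, ∀ x : ℤ → Fin T → ℂ, c.sum (fun a z => z * x a.1 a.2) =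
      ∑ q, ∑ k ∈ Finset.range ((B q).natDegree + 1),
        (B q).coeff k * γ.inc (fun k => x k q) (-1 - k) := by
  let A : Fin T → Polynomial ℂ := fun q => ∑ a ∈ c.support,
    if a.2 = q then Polynomial.C (c a) * Polynomial.X ^ (-1 - a.1).toNat else 0
  have hA : ∀ q (y : ℤ → ℂ), shiftEval y (-1) (A q) =
      ∑ a ∈ c.support, if a.2 = q then c a * y a.1 else 0 := fun q y => by
    rw [map_sum]
    refine Finset.sum_congr rfl fun a ha => ?_
    split_ifs
    · rw [shiftEval_C_mul_X_pow]
      have := hc a ha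
      congr 2
      omega
    · rw [map_zero]
  have hdvd : ∀ q, γ.poly ∣ A q := fun q => γ.poly_dvd_of_shiftEval_eq_zero fun y hy => by
    refine (hA q y).trans (Eq.trans ?_ (h (fun m r => if r = q then y m else 0) fun m r => ?_))
    · refine Finset.sum_congr rfl fun a _ => ?_
      split_ifs with h1 <;> simp [h1]
    · by_cases hr : r = q
      · simp only [hr, if_true, hy]
      · simp only [hr, if_false, inc_zero]
  choose B hB using hdvd
  refine ⟨B, fun x => ?_⟩
  have h1 : ∀ q, ∑ k ∈ Finset.range ((B q).natDegree + 1),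
      (B q).coeff k * γ.inc (fun k => x k q) (-1 - k) = shiftEval (fun k => x k q) (-1) (A q) :=
    fun q => by
      rw [hB q, mul_comm, shiftEval_mul]
      simp only [inc_eq_shiftEval]
  simp only [h1, hA]
  rw [Finset.sum_comm, Finsupp.sum]
  refine Finset.sum_congr rfl fun a _ => ?_
  simp

end GMParams

variable {Ω : Type*} [MeasurableSpace Ω] {P : Measure Ω} {T : ℕ}

/-- The variable `∑_{k ≤ N} d_μ(N - k) χξ_p(k)`. -/
def target (γ : GMParams) (X : ℤ → Fin T → Lp ℂ 2 P) (p : Fin T) (N : ℕ) : Lp ℂ 2 P :=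
  ∑ k ∈ Finset.range (N + 1), γ.dcoef (N - k) • X k p

/-- The combination `-∑_j v_N(j) ξ_p(-j)` of the initial values. -/
def initialComb (γ : GMParams) (p : Fin T) (N : ℕ) : ℤ × Fin T →₀ ℂ :=
  ∑ j ∈ Finset.Icc 1 γ.deg, Finsupp.single (-(j : ℤ), p) (-γ.v N j)

theorem sum_initialComb (γ : GMParams) (p : Fin T) (N : ℕ) (x : ℤ → Fin T → ℂ) :
    (initialComb γ p N).sum (fun a z => z * x a.1 a.2) =
      -∑ j ∈ Finset.Icc 1 γ.deg, γ.v N j * x (-(j : ℤ)) p := by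
  change Finsupp.linearCombination ℂ (fun a : ℤ × Fin T => x a.1 a.2) (initialComb γ p N) = _
  rw [initialComb, map_sum, ← Finset.sum_neg_distrib]
  refine Finset.sum_congr rfl fun j _ => ?_
  rw [Finsupp.linearCombination_single, smul_eq_mul, neg_mul]

theorem support_initialComb (γ : GMParams) (p : Fin T) (N : ℕ) :
    ∀ a ∈ (initialComb γ p N).support, a.1 ≤ -1 := by
  intro a ha
  have := Finsupp.support_finsetSum ha
  simp only [Finset.mem_biUnion, Finset.mem_Icc] at this
  obtain ⟨j, hj, h⟩ := this
  have := Finset.mem_singleton.mp (Finsupp.support_single_subset h)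
  rw [this]
  simp only
  omega

theorem lintegral_enorm_sq {α E : Type*} [MeasurableSpace α] {μ : Measure α} [NormedAddCommGroup E]
    (Z : Lp E 2 μ) : ∫⁻ x, ‖Z x‖ₑ ^ 2 ∂μ = ENNReal.ofReal (‖Z‖ ^ 2) := by
  rw [ENNReal.ofReal_pow (norm_nonneg _), ofReal_norm, Lp.enorm_def,
    eLpNorm_eq_lintegral_rpow_enorm_toReal (by simp) (by simp)]
  simp only [ENNReal.toReal_ofNat, ENNReal.rpow_two]
  rw [← ENNReal.rpow_natCast, ← ENNReal.rpow_mul]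
  simp

section
variable {γ : GMParams} {ξ : ℤ → Fin T → Ω → ℂ} {X : ℤ → Fin T → Lp ℂ 2 P}
  (hX : ∀ m p, X m p =ᵐ[P] fun ω => γ.inc (fun k => ξ k p ω) m)
include hX

theorem sub_estimate_ae_eq (p : Fin T) (N : ℕ) (Y : Lp ℂ 2 P) :
    (fun ω => ξ N p ω - estimate γ ξ p N Y ω) =ᵐ[P] (target γ X p N - Y : Lp ℂ 2 P) := by
  have h1 : ∀ᵐ ω ∂P, ∀ k : ℕ, X k p ω = γ.inc (fun k => ξ k p ω) k :=
    ae_all_iff.mpr fun k => hX k p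
  have h2 : (target γ X p N : Ω → ℂ) =ᵐ[P]
      fun ω => ∑ k ∈ Finset.range (N + 1), γ.dcoef (N - k) * X k p ω := by
    rw [target]
    refine (Lp.coeFn_fun_finsetSum _ _).trans ?_
    have : ∀ᵐ ω ∂P, ∀ k : ℕ, (γ.dcoef (N - k) • X k p : Lp ℂ 2 P) ω = γ.dcoef (N - k) * X k p ω :=
      ae_all_iff.mpr fun k => Lp.coeFn_smul _ _
    filter_upwards [this] with ω h
    simp only [h]
  filter_upwards [h1, h2, Lp.coeFn_sub (target γ X p N) Y] with ω h1 h2 h3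
  rw [h3, Pi.sub_apply, h2, estimate]
  simp only [h1]
  rw [γ.sum_dcoef_mul_inc (fun k => ξ k p ω) N]
  ring

/-- The linear estimates of `ξ_p(N)` are parametrized by the closed span of the observed increments. -/
theorem isLinearEstimate_iff {p : Fin T} {N : ℕ} {η : Ω → ℂ} :
    IsLinearEstimate γ ξ X p N η ↔ ∃ Y ∈ past X (-1), η =ᵐ[P] estimate γ ξ p N Y := by
  have hexact : ∀ x : ℤ → Fin T → ℂ, (∀ m q, γ.inc (fun k => x k q) m = 0) →
      (initialComb γ p N).sum (fun a z => z * x a.1 a.2) = x N p := fun x hx => by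
    have := γ.sum_dcoef_mul_inc (fun k => x k p) N
    simp only [hx, mul_zero, Finset.sum_const_zero] at this
    rw [sum_initialComb]
    linear_combination this
  constructor
  · rintro ⟨c, Y, hc, hcx, hY, hη⟩
    obtain ⟨B, hB⟩ := γ.exists_sum_inc_of_annihilates (c := c - initialComb γ p N) (fun a ha => by
      rcases Finset.mem_union.mp (Finsupp.support_sub ha) with h | h
      · exact hc a h
      · exact support_initialComb γ p N a h) (fun x hx => by
      rw [Finsupp.sum_sub_index (fun a b₁ b₂ => sub_mul _ _ _), hcx x hx, hexact x hx, sub_self])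
    let Y' : Lp ℂ 2 P := ∑ q, ∑ k ∈ Finset.range ((B q).natDegree + 1), (B q).coeff k • X (-1 - k) q
    have hY' : Y' =ᵐ[P] fun ω => ∑ q, ∑ k ∈ Finset.range ((B q).natDegree + 1),
        (B q).coeff k * γ.inc (fun k => ξ k q ω) (-1 - k) := by
      refine (Lp.coeFn_fun_finsetSum _ _).trans ?_
      have h1 : ∀ᵐ ω ∂P, ∀ q, (∑ k ∈ Finset.range ((B q).natDegree + 1),
          (B q).coeff k • X (-1 - k) q : Lp ℂ 2 P) ω = ∑ k ∈ Finset.range ((B q).natDegree + 1),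
            ((B q).coeff k • X (-1 - k) q : Lp ℂ 2 P) ω :=
        ae_all_iff.mpr fun q => Lp.coeFn_fun_finsetSum _ _
      have h2 : ∀ᵐ ω ∂P, ∀ (q : Fin T) (k : ℕ), ((B q).coeff k • X (-1 - k) q : Lp ℂ 2 P) ω =
          (B q).coeff k * γ.inc (fun k => ξ k q ω) (-1 - k) :=
        ae_all_iff.mpr fun q => ae_all_iff.mpr fun k => by
          filter_upwards [Lp.coeFn_smul ((B q).coeff k) (X (-1 - k) q), hX (-1 - k) q] with ω h1 h2
          rw [h1, Pi.smul_apply, h2, smul_eq_mul]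
      filter_upwards [h1, h2] with ω h1 h2
      simp only [h1, h2]
    refine ⟨Y + Y', Submodule.add_mem _ hY (Submodule.sum_mem _ fun q _ =>
      Submodule.sum_mem _ fun k _ => Submodule.smul_mem _ _ (mem_closedPast X (by omega) q)), ?_⟩
    filter_upwards [hη, hY', Lp.coeFn_add Y Y'] with ω h1 h2 h3
    have h4 := hB fun k q => ξ k q ω
    rw [Finsupp.sum_sub_index (fun a b₁ b₂ => sub_mul _ _ _),
      sum_initialComb γ p N fun k q => ξ k q ω, ← h2] at h4
    rw [h1, estimate, h3, Pi.add_apply, ← h4]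
    ring
  · rintro ⟨Y, hY, hη⟩
    refine ⟨initialComb γ p N, Y, support_initialComb γ p N, hexact, hY, ?_⟩
    filter_upwards [hη] with ω h
    rw [h, estimate, sum_initialComb γ p N fun k q => ξ k q ω]
    ring

/-- The optimal estimate is given by the orthogonal projection of `∑_{k ≤ N} d_μ(N - k) χξ_p(k)` on the
space of the observed increments. -/
theorem isOptimal_iff {p : Fin T} {N : ℕ} {Y : Lp ℂ 2 P} (hY : Y ∈ past X (-1))
    (hort : ∀ Z ∈ past X (-1), inner ℂ (target γ X p N - Y) Z = 0) {η : Ω → ℂ} :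
    IsOptimal γ ξ X p N η ↔ η =ᵐ[P] estimate γ ξ p N Y := by
  have herr : ∀ {η : Ω → ℂ} {Z : Lp ℂ 2 P}, η =ᵐ[P] estimate γ ξ p N Z →
      ∫⁻ ω, ‖ξ N p ω - η ω‖ₑ ^ 2 ∂P = ENNReal.ofReal (‖target γ X p N - Z‖ ^ 2) := by
    intro η Z h
    rw [← lintegral_enorm_sq]
    refine lintegral_congr_ae ?_
    filter_upwards [h, sub_estimate_ae_eq hX p N Z] with ω h1 h2
    rw [← h2, h1]
  have hpyth : ∀ Z ∈ past X (-1), ‖target γ X p N - Z‖ ^ 2 =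
      ‖target γ X p N - Y‖ ^ 2 + ‖Y - Z‖ ^ 2 := fun Z hZ => by
    have := norm_add_sq_eq_norm_sq_add_norm_sq_of_inner_eq_zero _ _
      (hort (Y - Z) (Submodule.sub_mem _ hY hZ))
    simp only [sub_add_sub_cancel] at this
    nlinarith
  constructor
  · rintro ⟨hη, hmin⟩
    obtain ⟨Z, hZ, hηZ⟩ := (isLinearEstimate_iff hX).mp hη
    have h1 := hmin _ ((isLinearEstimate_iff hX).mpr ⟨Y, hY, Filter.EventuallyEq.rfl⟩)
    rw [herr hηZ, herr Filter.EventuallyEq.rfl, ENNReal.ofReal_le_ofReal_iff (sq_nonneg _),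
      hpyth Z hZ] at h1
    have h2 : ‖Y - Z‖ = 0 := by nlinarith [norm_nonneg (Y - Z)]
    rwa [← sub_eq_zero.mp (norm_eq_zero.mp h2)] at hηZ
  · intro hη
    refine ⟨(isLinearEstimate_iff hX).mpr ⟨Y, hY, hη⟩, fun η' hη' => ?_⟩
    obtain ⟨Z, hZ, hηZ⟩ := (isLinearEstimate_iff hX).mp hη'
    rw [herr hη, herr hηZ, hpyth Z hZ]
    exact ENNReal.ofReal_le_ofReal (by nlinarith [sq_nonneg ‖Y - Z‖])

end

end

section

/-! ### The transfer function `χ_μ / β` -/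

namespace GMParams
variable (γ : GMParams)

/-- The transfer function `χ_μ(e^{-it}) / β(it)`. -/
def transfer (t : ℝ) : ℂ := γ.chi t / γ.beta t

theorem weight_eq (t : ℝ) : γ.weight t = ‖γ.transfer t‖ ^ 2 := by
  rw [weight, transfer, norm_div, div_pow]

theorem measurable_transfer : Measurable γ.transfer := by
  have h1 : Continuous γ.chi := by unfold chi; fun_prop
  have h2 : Continuous γ.beta := by unfold beta; fun_prop
  exact h1.measurable.div h2.measurable

theorem countable_chi_eq_zero : {t | γ.chi t = 0}.Countable := by
  refine Set.Countable.mono (fun t (ht : γ.chi t = 0) => ?_) (Set.countable_iUnion fun j =>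
    Set.countable_range fun n : ℤ => (2 * π * n) / ((γ.mu j * γ.s j : ℕ) : ℝ))
  rw [chi, Finset.prod_eq_zero_iff] at ht
  obtain ⟨j, -, hj⟩ := ht
  have h1 := sub_eq_zero.mp ((pow_eq_zero_iff (γ.d_pos j).ne').mp hj)
  rw [eq_comm, Complex.exp_eq_one_iff] at h1
  obtain ⟨n, hn⟩ := h1
  refine Set.mem_iUnion.mpr ⟨j, -n, ?_⟩
  have ha : ((γ.mu j * γ.s j : ℕ) : ℝ) ≠ 0 := by
    exact_mod_cast (Nat.mul_pos (γ.mu_pos j) (γ.s_pos j)).ne'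
  have h2 : (t : ℂ) * ((γ.mu j * γ.s j : ℕ) : ℂ) = 2 * π * (-n : ℤ) := by
    have := congrArg (fun z => I * z) hn
    have h3 := I_mul_I
    push_cast at this ⊢
    linear_combination this + (t * (γ.mu j * γ.s j) + 2 * π * n) * h3
  have h3 : t * ((γ.mu j * γ.s j : ℕ) : ℝ) = 2 * π * (-n : ℤ) := by exact_mod_cast h2
  simp only
  rw [← h3]
  field_simp

theorem countable_beta_eq_zero : {t | γ.beta t = 0}.Countable := by
  refine Set.Countable.mono (fun t (ht : γ.beta t = 0) => ?_) (Set.countable_iUnion fun j =>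
    Set.countable_range fun n : ℤ => (2 * π * n) / (γ.s j : ℝ))
  rw [beta, Finset.prod_eq_zero_iff] at ht
  obtain ⟨j, -, hj⟩ := ht
  rw [Finset.prod_eq_zero_iff] at hj
  obtain ⟨k, -, hk⟩ := hj
  have h1 := (pow_eq_zero_iff (γ.d_pos j).ne').mp hk
  refine Set.mem_iUnion.mpr ⟨j, k, ?_⟩
  have h2 : (t : ℂ) = 2 * π * k / γ.s j := by
    have := congrArg (fun z => -I * z) h1
    have h3 := I_mul_I
    simp only [mul_zero] at this
    linear_combination this + (t - 2 * π * k / γ.s j) * h3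
  simp only
  exact_mod_cast h2.symm

theorem transfer_ne_zero : ∀ᵐ t ∂circ, γ.transfer t ≠ 0 := by
  have h : ∀ᵐ t : ℝ, t ∉ {t | γ.chi t = 0} ∪ {t | γ.beta t = 0} :=
    measure_eq_zero_iff_ae_notMem.mp
      ((γ.countable_chi_eq_zero.union γ.countable_beta_eq_zero).measure_zero _)
  rw [ae_circ]
  filter_upwards [ae_restrict_of_ae h] with t ht
  rw [Set.mem_union, not_or] at ht
  exact div_ne_zero ht.1 ht.2

end GMParams

variable {Ω : Type*} [MeasurableSpace Ω] {P : Measure Ω} {T : ℕ} {γ : GMParams}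
  {ξ : ℤ → Fin T → Ω → ℂ} {X : ℤ → Fin T → Lp ℂ 2 P} {f : ℝ → Matrix (Fin T) (Fin T) ℂ}

/-- The diagonal entries of the positive semidefinite matrix `f⁻¹` are bounded by its trace. -/
theorem HasSpectralDensity.isMinimal (hf : HasSpectralDensity γ P ξ X f)
    (hmin : MinimalityCondition γ f) : IsMinimal γ.transfer f := by
  have hm : ∀ p q, AEStronglyMeasurable (fun t => f t p q) circ := fun p q => by
    have h1 := (integrable_circ.mpr (hf.integrable p q)).1
    have h2 : AEStronglyMeasurable (fun t => ((γ.weight t : ℂ))⁻¹ * ((γ.weight t : ℂ) * f t p q))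
        circ := by
      refine AEStronglyMeasurable.mul ?_ h1
      simp only [γ.weight_eq]
      have h3 := γ.measurable_transfer
      exact (by fun_prop : Measurable fun t => (((‖γ.transfer t‖ ^ 2 : ℝ) : ℂ))⁻¹).aestronglyMeasurable
    refine h2.congr ?_
    filter_upwards [γ.transfer_ne_zero] with t ht
    have : (γ.weight t : ℂ) ≠ 0 := by
      rw [γ.weight_eq]
      exact_mod_cast pow_ne_zero 2 (norm_ne_zero_iff.mpr ht)
    rw [inv_mul_cancel_left₀ this]
  have hpos : ∀ᵐ t ∂circ, (f t).PosSemidef := ae_circ.mpr hf.posSemidef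
  refine ⟨γ.measurable_transfer, γ.transfer_ne_zero, hm, hpos, ae_circ.mpr hmin.1, fun p => ?_,
    fun p => ?_⟩
  · have h1 := (integrable_circ.mpr (hf.integrable p p)).re
    refine h1.congr (Filter.Eventually.of_forall fun t => ?_)
    change (((γ.weight t : ℝ) : ℂ) * f t p p).re = ‖γ.transfer t‖ ^ 2 * (f t p p).re
    rw [← γ.weight_eq, Complex.re_ofReal_mul]
  · have h1 := (integrable_circ.mpr hmin.2).re
    refine h1.mono ?_ ?_
    · have h3 := γ.measurable_transfer
      refine AEStronglyMeasurable.mul (by fun_prop :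
        Measurable fun t => (‖γ.transfer t‖ ^ 2)⁻¹).aestronglyMeasurable ?_
      exact Complex.continuous_re.comp_aestronglyMeasurable (aestronglyMeasurable_inv hm p p)
    · filter_upwards [hpos] with t ht
      have hd : ∀ q, 0 ≤ ((f t)⁻¹ q q).re := fun q => (Complex.nonneg_iff.mp ht.inv.diag_nonneg).1
      have hw : 0 ≤ (‖γ.transfer t‖ ^ 2)⁻¹ := by positivity
      have e : ((symbol γ f t).trace).re = (‖γ.transfer t‖ ^ 2)⁻¹ * ∑ q, ((f t)⁻¹ q q).re := by
        rw [symbol, γ.weight_eq, Matrix.trace_smul, smul_eq_mul, Complex.re_ofReal_mul,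
          Matrix.trace, Complex.re_sum]
        rfl
      rw [RCLike.re_eq_complex_re, e, Real.norm_eq_abs, Real.norm_eq_abs,
        abs_of_nonneg (mul_nonneg hw (hd p)),
        abs_of_nonneg (mul_nonneg hw (Finset.sum_nonneg fun q _ => hd q))]
      exact mul_le_mul_of_nonneg_left
        (Finset.single_le_sum (f := fun q => ((f t)⁻¹ q q).re) (fun q _ => hd q) (Finset.mem_univ p)) hw

/-- The isometry of `L²(f)` into `L²(P)` which maps `e^{imt} (χ_μ / β) δ_p` to `χξ_p(m)`. -/
theorem HasSpectralDensity.exists_isometry (hf : HasSpectralDensity γ P ξ X f)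
    (hm : IsMinimal γ.transfer f) : ∃ V : VecL2 T →ₗᵢ[ℂ] Lp ℂ 2 P, ∀ m p, V (hm.basis m p) = X m p := by
  obtain ⟨V, hV⟩ := exists_linearIsometry_of_gram (E := fun a : ℤ × Fin T => hm.basis a.1 a.2)
    (X := fun a : ℤ × Fin T => X a.1 a.2)
    (fun k hk => hm.eq_zero_of_inner_basis k fun m p => hk (m, p)) (fun a b => by
      rw [hm.inner_basis_basis, integral_circ, hf.covariance]
      simp only [γ.weight_eq]
      rfl)
  exact ⟨V, fun m p => hV (m, p)⟩

/-! ### The stochastic integral -/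

/-- The function `1_A δ_q`. -/
def stepFun (q : Fin T) (A : Set ℝ) (t : ℝ) : Fin T → ℂ := A.indicator (fun _ => Pi.single q 1) t

open Classical in
/-- The image of `1_A δ_q` in `L²([-π, π), ℂ^T)`; it is `0` if `1_A δ_q` is not in `L²(f)`. -/
def stepElt (f : ℝ → Matrix (Fin T) (Fin T) ℂ) (q : Fin T) (A : Set ℝ) : VecL2 T :=
  if h : MemLp (rootMul f (stepFun q A)) 2 circ then h.toLp else 0

/-- The closure of the graph of the integration of step functions with respect to `Z`. -/
def stepGraph (f : ℝ → Matrix (Fin T) (Fin T) ℂ) (Z : Fin T → Set ℝ → Lp ℂ 2 P) :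
    Submodule ℂ (VecL2 T × Lp ℂ 2 P) :=
  (Submodule.span ℂ {z | ∃ q A, Admissible f q A ∧ z = (stepElt f q A, Z q A)}).topologicalClosure

theorem lintegral_circ (g : ℝ → ℝ≥0∞) :
    ∫⁻ t, g t ∂circ = ENNReal.ofReal (1 / (2 * π)) * ∫⁻ t in freq, g t := by
  rw [circ, lintegral_smul_measure, smul_eq_mul]

/-- A closed subspace of a product which contains the graph of an isometry over a total set contains
the whole graph. -/
theorem graph_mem_of_total {ι : Type*} {E : ι → VecL2 T}
    (hE : ∀ k : VecL2 T, (∀ i, inner ℂ (E i) k = 0) → k = 0) (V : VecL2 T →ₗᵢ[ℂ] Lp ℂ 2 P)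
    {W : Submodule ℂ (VecL2 T × Lp ℂ 2 P)} (hW : IsClosed (W : Set (VecL2 T × Lp ℂ 2 P)))
    (h : ∀ i, (E i, V (E i)) ∈ W) (k : VecL2 T) : (k, V k) ∈ W := by
  let L : VecL2 T →L[ℂ] VecL2 T × Lp ℂ 2 P :=
    (ContinuousLinearMap.id ℂ _).prod V.toContinuousLinearMap
  have h1 : (Submodule.span ℂ (Set.range E)).topologicalClosure ≤ W.comap L.toLinearMap := by
    refine Submodule.topologicalClosure_minimal _ (Submodule.span_le.mpr ?_) (hW.preimage L.continuous)
    rintro _ ⟨i, rfl⟩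
    exact h i
  have h2 : (Submodule.span ℂ (Set.range E)).topologicalClosure = ⊤ := by
    rw [Submodule.topologicalClosure_eq_top_iff, Submodule.eq_bot_iff]
    exact fun x hx => hE x fun i => hx _ (Submodule.subset_span ⟨i, rfl⟩)
  rw [h2] at h1
  exact h1 (Submodule.mem_top (x := k))

namespace IsMinimal
variable {ρ : ℝ → ℂ} (hf : IsMinimal ρ f)
include hf

theorem coeFn_stepElt {q : Fin T} {A : Set ℝ} (hA : Admissible f q A) :
    stepElt f q A =ᵐ[circ] rootMul f (stepFun q A) := by
  have h : MemLp (rootMul f (stepFun q A)) 2 circ := by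
    refine hf.memLp_rootMul (fun r => ?_) ?_
    · have : Measurable fun t => stepFun q A t r := by
        have : Measurable (stepFun q A) := measurable_const.indicator hA.1
        exact (measurable_pi_apply r).comp this
      exact this.aestronglyMeasurable
    · have h1 : Integrable (A.indicator fun t => (f t q q).re) circ := by
        rw [integrable_indicator_iff hA.1, IntegrableOn, circ, Measure.restrict_smul,
          Measure.restrict_restrict hA.1, Set.inter_eq_self_of_subset_left hA.2.1]
        exact (hA.2.2.re).smul_measure ENNReal.ofReal_ne_top
      refine h1.congr (Filter.Eventually.of_forall fun t => ?_)
      by_cases ht : t ∈ A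
      · simp [stepFun, ht]
      · simp [stepFun, ht]
  rw [stepElt, dif_pos h]
  exact h.coeFn_toLp

/-- The seminorm of `L²(f)` is taken with respect to `dt`, the norm of `VecL2` with respect to
`dt / 2π`. -/
theorem sqNorm_eq {u : ℝ → Fin T → ℂ} {k : VecL2 T} (hk : k =ᵐ[circ] rootMul f u) :
    sqNorm f u = ENNReal.ofReal (2 * π * ‖k‖ ^ 2) := by
  have h1 : ∫⁻ t, ENNReal.ofReal (u t ⬝ᵥ (f t *ᵥ star (u t))).re ∂circ = ENNReal.ofReal (‖k‖ ^ 2) := by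
    rw [← lintegral_enorm_sq]
    refine lintegral_congr_ae ?_
    filter_upwards [hk, hf.norm_sq_rootMul] with t h1 h2
    rw [h1, ← h2, ENNReal.ofReal_pow (norm_nonneg _), ofReal_norm]
  rw [lintegral_circ] at h1
  rw [ENNReal.ofReal_mul (by positivity), ← h1, ← mul_assoc, ← ENNReal.ofReal_mul (by positivity),
    mul_one_div_cancel Real.two_pi_pos.ne', ENNReal.ofReal_one, one_mul, sqNorm]

/-- The stochastic integral as the relation whose graph is the closure of the graph on step
functions. -/
theorem isStochInt_iff {Z : Fin T → Set ℝ → Lp ℂ 2 P} {h : ℝ → Fin T → ℂ} {k : VecL2 T}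
    (hk : k =ᵐ[circ] rootMul f h) {Y : Lp ℂ 2 P} :
    IsStochInt f Z h Y ↔ (k, Y) ∈ stepGraph f Z := by
  have hstep : ∀ {n : ℕ} (a : Fin n → ℂ) (q : Fin n → Fin T) (A : Fin n → Set ℝ),
      (∀ i, Admissible f (q i) (A i)) →
      sqNorm f (fun t => h t - ∑ i, (A i).indicator (fun _ => Pi.single (q i) (a i)) t) =
        ENNReal.ofReal (2 * π * ‖k - ∑ i, a i • stepElt f (q i) (A i)‖ ^ 2) := by
    intro n a q A hA
    refine hf.sqNorm_eq ?_
    have h1 : ∀ᵐ t ∂circ, ∀ i, stepElt f (q i) (A i) t = rootMul f (stepFun (q i) (A i)) t :=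
      ae_all_iff.mpr fun i => hf.coeFn_stepElt (hA i)
    have h2 : ∀ᵐ t ∂circ, ∀ i, (a i • stepElt f (q i) (A i)) t = a i • stepElt f (q i) (A i) t :=
      ae_all_iff.mpr fun i => Lp.coeFn_smul _ _
    filter_upwards [hk, h1, h2, Lp.coeFn_sub k (∑ i, a i • stepElt f (q i) (A i)),
      Lp.coeFn_fun_finsetSum Finset.univ (fun i => a i • stepElt f (q i) (A i))] with t h0 h1 h2 h3 h4
    rw [h3, Pi.sub_apply, h4, h0]
    simp only [h2, h1, rootMul]
    rw [Matrix.mulVec_sub, WithLp.toLp_sub, Matrix.mulVec_sum, WithLp.toLp_sum]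
    congr 1
    refine Finset.sum_congr rfl fun i _ => ?_
    rw [← WithLp.toLp_smul, ← Matrix.mulVec_smul, stepFun]
    congr 2
    by_cases ht : t ∈ A i
    · simp only [ht, Set.indicator_of_mem]
      rw [← Pi.single_smul, smul_eq_mul, mul_one]
    · simp [ht]
  rw [stepGraph, ← SetLike.mem_coe, Submodule.topologicalClosure_coe, Metric.mem_closure_iff]
  have hpair : ∀ {n : ℕ} (a : Fin n → ℂ) (q : Fin n → Fin T) (A : Fin n → Set ℝ),
      ∑ i, a i • ((stepElt f (q i) (A i), Z (q i) (A i)) : VecL2 T × Lp ℂ 2 P) =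
        (∑ i, a i • stepElt f (q i) (A i), ∑ i, a i • Z (q i) (A i)) := fun a q A => by
    ext1 <;> simp [Prod.fst_sum, Prod.snd_sum]
  constructor
  · intro H ε hε
    -- `sqNorm` is a squared norm, hence `ε ^ 2`
    obtain ⟨n, a, q, A, hA, h1, h2⟩ := H (min ε (ε ^ 2)) (by positivity)
    refine ⟨∑ i, a i • ((stepElt f (q i) (A i), Z (q i) (A i)) : VecL2 T × Lp ℂ 2 P),
      Submodule.sum_mem _ fun i _ => Submodule.smul_mem _ _ (Submodule.subset_span
        ⟨q i, A i, hA i, rfl⟩), ?_⟩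
    rw [hstep a q A hA, ENNReal.ofReal_lt_ofReal_iff (by positivity)] at h1
    rw [hpair, Prod.dist_eq, max_lt_iff, dist_eq_norm, dist_eq_norm]
    refine ⟨?_, h2.trans_le (min_le_left _ _)⟩
    have h3 := h1.trans_le (min_le_right _ _)
    have h4 : ‖k - ∑ i, a i • stepElt f (q i) (A i)‖ ^ 2 < ε ^ 2 := by
      nlinarith [Real.pi_gt_three, sq_nonneg ‖k - ∑ i, a i • stepElt f (q i) (A i)‖]
    exact lt_of_pow_lt_pow_left₀ 2 hε.le h4
  · intro H ε hε
    obtain ⟨b, hb, hd⟩ := H (min ε (√(ε / (2 * π)))) (by positivity)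
    obtain ⟨n, a, g, rfl⟩ := Submodule.mem_span_set'.mp hb
    choose q A hA hg using fun i => (g i).2
    simp only [hg] at hd
    rw [hpair, Prod.dist_eq, max_lt_iff, dist_eq_norm, dist_eq_norm] at hd
    refine ⟨n, a, q, A, hA, ?_, hd.2.trans_le (min_le_left _ _)⟩
    rw [hstep a q A hA, ENNReal.ofReal_lt_ofReal_iff hε]
    have h3 := (Real.lt_sqrt (norm_nonneg _)).mp (hd.1.trans_le (min_le_right _ _))
    rw [lt_div_iff₀ (by positivity)] at h3
    linarith

/-- The step functions are total in `L²(f)`. -/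
theorem eq_zero_of_inner_stepElt {k : VecL2 T}
    (h : ∀ q A, Admissible f q A → inner ℂ (stepElt f q A) k = 0) : k = 0 := by
  have hz : ∀ q, ∀ᵐ t ∂circ, (root f t *ᵥ (k t).ofLp) q = 0 := by
    intro q
    obtain ⟨g, hgm, hg⟩ := hf.aestronglyMeasurable q q
    have hfreq : ∀ᵐ t ∂circ, t ∈ freq := ae_circ.mpr (ae_restrict_mem measurableSet_Ico)
    -- on the sets where `f_qq` is bounded every measurable subset is admissible
    have key : ∀ n : ℕ, ∀ᵐ t ∂circ, t ∈ freq ∩ {t | ‖g t‖ ≤ n} → (root f t *ᵥ (k t).ofLp) q = 0 := by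
      intro n
      set B := freq ∩ {t | ‖g t‖ ≤ n} with hB
      have hBm : MeasurableSet B :=
        measurableSet_Ico.inter (measurableSet_le hgm.norm.measurable measurable_const)
      have hadm : ∀ s, MeasurableSet s → Admissible f q (s ∩ B) := fun s hs => by
        refine ⟨hs.inter hBm, fun t ht => ht.2.1, ?_⟩
        have hg' : (fun t => f t q q) =ᵐ[volume.restrict (s ∩ B)] g :=
          ae_restrict_of_ae_restrict_of_subset (t := freq) (fun t ht => ht.2.1) (ae_circ.mp hg)
        refine IntegrableOn.congr_fun_ae ?_ hg'.symm
        refine Measure.integrableOn_of_bounded (M := n) ?_ hgm.aestronglyMeasurable ?_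
        · refine ((measure_mono fun t ht => ht.2.1).trans_lt (?_ : volume freq < ⊤)).ne
          simp [freq]
        · exact (ae_restrict_mem (hs.inter hBm)).mono fun t ht => ht.2.2
      have hin : ∀ s, MeasurableSet s → (fun t => inner ℂ (stepElt f q (s ∩ B) t) (k t)) =ᵐ[circ]
          (s ∩ B).indicator fun t => (root f t *ᵥ (k t).ofLp) q := fun s hs => by
        filter_upwards [hf.coeFn_stepElt (hadm s hs), hf.inner_rootMul_left] with t h1 h2
        rw [h1, h2, stepFun]
        by_cases ht : t ∈ s ∩ B
        · rw [Set.indicator_of_mem ht, Set.indicator_of_mem ht, Pi.star_single, star_one,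
            dotProduct_single, mul_one]
        · rw [Set.indicator_of_notMem ht, Set.indicator_of_notMem ht, star_zero, dotProduct_zero]
      have hi : Integrable (B.indicator fun t => (root f t *ᵥ (k t).ofLp) q) circ := by
        have := (L2.integrable_inner (𝕜 := ℂ) (stepElt f q (Set.univ ∩ B)) k).congr
          (hin _ MeasurableSet.univ)
        rwa [Set.univ_inter] at this
      have h0 := hi.ae_eq_zero_of_forall_setIntegral_eq_zero fun s hs _ => by
        rw [← integral_indicator hs, Set.indicator_indicator, ← h q (s ∩ B) (hadm s hs), L2.inner_def,
          integral_congr_ae (hin s hs)]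
      filter_upwards [h0] with t ht htB
      rwa [Set.indicator_of_mem htB] at ht
    filter_upwards [hfreq, ae_all_iff.mpr key] with t h1 h2
    obtain ⟨n, hn⟩ := exists_nat_ge ‖g t‖
    exact h2 n ⟨h1, hn⟩
  rw [Lp.eq_zero_iff_ae_eq_zero]
  filter_upwards [ae_all_iff.mpr hz, hf.rootMul_preimage k] with t h1 h2
  rw [← h2, rootMul, preimage, show root f t *ᵥ (k t).ofLp = 0 from funext h1]
  simp

end IsMinimal

/-- Whatever the spectral process `Z`, the stochastic integral is the isometry `V`. -/
theorem IsSpectralProcess.isStochInt {Z : Fin T → Set ℝ → Lp ℂ 2 P}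
    (hZ : IsSpectralProcess γ X f Z) (hm : IsMinimal γ.transfer f) {V : VecL2 T →ₗᵢ[ℂ] Lp ℂ 2 P}
    (hV : ∀ m p, V (hm.basis m p) = X m p) {h : ℝ → Fin T → ℂ} {k : VecL2 T}
    (hk : k =ᵐ[circ] rootMul f h) : IsStochInt f Z h (V k) := by
  rw [hm.isStochInt_iff hk]
  refine graph_mem_of_total (E := fun a : ℤ × Fin T => hm.basis a.1 a.2)
    (fun k hk => hm.eq_zero_of_inner_basis k fun m p => hk (m, p)) V
    (Submodule.isClosed_topologicalClosure _) (fun a => ?_) k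
  rw [hV]
  exact (hm.isStochInt_iff (hm.memLp_expFun a.1 a.2).coeFn_toLp).mp (hZ.representation a.1 a.2)

/-- The stochastic measure is the image under `V` of the indicator functions. -/
theorem exists_isSpectralProcess (hm : IsMinimal γ.transfer f) {V : VecL2 T →ₗᵢ[ℂ] Lp ℂ 2 P}
    (hV : ∀ m p, V (hm.basis m p) = X m p) : ∃ Z, IsSpectralProcess γ X f Z := by
  refine ⟨fun q A => V (stepElt f q A), fun p q A B hA hB => ?_, fun m p => ?_⟩
  · rw [LinearIsometry.inner_map_map, L2.inner_def]
    have : ∫ t, inner ℂ (stepElt f q B t) (stepElt f p A t) ∂circ =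
        ∫ t, (A ∩ B).indicator (fun t => f t p q) t ∂circ := by
      refine integral_congr_ae ?_
      filter_upwards [hm.coeFn_stepElt hA, hm.coeFn_stepElt hB, hm.inner_rootMul] with t h1 h2 h3
      rw [h1, h2, h3, stepFun, stepFun]
      by_cases h4 : t ∈ A <;> by_cases h5 : t ∈ B <;> simp [h4, h5]
    rw [this, integral_circ, integral_indicator (hA.1.inter hB.1), Measure.restrict_restrict
      (hA.1.inter hB.1), Set.inter_eq_self_of_subset_left (Set.inter_subset_left.trans hA.2.1)]
  · change IsStochInt f _ (expFun γ.transfer m p) (X m p)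
    rw [hm.isStochInt_iff (hm.memLp_expFun m p).coeFn_toLp, ← hV]
    refine graph_mem_of_total
      (E := fun a : {a : Fin T × Set ℝ // Admissible f a.1 a.2} => stepElt f a.1.1 a.1.2)
      (fun k hk => hm.eq_zero_of_inner_stepElt fun q A hA => hk ⟨(q, A), hA⟩) V
      (Submodule.isClosed_topologicalClosure _) (fun a => ?_) _
    exact Submodule.le_topologicalClosure _ (Submodule.subset_span ⟨a.1.1, a.1.2, a.2, rfl⟩)

end

section

variable {Ω : Type*} [MeasurableSpace Ω] {P : Measure Ω} {T : ℕ} {γ : GMParams}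
  {ξ : ℤ → Fin T → Ω → ℂ} {X : ℤ → Fin T → Lp ℂ 2 P} {f : ℝ → Matrix (Fin T) (Fin T) ℂ}

/-! ### The spectral characteristic -/

theorem integral_norm_sq {α E : Type*} [MeasurableSpace α] {μ : Measure α} [NormedAddCommGroup E]
    [InnerProductSpace ℂ E] (Z : Lp E 2 μ) : ∫ x, ‖Z x‖ ^ 2 ∂μ = ‖Z‖ ^ 2 := by
  have h := L2.inner_def (𝕜 := ℂ) Z Z
  simp only [inner_self_eq_norm_sq_to_K, Complex.coe_algebraMap, ← Complex.ofReal_pow] at h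
  rw [integral_complex_ofReal] at h
  exact_mod_cast h.symm

/-- The image in `L²([-π, π), ℂ^T)` of `∑_{k ≤ N} d_μ(N - k) χξ_p(k)`. -/
def targetElt (hm : IsMinimal γ.transfer f) (p : Fin T) (N : ℕ) : VecL2 T :=
  ∑ k ∈ Finset.range (N + 1), γ.dcoef (N - k) • hm.basis k p

theorem map_targetElt {hm : IsMinimal γ.transfer f} {V : VecL2 T →ₗᵢ[ℂ] Lp ℂ 2 P}
    (hV : ∀ m p, V (hm.basis m p) = X m p) (p : Fin T) (N : ℕ) :
    V (targetElt hm p N) = target γ X p N := by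
  simp only [targetElt, target, map_sum, map_smul, hV]

/-- A function `h` is the spectral characteristic as soon as it represents an element of the observed
increments and the error `e` is orthogonal to them. -/
theorem isOptimalCharacteristic_of_orthogonal (hf : HasSpectralDensity γ P ξ X f)
    {hm : IsMinimal γ.transfer f} {V : VecL2 T →ₗᵢ[ℂ] Lp ℂ 2 P}
    (hV : ∀ m p, V (hm.basis m p) = X m p) {p : Fin T} {N : ℕ} {e : VecL2 T} {h : ℝ → Fin T → ℂ}
    (hmem : V (targetElt hm p N - e) ∈ past X (-1))
    (hort : ∀ j ≤ -1, ∀ q, inner ℂ (hm.basis j q) e = 0)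
    (hh : (targetElt hm p N - e : VecL2 T) =ᵐ[circ] rootMul f h) :
    IsOptimalCharacteristic γ ξ X f p N h (‖e‖ ^ 2) := by
  intro Z hZ
  set Y := V (targetElt hm p N - e) with hYdef
  have hY : target γ X p N - Y = V e := by
    rw [hYdef, map_sub, map_targetElt hV]; abel
  have hae := sub_estimate_ae_eq hf.increment p N Y
  refine ⟨Y, hZ.isStochInt hm hV hh, (isOptimal_iff hf.increment hmem fun W hW => ?_).mpr
    Filter.EventuallyEq.rfl, (Lp.memLp _).ae_eq hae.symm, ?_, ?_⟩
  · rw [hY]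
    refine inner_eq_zero_of_mem_closedPast (fun k hk q => ?_) hW
    rw [← hV, LinearIsometry.inner_map_map, ← inner_conj_symm, hort k hk, map_zero]
  · rw [← LinearIsometry.norm_map V e, ← hY, ← integral_norm_sq]
    refine integral_congr_ae ?_
    filter_upwards [hae] with ω h
    rw [h]
  · change ‖target γ X p N - Y‖ ^ 2 = _
    rw [hY, LinearIsometry.norm_map]

theorem coeFn_targetElt (hm : IsMinimal γ.transfer f) (p : Fin T) (N : ℕ) :
    targetElt hm p N =ᵐ[circ] rootMul f fun t => (γ.chi t / γ.beta t) • (Pi.single p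
      (∑ k ∈ Finset.range (N + 1), γ.dcoef (N - k) * exp (I * t * (k : ℂ))) : Fin T → ℂ) := by
  have h1 : ∀ᵐ t ∂circ, ∀ k : ℕ, hm.basis k p t = rootMul f (expFun γ.transfer k p) t :=
    ae_all_iff.mpr fun k => (hm.memLp_expFun k p).coeFn_toLp
  have h2 : ∀ᵐ t ∂circ, ∀ k : ℕ,
      (γ.dcoef (N - k) • hm.basis k p) t = γ.dcoef (N - k) • hm.basis k p t :=
    ae_all_iff.mpr fun k => Lp.coeFn_smul _ _
  filter_upwards [h1, h2, Lp.coeFn_fun_finsetSum (Finset.range (N + 1))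
    (fun k => γ.dcoef (N - k) • hm.basis (k : ℤ) p)] with t h1 h2 h3
  rw [targetElt, h3]
  simp only [h2, h1, rootMul, ← WithLp.toLp_smul, ← Matrix.mulVec_smul, ← WithLp.toLp_sum,
    ← Matrix.mulVec_sum]
  congr 2
  ext q
  by_cases hq : q = p
  · subst hq
    simp only [Finset.sum_apply, Pi.smul_apply, expFun, Pi.single_eq_same, smul_eq_mul, ex,
      GMParams.transfer, Finset.mul_sum]
    refine Finset.sum_congr rfl fun k _ => ?_
    push_cast; ring
  · simp [expFun, hq]

/-- The projection of the target is represented by the spectral characteristic. -/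
theorem coeFn_targetElt_sub (hm : IsMinimal γ.transfer f) (p : Fin T) (N : ℕ) {e : VecL2 T}
    {c : SeqSpace T} (hc : specDens γ.transfer f e =ᵐ[circ] series c) :
    (targetElt hm p N - e : VecL2 T) =ᵐ[circ] rootMul f (characteristic γ f N p c) := by
  filter_upwards [coeFn_targetElt hm p N, Lp.coeFn_sub (targetElt hm p N) e,
    hm.rootMul_preimage e, hm.ne_zero, hc] with t h1 h2 h3 h4 h5
  rw [h2, Pi.sub_apply, h1, ← h3, rootMul, rootMul, rootMul, ← WithLp.toLp_sub, ← Matrix.mulVec_sub]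
  congr 2
  rw [characteristic, ← h5, specDens, Matrix.smul_vecMul, ← Matrix.mulVec_transpose, smul_smul]
  have : star (γ.beta t) / star (γ.chi t) * star (γ.transfer t) = 1 := by
    rw [← star_div₀, ← star_mul', GMParams.transfer]
    rw [GMParams.transfer] at h4
    have h6 := (div_ne_zero_iff.mp h4)
    rw [div_mul_div_cancel₀' h6.2, div_self h6.1, star_one]
  rw [this, one_smul]
  rfl

/-- If `e` is the image of `g ∈ L²(f)` and `C` is its function `specDens`, then `G^⊤ C = g / ρ`. -/
theorem symbol_transpose_mulVec (hm : IsMinimal γ.transfer f) (e : VecL2 T) : ∀ᵐ t ∂circ,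
    (symbol γ f t)ᵀ *ᵥ specDens γ.transfer f e t = (γ.transfer t)⁻¹ • preimage f e t := by
  filter_upwards [hm.ne_zero] with t h
  rw [symbol, Matrix.transpose_smul, Matrix.smul_mulVec, specDens, Matrix.mulVec_smul, smul_smul,
    γ.weight_eq, preimage]
  congr 1
  rw [← Complex.normSq_eq_norm_sq]
  push_cast
  rw [← Complex.mul_conj, Complex.star_def]
  have h' : (starRingEnd ℂ) (γ.transfer t) ≠ 0 := by simpa using h
  field_simp

theorem series_dotProduct_symbol (hm : IsMinimal γ.transfer f) (e : VecL2 T) : ∀ᵐ t ∂circ,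
    specDens γ.transfer f e t ⬝ᵥ (symbol γ f t *ᵥ star (specDens γ.transfer f e t)) =
      ((‖e t‖ ^ 2 : ℝ) : ℂ) := by
  filter_upwards [hm.specDens_dotProduct e, hm.ne_zero] with t h1 h2
  rw [symbol, Matrix.smul_mulVec, dotProduct_smul, h1, smul_eq_mul, γ.weight_eq,
    ← Complex.ofReal_mul]
  congr 1
  have := norm_ne_zero_iff.mpr h2
  field_simp

/-- The domain and the values of `F_μ` in terms of `L²([-π, π), ℂ^T)`. -/
theorem opF_iff (hm : IsMinimal γ.transfer f) (c b : SeqSpace T) :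
    OpF γ f c b ↔ ∃ k : VecL2 T, specDens γ.transfer f k =ᵐ[circ] series c ∧
      ∀ (j : ℕ) q, inner ℂ (hm.dual j q) k = b j q := by
  have hval : ∀ k : VecL2 T, specDens γ.transfer f k =ᵐ[circ] series c → ∀ (j : ℕ) q,
      (1 / (2 * π) : ℂ) * ∫ t in freq, exp (-(I * t * (j : ℂ))) * ((symbol γ f t)ᵀ *ᵥ series c t) q
        = inner ℂ (hm.dual j q) k := by
    intro k hk j q
    rw [← integral_circ, hm.inner_dual]
    refine integral_congr_ae ?_
    filter_upwards [symbol_transpose_mulVec hm k, hk] with t h1 h2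
    rw [← h2, h1, Pi.smul_apply, smul_eq_mul, ex]
    congr 2
    push_cast; ring
  constructor
  · rintro ⟨hint, hb⟩
    -- the solution of `conj(ρ) fᵀ u = C`; its squared norm in `L²(f)` is the quadratic form of `c`
    let u : ℝ → Fin T → ℂ := fun t => (star (γ.transfer t))⁻¹ • ((f t)⁻¹ᵀ *ᵥ series c t)
    have hu : MemLp (rootMul f u) 2 circ := by
      refine hm.memLp_rootMul (fun p => ?_) ((integrable_circ.mpr hint).re.congr ?_)
      · refine AEStronglyMeasurable.mul (Complex.continuous_conj.measurable.comp
          hm.measurable).inv.aestronglyMeasurable (aestronglyMeasurable_mulVec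
            (fun p q => aestronglyMeasurable_inv hm.aestronglyMeasurable q p)
            (fun q => (memLp_series c q).1) p)
      · filter_upwards [hm.posSemidef, hm.isUnit] with t hp hd
        have e : star ((f t)⁻¹ᵀ *ᵥ series c t) = (f t)⁻¹ *ᵥ star (series c t) := by
          rw [Matrix.star_mulVec, ← Matrix.mulVec_transpose]
          congr 1
          ext i j
          exact hp.isHermitian.inv.apply i j
        change ((series c t ⬝ᵥ (symbol γ f t *ᵥ star (series c t)))).re = _
        congr 1
        simp only [u]
        rw [star_smul, Matrix.mulVec_smul, e, Matrix.mulVec_mulVec, Matrix.mul_nonsing_inv _ hd,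
          Matrix.one_mulVec, smul_dotProduct, dotProduct_smul, symbol, Matrix.smul_mulVec,
          dotProduct_smul, Matrix.mulVec_transpose, ← Matrix.dotProduct_mulVec, smul_smul, γ.weight_eq,
          ← Complex.normSq_eq_norm_sq]
        congr 1
        push_cast
        rw [← Complex.mul_conj, star_inv₀, star_star, _root_.mul_inv_rev, Complex.star_def]
    have hk : specDens γ.transfer f hu.toLp =ᵐ[circ] series c := by
      filter_upwards [hu.coeFn_toLp, hm.root_spec, hm.isUnit, hm.ne_zero] with t h1 ⟨_, h2, _⟩ h3 h4
      rw [specDens, h1, rootMul]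
      simp only [Matrix.mulVec_mulVec, h2, u]
      rw [Matrix.mulVec_smul, smul_smul, mul_inv_cancel₀ (star_ne_zero.mpr h4), one_smul,
        Matrix.mulVec_mulVec, ← Matrix.transpose_mul, Matrix.nonsing_inv_mul _ h3,
        Matrix.transpose_one, Matrix.one_mulVec]
    exact ⟨hu.toLp, hk, fun j q => by rw [← hval _ hk, hb]⟩
  · rintro ⟨k, hk, hb⟩
    refine ⟨?_, fun j q => by rw [hval k hk, hb]⟩
    have hi : Integrable (fun t => ‖k t‖ ^ 2) circ :=
      (memLp_two_iff_integrable_sq_norm (Lp.aestronglyMeasurable k)).mp (Lp.memLp k)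
    refine integrable_circ.mp (hi.ofReal.congr ?_)
    filter_upwards [series_dotProduct_symbol hm k, hk] with t h1 h2
    rw [← h2, h1]
    rfl

theorem dvec_apply (γ : GMParams) (N : ℕ) (p : Fin T) (j : ℕ) (q : Fin T) :
    dvec γ N p j q = if j ≤ N ∧ q = p then γ.dcoef (N - j) else 0 := by
  have h1 : (dvec γ N p : ℕ → EuclideanSpace ℂ (Fin T)) j = ∑ k ∈ Finset.range (N + 1),
      (lp.single 2 k (EuclideanSpace.single p (γ.dcoef (N - k))) : SeqSpace T) j := by
    rw [dvec, lp.coeFn_sum, Finset.sum_apply]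
  rw [h1]
  simp only [lp.coeFn_single]
  by_cases hj : j ≤ N
  · rw [Finset.sum_eq_single j]
    · by_cases hq : q = p <;> simp [hj, hq]
    · intro k _ hk
      rw [Pi.single_eq_of_ne (Ne.symm hk)]
    · intro h
      exact absurd (Finset.mem_range.mpr (Nat.lt_succ_of_le hj)) h
  · rw [Finset.sum_eq_zero]
    · simp [hj]
    · intro k hk
      have := Finset.mem_range.mp hk
      rw [Pi.single_eq_of_ne (by omega)]

theorem errorIntegral_eq (hm : IsMinimal γ.transfer f) {e : VecL2 T} {c : SeqSpace T}
    (hc : specDens γ.transfer f e =ᵐ[circ] series c) : ((‖e‖ ^ 2 : ℝ) : ℂ) = errorIntegral γ f c := by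
  rw [errorIntegral, ← integral_circ, ← integral_norm_sq, ← integral_complex_ofReal]
  refine integral_congr_ae ?_
  filter_upwards [hm.specDens_dotProduct e, hm.ne_zero, hc] with t h1 h2 h3
  rw [← h3, h1, GMParams.transfer]
  rw [GMParams.transfer, div_ne_zero_iff] at h2
  have e1 : star (γ.beta t) / star (γ.chi t) * (γ.beta t / γ.chi t) =
      ((‖γ.beta t / γ.chi t‖ ^ 2 : ℝ) : ℂ) := by
    rw [← star_div₀, mul_comm, Complex.star_def, Complex.mul_conj, Complex.normSq_eq_norm_sq]
  rw [mul_right_comm, e1, ← Complex.ofReal_mul, norm_div, norm_div]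
  congr 1
  have h4 := norm_ne_zero_iff.mpr h2.1
  have h5 := norm_ne_zero_iff.mpr h2.2
  field_simp

/-- Since the error is orthogonal to the estimate, its squared norm is its inner product with the
target. -/
theorem inner_dvec_eq (hm : IsMinimal γ.transfer f) {p : Fin T} {N : ℕ} {e : VecL2 T} {c : SeqSpace T}
    (hmem : targetElt hm p N - e ∈ closedPast hm.basis (-1))
    (hort : ∀ j ≤ -1, ∀ q, inner ℂ (hm.basis j q) e = 0)
    (hc : ∀ (j : ℕ) q, c j q = inner ℂ (hm.basis j q) e) :
    ((‖e‖ ^ 2 : ℝ) : ℂ) = inner ℂ c (dvec γ N p) := by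
  have h1 : inner ℂ e (targetElt hm p N - e) = 0 := inner_eq_zero_of_mem_closedPast (fun j hj q => by
    rw [← inner_conj_symm, hort j hj, map_zero]) hmem
  rw [inner_sub_right, sub_eq_zero, inner_self_eq_norm_sq_to_K] at h1
  rw [Complex.ofReal_pow]
  refine h1.symm.trans ?_
  rw [targetElt, dvec, inner_sum, inner_sum]
  refine Finset.sum_congr rfl fun k _ => ?_
  rw [inner_smul_right, lp.inner_single_right, EuclideanSpace.inner_single_right, hc, inner_conj_symm]

end

section

variable {Ω : Type*} [MeasurableSpace Ω] {P : Measure Ω} {T : ℕ} {γ : GMParams}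
  {ξ : ℤ → Fin T → Ω → ℂ} {X : ℤ → Fin T → Lp ℂ 2 P} {f : ℝ → Matrix (Fin T) (Fin T) ℂ} {q : ℕ}
  {ε : ℤ → Fin q → Lp ℂ 2 P} {φ : ℕ → Matrix (Fin T) (Fin q) ℂ}

/-! ### The canonical factorization -/

theorem truncRow_apply (φ : ℕ → Matrix (Fin T) (Fin q) ℂ) (N : ℕ) (p : Fin T) (t : ℝ) (j : Fin q) :
    truncRow φ N p t j = ∑ k ∈ Finset.range (N + 1), φ k p j * ex (-k) t := by
  simp only [truncRow, Matrix.sum_apply, Matrix.smul_apply, smul_eq_mul]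
  refine Finset.sum_congr rfl fun k _ => ?_
  rw [mul_comm, ex]; push_cast; ring_nf

namespace IsCanonical

variable (hc : IsCanonical γ X f ε φ)
include hc

theorem summable_coeff (p : Fin T) (j : Fin q) : Summable fun k => ‖φ k p j‖ ^ 2 := by
  refine Summable.of_nonneg_of_le (fun _ => sq_nonneg _) (fun k => ?_) hc.summable
  refine le_trans ?_ (Finset.single_le_sum (f := fun i => ∑ j, ‖φ k i j‖ ^ 2)
    (fun _ _ => Finset.sum_nonneg fun _ _ => sq_nonneg _) (Finset.mem_univ p))
  exact Finset.single_le_sum (f := fun j => ‖φ k p j‖ ^ 2) (fun _ _ => sq_nonneg _)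
    (Finset.mem_univ j)

theorem inner_innovation (u v : ℤ) (i j : Fin q) :
    inner ℂ (ε u i) (ε v j) = if u = v ∧ i = j then 1 else 0 := by
  have h := orthonormal_iff_ite.mp hc.orthonormal (u, i) (v, j)
  simpa only [Prod.mk.injEq] using h

theorem hasSum_inner (u m : ℤ) (p : Fin T) (j : Fin q) :
    HasSum (fun k : ℕ => if u = m - k then φ k p j else 0) (inner ℂ (ε u j) (X m p)) := by
  have h := (innerSL ℂ (ε u j)).hasSum (hc.movingAverage m p)
  refine h.congr_fun fun k => ?_
  simp only [innerSL_apply_apply, inner_sum, inner_smul_right, hc.inner_innovation]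
  by_cases hk : u = m - k <;> simp [hk]

theorem inner_eq (u : ℤ) (k : ℕ) (p : Fin T) (j : Fin q) :
    inner ℂ (ε u j) (X (u + k) p) = φ k p j := by
  refine (hc.hasSum_inner u (u + k) p j).unique ?_
  convert hasSum_ite_eq k (φ k p j) using 2 with l
  by_cases h : l = k
  · simp [h]
  · rw [if_neg (by omega), if_neg h]

theorem inner_eq_zero {u m : ℤ} (h : m < u) (p : Fin T) (j : Fin q) :
    inner ℂ (ε u j) (X m p) = 0 := by
  refine (hc.hasSum_inner u m p j).unique ?_
  convert hasSum_zero using 2 with l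
  rw [if_neg (by omega)]

/-- The matrix `φ(0)` is injective: a combination of the innovations `ε_j(0)` which is orthogonal to
the increments at time `0` is orthogonal to the past of the increments, to which it belongs. -/
theorem card_le : q ≤ T := by
  have hinj : Function.Injective (φ 0).mulVecLin := by
    rw [← LinearMap.ker_eq_bot, LinearMap.ker_eq_bot']
    intro v hv
    rw [Matrix.mulVecLin_apply] at hv
    have hort : ∀ m ≤ (0 : ℤ), ∀ p, inner ℂ (∑ j, star (v j) • ε 0 j) (X m p) = 0 := by
      intro m hm p
      simp only [sum_inner, inner_smul_left, Complex.star_def, Complex.conj_conj]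
      rcases hm.lt_or_eq with h | rfl
      · simp [hc.inner_eq_zero h]
      · have := congrFun hv p
        rw [Matrix.mulVec, dotProduct, Pi.zero_apply] at this
        rw [← this]
        refine Finset.sum_congr rfl fun j _ => ?_
        have h := hc.inner_eq 0 0 p j
        rw [Nat.cast_zero, add_zero] at h
        rw [h, mul_comm]
    have hmem : (∑ j, star (v j) • ε 0 j) ∈ past X 0 := by
      rw [hc.same_past]
      exact Submodule.sum_mem _ fun j _ => Submodule.smul_mem _ _ (mem_closedPast ε le_rfl j)
    have h0 := inner_self_eq_zero.mp (inner_eq_zero_of_mem_closedPast hort hmem)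
    ext j
    have h1 := congrArg (inner ℂ (ε 0 j)) h0
    simpa [inner_sum, inner_smul_right, hc.inner_innovation] using h1
  simpa using LinearMap.finrank_le_finrank_of_injective hinj

theorem boundary_mul_inv (hm : IsMinimal γ.transfer f) : ∀ᵐ t ∂circ,
    boundary φ t * ((boundary φ t)ᴴ * ((γ.weight t : ℂ) • f t)⁻¹) = 1 := by
  filter_upwards [ae_circ.mpr hc.factorization, hm.isUnit, hm.ne_zero] with t h1 h2 h3
  rw [← Matrix.mul_assoc, ← h1, Matrix.mul_nonsing_inv]
  rw [Matrix.det_smul]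
  refine IsUnit.mul (IsUnit.pow _ (isUnit_iff_ne_zero.mpr ?_)) h2
  rw [γ.weight_eq]
  simpa using h3

/-- The rank of `Φ Φ^*` is `T`, hence `T ≤ q`. -/
theorem card_eq (hm : IsMinimal γ.transfer f) : q = T := by
  refine le_antisymm hc.card_le ?_
  have : NeZero circ := inferInstance
  obtain ⟨t, ht⟩ := (hc.boundary_mul_inv hm).exists
  have h := Matrix.rank_mul_le_left (boundary φ t)
    ((boundary φ t)ᴴ * ((γ.weight t : ℂ) • f t)⁻¹)
  rw [ht, Matrix.rank_one, Fintype.card_fin] at h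
  simpa using h.trans (Matrix.rank_le_card_width _)

theorem exists_leftInverse (hm : IsMinimal γ.transfer f) :
    ∃ Ψ : ℝ → Matrix (Fin q) (Fin T) ℂ, ∀ᵐ t ∂circ, Ψ t * boundary φ t = 1 := by
  refine ⟨fun t => (boundary φ t)ᴴ * ((γ.weight t : ℂ) • f t)⁻¹, ?_⟩
  filter_upwards [hc.boundary_mul_inv hm] with t ht
  exact (Matrix.mul_eq_one_comm_of_card_eq _ _ _ (by simpa using (hc.card_eq hm).symm)).mp ht

end IsCanonical

/-- The function `e^{iut} ρ(t) Ψ(e^{-it})ᵀ δ_j` of `L²(f)`, which corresponds to the innovation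
`ε_j(u)`. -/
def innovFun (γ : GMParams) (Ψ : ℝ → Matrix (Fin q) (Fin T) ℂ) (u : ℤ) (j : Fin q) (t : ℝ) :
    Fin T → ℂ := (ex u t * γ.transfer t) • Ψ t j

section LeftInverse

variable (hc : IsCanonical γ X f ε φ) (hm : IsMinimal γ.transfer f)
  {Ψ : ℝ → Matrix (Fin q) (Fin T) ℂ} (hΨ : ∀ᵐ t ∂circ, Ψ t * boundary φ t = 1)
include hc hm hΨ

/-- A left inverse `Ψ` of `Φ` is not assumed to be measurable, but it coincides almost everywhere with
`Φ^* (|ρ|² f)⁻¹`. -/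
theorem IsCanonical.aestronglyMeasurable_leftInverse (j : Fin q) (p : Fin T) :
    AEStronglyMeasurable (fun t => Ψ t j p) circ := by
  have hΦ : ∀ p j, AEStronglyMeasurable (fun t => boundary φ t p j) circ := fun p j =>
    (memLp_fourierSum (-1) fun k => φ k p j).1
  have hwf : ∀ p r, AEStronglyMeasurable (fun t => ((γ.weight t : ℂ) • f t) p r) circ := fun p r => by
    refine AEStronglyMeasurable.mul ?_ (hm.aestronglyMeasurable p r)
    have h3 := γ.measurable_transfer
    simp only [γ.weight_eq]
    exact (by fun_prop : Measurable fun t => ((‖γ.transfer t‖ ^ 2 : ℝ) : ℂ)).aestronglyMeasurable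
  have h : AEStronglyMeasurable
      (fun t => ((boundary φ t)ᴴ * ((γ.weight t : ℂ) • f t)⁻¹) j p) circ := by
    simp only [Matrix.mul_apply]
    exact Finset.aestronglyMeasurable_fun_sum _ fun r _ =>
      (Complex.continuous_conj.comp_aestronglyMeasurable (hΦ r j)).mul
        (aestronglyMeasurable_inv hwf r p)
  refine h.congr ?_
  filter_upwards [hΨ, hc.boundary_mul_inv hm] with t h1 h2
  rw [← Matrix.one_mul ((boundary φ t)ᴴ * _), ← h1, Matrix.mul_assoc, h2, Matrix.mul_one]

/-- The function `innovFun` has norm one: `Ψ (|ρ|² f) Ψ^* = (Ψ Φ) (Ψ Φ)^* = 1`. -/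
theorem IsCanonical.memLp_innovFun (u : ℤ) (j : Fin q) : MemLp (rootMul f (innovFun γ Ψ u j)) 2 circ := by
  refine hm.memLp_rootMul (fun p => ?_) ((integrable_const (1 : ℝ)).congr ?_)
  · exact ((continuous_ex u).measurable.mul γ.measurable_transfer).aestronglyMeasurable.mul
      (hc.aestronglyMeasurable_leftInverse hm hΨ j p)
  · filter_upwards [hΨ, ae_circ.mpr hc.factorization] with t h1 h2
    have h3 : Ψ t * ((γ.weight t : ℂ) • f t) * (Ψ t)ᴴ = 1 := by
      rw [h2, ← Matrix.mul_assoc, h1, Matrix.one_mul, ← Matrix.conjTranspose_mul, h1,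
        Matrix.conjTranspose_one]
    have h4 := congrFun (congrFun h3 j) j
    have e2 : (ex u t * γ.transfer t) * star (ex u t * γ.transfer t) = (γ.weight t : ℂ) := by
      rw [Complex.star_def, Complex.mul_conj, Complex.normSq_eq_norm_sq, norm_mul, norm_ex, one_mul,
        γ.weight_eq]
    have h5 : innovFun γ Ψ u j t ⬝ᵥ (f t *ᵥ star (innovFun γ Ψ u j t)) = 1 := by
      rw [innovFun, star_smul, Matrix.mulVec_smul, smul_dotProduct, dotProduct_smul, smul_smul, e2]
      rw [Matrix.mul_assoc, Matrix.smul_mul, Matrix.mul_smul, Matrix.smul_apply, Matrix.one_apply_eq]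
        at h4
      exact h4
    rw [h5, Complex.one_re]

/-- The element of `L²([-π, π), ℂ^T)` which corresponds to the innovation `ε_j(u)`. -/
def IsCanonical.innov (u : ℤ) (j : Fin q) : VecL2 T := (hc.memLp_innovFun hm hΨ u j).toLp

theorem IsCanonical.coeFn_innov (u : ℤ) (j : Fin q) :
    hc.innov hm hΨ u j =ᵐ[circ] rootMul f (innovFun γ Ψ u j) :=
  (hc.memLp_innovFun hm hΨ u j).coeFn_toLp

theorem IsCanonical.specDens_innov (u : ℤ) (j : Fin q) : ∀ᵐ t ∂circ, ∀ p,
    specDens γ.transfer f (hc.innov hm hΨ u j) t p =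
      ex u t * star (boundary φ t p j) := by
  filter_upwards [hΨ, ae_circ.mpr hc.factorization, hm.root_spec,
    hc.coeFn_innov hm hΨ u j] with t h1 h2 ⟨_, h3, _⟩ h4 p
  have h5 : Ψ t * ((γ.weight t : ℂ) • f t) = (boundary φ t)ᴴ := by
    rw [h2, ← Matrix.mul_assoc, h1, Matrix.one_mul]
  have h6 := congrFun (congrFun h5 j) p
  rw [Matrix.conjTranspose_apply] at h6
  rw [← h6, specDens, h4, rootMul]
  simp only [Matrix.mulVec_mulVec, h3, innovFun, Matrix.mulVec_smul, Matrix.mulVec_transpose,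
    Pi.smul_apply, smul_eq_mul]
  have e2 : star (γ.transfer t) * γ.transfer t = (γ.weight t : ℂ) := by
    rw [mul_comm, Complex.star_def, Complex.mul_conj, Complex.normSq_eq_norm_sq, γ.weight_eq]
  rw [Matrix.mul_smul, Matrix.smul_apply, smul_eq_mul, Matrix.mul_apply_eq_vecMul, ← e2]
  ring

theorem IsCanonical.inner_basis_innov (m u : ℤ) (p : Fin T) (j : Fin q) :
    inner ℂ (hm.basis m p) (hc.innov hm hΨ u j) = inner ℂ (X m p) (ε u j) := by
  have h1 : inner ℂ (hm.basis m p) (hc.innov hm hΨ u j) =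
      star (∫ t, ex (m - u) t * fourierSum (-1) (fun k => φ k p j) t ∂circ) := by
    rw [hm.inner_basis, Complex.star_def, ← integral_conj]
    refine integral_congr_ae ?_
    filter_upwards [hc.specDens_innov hm hΨ u j] with t h
    rw [h, ← mul_assoc, ← ex_add, map_mul, ← Complex.star_def, star_ex, boundary, Matrix.of_apply,
      neg_sub, neg_add_eq_sub]
  rw [h1, ← inner_conj_symm, Complex.star_def]
  congr 1
  rcases lt_or_ge m u with h | h
  · rw [hc.inner_eq_zero h, show m - u = -(u - m) by ring]
    exact integral_ex_mul_fourierSum_eq_zero (by norm_num) (hc.summable_coeff p j)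
      fun k => by omega
  · obtain ⟨k, rfl⟩ : ∃ k : ℕ, m = u + k := ⟨(m - u).toNat, by omega⟩
    rw [hc.inner_eq, show u + (k : ℤ) - u = -(-1 * k) by ring]
    exact integral_ex_mul_fourierSum_coe (by norm_num) (hc.summable_coeff p j) k

/-- The innovation `ε_j(u)` belongs to the range of `V`, since it belongs to the past of the increments;
so it is determined by its inner products with them. -/
theorem IsCanonical.map_innov {V : VecL2 T →ₗᵢ[ℂ] Lp ℂ 2 P} (hV : ∀ m p, V (hm.basis m p) = X m p)
    (u : ℤ) (j : Fin q) : V (hc.innov hm hΨ u j) = ε u j := by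
  have h1 : ε u j ∈ past X u := by rw [hc.same_past]; exact mem_closedPast ε le_rfl j
  have h2 : ε u j ∈ V.toLinearMap.range := map_mem_of_mem_closedPast (ContinuousLinearMap.id ℂ _)
    (V.isometry.isClosedEmbedding.isClosed_range) (fun k _ p => LinearMap.mem_range.mpr ⟨_, hV k p⟩) h1
  obtain ⟨k, hk⟩ := h2
  change V k = _ at hk
  have h3 : (hc.innov hm hΨ u j) - k = 0 := hm.eq_zero_of_inner_basis _ fun m p => by
    rw [inner_sub_right, hc.inner_basis_innov hm hΨ, ← hk, ← hV m p, LinearIsometry.inner_map_map,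
      sub_self]
  rw [sub_eq_zero.mp h3, hk]

/-- The image in `L²([-π, π), ℂ^T)` of the error `∑_{k ≤ N} φ(k) ε(N - k)`. -/
def IsCanonical.errorElt (p : Fin T) (N : ℕ) : VecL2 T :=
  ∑ k ∈ Finset.range (N + 1), ∑ j, φ k p j • hc.innov hm hΨ (N - k) j

theorem IsCanonical.coeFn_errorElt (p : Fin T) (N : ℕ) : hc.errorElt hm hΨ p N =ᵐ[circ]
    rootMul f fun t => (γ.transfer t * ex N t) • ((Ψ t)ᵀ *ᵥ truncRow φ N p t) := by
  have h1 : ∀ᵐ t ∂circ, ∀ (k : ℕ) j, hc.innov hm hΨ (N - k) j t =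
      rootMul f (innovFun γ Ψ (N - k) j) t :=
    ae_all_iff.mpr fun k => ae_all_iff.mpr fun j => hc.coeFn_innov hm hΨ (N - k) j
  have h2 : ∀ᵐ t ∂circ, ∀ (k : ℕ) j,
      (φ k p j • hc.innov hm hΨ (N - k) j : VecL2 T) t =
        φ k p j • hc.innov hm hΨ (N - k) j t :=
    ae_all_iff.mpr fun k => ae_all_iff.mpr fun j => Lp.coeFn_smul _ _
  have h3 : ∀ᵐ t ∂circ, ∀ k : ℕ,
      (∑ j, φ k p j • hc.innov hm hΨ (N - k) j : VecL2 T) t =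
        ∑ j, (φ k p j • hc.innov hm hΨ (N - k) j : VecL2 T) t :=
    ae_all_iff.mpr fun k => Lp.coeFn_fun_finsetSum _ _
  filter_upwards [h1, h2, h3, Lp.coeFn_fun_finsetSum (Finset.range (N + 1)) (fun k =>
    ∑ j, φ k p j • hc.innov hm hΨ (N - k) j)] with t h1 h2 h3 h4
  rw [IsCanonical.errorElt, h4]
  simp only [h3, h2, h1, rootMul, ← WithLp.toLp_smul, ← Matrix.mulVec_smul, ← WithLp.toLp_sum,
    ← Matrix.mulVec_sum]
  congr 2
  ext r
  simp only [Finset.sum_apply, Pi.smul_apply, innovFun, smul_eq_mul, Matrix.mulVec, dotProduct,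
    truncRow_apply, Matrix.transpose_apply, Finset.mul_sum]
  rw [Finset.sum_comm]
  refine Finset.sum_congr rfl fun j _ => Finset.sum_congr rfl fun k _ => ?_
  rw [sub_eq_add_neg, ex_add]
  ring

theorem IsCanonical.map_errorElt {V : VecL2 T →ₗᵢ[ℂ] Lp ℂ 2 P}
    (hV : ∀ m p, V (hm.basis m p) = X m p) (p : Fin T) (N : ℕ) :
    V (hc.errorElt hm hΨ p N) = ∑ k ∈ Finset.range (N + 1), ∑ j, φ k p j • ε (N - k) j := by
  simp only [IsCanonical.errorElt, map_sum, map_smul, hc.map_innov hm hΨ hV]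

theorem IsCanonical.inner_basis_errorElt (p : Fin T) (N : ℕ) {m : ℤ} (h : m ≤ -1) (r : Fin T) :
    inner ℂ (hm.basis m r) (hc.errorElt hm hΨ p N) = 0 := by
  simp only [IsCanonical.errorElt, inner_sum, inner_smul_right, hc.inner_basis_innov hm hΨ]
  refine Finset.sum_eq_zero fun k hk => Finset.sum_eq_zero fun j _ => ?_
  have := Finset.mem_range.mp hk
  rw [← inner_conj_symm, hc.inner_eq_zero (by omega), map_zero, mul_zero]

end LeftInverse

namespace IsCanonical

variable (hc : IsCanonical γ X f ε φ)
include hc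

theorem norm_sq_error (p : Fin T) (N : ℕ) :
    ‖∑ k ∈ Finset.range (N + 1), ∑ j, φ k p j • ε (N - k) j‖ ^ 2 =
      ∑ k ∈ Finset.range (N + 1), ∑ j, ‖φ k p j‖ ^ 2 := by
  have h : Orthonormal ℂ fun a : ℕ × Fin q => ε (N - a.1) a.2 :=
    hc.orthonormal.comp (fun a : ℕ × Fin q => ((N : ℤ) - a.1, a.2)) fun a b hab => by
      simp only [Prod.mk.injEq] at hab
      exact Prod.ext (by omega) hab.2
  have h1 := h.inner_sum (fun a => φ a.1 p a.2) (fun a => φ a.1 p a.2)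
    (Finset.range (N + 1) ×ˢ Finset.univ)
  rw [inner_self_eq_norm_sq_to_K, Finset.sum_product, Finset.sum_product] at h1
  simp only [RCLike.conj_mul, Complex.coe_algebraMap] at h1
  exact_mod_cast h1

/-- What the first `N + 1` innovations do not explain of `χξ_p(N)` belongs to the past. -/
theorem sub_error_mem_past (p : Fin T) (N : ℕ) :
    X N p - ∑ k ∈ Finset.range (N + 1), ∑ j, φ k p j • ε (N - k) j ∈ past X (-1) := by
  have h := (hasSum_nat_add_iff' (N + 1)).mpr (hc.movingAverage N p)
  rw [hc.same_past]
  refine (Submodule.isClosed_topologicalClosure _).mem_of_tendsto h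
    (Filter.Eventually.of_forall fun s => ?_)
  refine Submodule.sum_mem _ fun k _ => Submodule.sum_mem _ fun j _ => Submodule.smul_mem _ _ ?_
  exact mem_closedPast ε (by push_cast; omega) j

/-- The first `N + 1` terms of the moving average are the error of the optimal estimate. -/
theorem isOptimalCharacteristic (hf : HasSpectralDensity γ P ξ X f) (hm : IsMinimal γ.transfer f)
    {V : VecL2 T →ₗᵢ[ℂ] Lp ℂ 2 P} (hV : ∀ m p, V (hm.basis m p) = X m p)
    {Ψ : ℝ → Matrix (Fin q) (Fin T) ℂ} (hΨ : ∀ᵐ t ∂circ, Ψ t * boundary φ t = 1) {N : ℕ}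
    (hN : ∀ i, N < γ.mu i * γ.s i) (p : Fin T) :
    IsOptimalCharacteristic γ ξ X f p N (canonicalCharacteristic γ φ Ψ N p)
      (∑ k ∈ Finset.range (N + 1), ∑ j, ‖φ k p j‖ ^ 2) := by
  have ht : targetElt hm p N = hm.basis N p := by
    rw [targetElt, Finset.sum_eq_single N]
    · rw [γ.dcoef_eq_ite hN (by omega), if_pos (by omega), one_smul]
    · intro k hk hkN
      have := Finset.mem_range.mp hk
      rw [γ.dcoef_eq_ite hN (by omega), if_neg (by omega), zero_smul]
    · simp
  rw [← hc.norm_sq_error, ← hc.map_errorElt hm hΨ hV, LinearIsometry.norm_map]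
  refine isOptimalCharacteristic_of_orthogonal hf hV ?_
    (fun m h r => hc.inner_basis_errorElt hm hΨ p N h r) ?_
  · rw [map_sub, ht, hV, hc.map_errorElt hm hΨ hV]
    exact hc.sub_error_mem_past p N
  · rw [ht]
    filter_upwards [Lp.coeFn_sub (hm.basis N p) (hc.errorElt hm hΨ p N),
      (hm.memLp_expFun N p).coeFn_toLp, hc.coeFn_errorElt hm hΨ p N] with t h1 h2 h3
    rw [h1, Pi.sub_apply, h3, IsMinimal.basis, h2, rootMul, rootMul, rootMul, ← WithLp.toLp_sub,
      ← Matrix.mulVec_sub]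
    congr 2
    rw [canonicalCharacteristic, smul_sub, expFun, ← Pi.single_smul', smul_eq_mul, mul_one,
      mul_comm (ex N t)]
    simp only [GMParams.transfer, ex, Int.cast_natCast]

end IsCanonical

theorem integral_truncRow (φ : ℕ → Matrix (Fin T) (Fin q) ℂ) (N : ℕ) (p : Fin T) :
    ((∑ k ∈ Finset.range (N + 1), ∑ j, ‖φ k p j‖ ^ 2 : ℝ) : ℂ) =
      ∫ t, truncRow φ N p t ⬝ᵥ star (truncRow φ N p t) ∂circ := by
  have e : ∀ t, truncRow φ N p t ⬝ᵥ star (truncRow φ N p t) =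
      ∑ j, ∑ k ∈ Finset.range (N + 1), ∑ l ∈ Finset.range (N + 1),
        (φ k p j * star (φ l p j)) * ex (l - k) t := by
    intro t
    rw [dotProduct]
    refine Finset.sum_congr rfl fun j _ => ?_
    rw [Pi.star_apply, truncRow_apply, star_sum, Finset.sum_mul_sum]
    refine Finset.sum_congr rfl fun k _ => Finset.sum_congr rfl fun l _ => ?_
    rw [star_mul', star_ex, neg_neg, sub_eq_add_neg, ex_add]
    ring
  have hi : ∀ k : ℤ, Integrable (ex k) circ := fun k => by
    simpa using integrable_ex_mul (integrable_const (1 : ℂ)) k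
  simp only [e]
  rw [integral_finsetSum _ fun j _ => integrable_finsetSum _ fun k _ =>
    integrable_finsetSum _ fun l _ => (hi _).const_mul _]
  push_cast
  rw [Finset.sum_comm]
  refine Finset.sum_congr rfl fun j _ => ?_
  rw [integral_finsetSum _ fun k _ => integrable_finsetSum _ fun l _ => (hi _).const_mul _]
  refine Finset.sum_congr rfl fun k hk => ?_
  rw [integral_finsetSum _ fun l _ => (hi _).const_mul _]
  simp only [integral_const_mul, integral_ex]
  rw [Finset.sum_eq_single k _ fun h => absurd hk h]
  · rw [sub_self, if_pos rfl, mul_one, Complex.star_def, Complex.mul_conj, Complex.normSq_eq_norm_sq]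
    push_cast; rfl
  · intro l _ hl
    rw [if_neg (by omega), mul_zero]

end

end GMForecast

end

theorem mainTheorem3 {Ω : Type*} [MeasurableSpace Ω] (P : Measure Ω) [IsProbabilityMeasure P]
    {T : ℕ} (γ : GMParams) (ξ : ℤ → Fin T → Ω → ℂ) (X : ℤ → Fin T → Lp ℂ 2 P)
    (f : ℝ → Matrix (Fin T) (Fin T) ℂ)
    (hf : HasSpectralDensity γ P ξ X f) (hmin : MinimalityCondition γ f) (p : Fin T) (N : ℕ) :
    (∃ Z, IsSpectralProcess γ X f Z) ∧
    (∃ η, IsOptimal γ ξ X p N η) ∧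
    (∀ η η', IsOptimal γ ξ X p N η → IsOptimal γ ξ X p N η' → η =ᵐ[P] η') ∧
    (∃! c : SeqSpace T, OpF γ f c (dvec γ N p)) ∧
    (∀ c : SeqSpace T, OpF γ f c (dvec γ N p) →
      ∃ Δ : ℝ, IsOptimalCharacteristic γ ξ X f p N (characteristic γ f N p c) Δ ∧
        (Δ : ℂ) = errorIntegral γ f c ∧
        (Δ : ℂ) = inner ℂ c (dvec γ N p)) ∧
    (∀ (q : ℕ) (ε : ℤ → Fin q → Lp ℂ 2 P) (φ : ℕ → Matrix (Fin T) (Fin q) ℂ),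
      IsCanonical γ X f ε φ → (∀ i, N < γ.mu i * γ.s i) →
      (∃ Ψ : ℝ → Matrix (Fin q) (Fin T) ℂ,
        ∀ᵐ t ∂volume.restrict freq, Ψ t * boundary φ t = 1) ∧
      ∀ Ψ : ℝ → Matrix (Fin q) (Fin T) ℂ,
        (∀ᵐ t ∂volume.restrict freq, Ψ t * boundary φ t = 1) →
        ∃ Δ : ℝ, IsOptimalCharacteristic γ ξ X f p N (canonicalCharacteristic γ φ Ψ N p) Δ ∧
          (Δ : ℂ) = (1 / (2 * π) : ℂ) *
            ∫ t in freq, truncRow φ N p t ⬝ᵥ star (truncRow φ N p t) ∧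
          Δ = ∑ k ∈ Finset.range (N + 1), ∑ j, ‖φ k p j‖ ^ 2) := by
  have hm := hf.isMinimal hmin
  obtain ⟨V, hV⟩ := hf.exists_isometry hm
  -- the error `e` of the projection in the frequency domain, and the solution `c` of `F_μ c = d_{μ,N,p}`
  obtain ⟨e, c, hmem, hort, hc, hser, hdual⟩ :=
    hm.exists_prediction (fun k => γ.dcoef (N - k)) N p
  have hY : V (targetElt hm p N - e) ∈ past X (-1) :=
    map_mem_of_mem_closedPast V.toContinuousLinearMap (Submodule.isClosed_topologicalClosure _)
      (fun k hk r => by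
        change V (hm.basis k r) ∈ _
        rw [hV]; exact mem_closedPast X hk r) hmem
  have hoptimal : ∀ η, IsOptimal γ ξ X p N η ↔
      η =ᵐ[P] estimate γ ξ p N (V (targetElt hm p N - e)) := fun η => by
    refine isOptimal_iff hf.increment hY fun W hW => ?_
    refine inner_eq_zero_of_mem_closedPast (fun k hk r => ?_) hW
    rw [map_sub, map_targetElt hV, sub_sub_cancel, ← hV, LinearIsometry.inner_map_map,
      ← inner_conj_symm, hort k hk, map_zero]
  have hdvec : ∀ (j : ℕ) r, inner ℂ (hm.dual j r) e = dvec γ N p j r := fun j r => by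
    rw [hdual, dvec_apply]
  have huniq : ∀ d : SeqSpace T, OpF γ f d (dvec γ N p) → d = c := fun d hd => by
    obtain ⟨k, hk, hkd⟩ := (opF_iff hm d _).mp hd
    exact (hm.unique_of_inner_dual hk hser fun j r => by rw [hkd, hdvec]).2
  -- as the solution is unique, the formulas need to be verified only for the sequence `c` of the error
  refine ⟨exists_isSpectralProcess hm hV, ⟨_, (hoptimal _).mpr Filter.EventuallyEq.rfl⟩,
    fun η η' h h' => ((hoptimal η).mp h).trans ((hoptimal η').mp h').symm,
    ⟨c, (opF_iff hm c _).mpr ⟨e, hser, hdvec⟩, huniq⟩, fun d hd => ?_, fun q ε φ hcan hN => ?_⟩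
  · rw [huniq d hd]
    exact ⟨‖e‖ ^ 2, isOptimalCharacteristic_of_orthogonal hf hV hY hort
      (coeFn_targetElt_sub hm p N hser), errorIntegral_eq hm hser, inner_dvec_eq hm hmem hort hc⟩
  · obtain ⟨Ψ, hΨ⟩ := hcan.exists_leftInverse hm
    refine ⟨⟨Ψ, ae_circ.mp hΨ⟩, fun Ψ hΨ => ⟨_, hcan.isOptimalCharacteristic hf hm hV
      (ae_circ.mpr hΨ) hN p, ?_, rfl⟩⟩
    rw [integral_truncRow, integral_circ]
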